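/- Let $s>0$, $1\le p<\infty$, $sp\ge 1$. Write $m=\lfloor s\rfloor$ and $\sigma=s-m$, and let $W^{s,p}(\mathbb S^1;\mathbb C)$ be the Sobolev space of functions on the unit circle whose weak (angular) derivatives $h,\dot h,\dots,h^{(m)}$ are in $L^p$ and for which $|h|_{s,p}<\infty$, where $|h|_{s,p}:=\|h^{(m)}\|_{L^p(\mathbb S^1)}$ if $\sigma=0$, and $$|h|_{s,p}:=\left(\int_{\mathbb S^1}\int_{\mathbb S^1}\frac{|h^{(m)}(x)-h^{(m)}(y)|^p}{|x-y|^{1+\sigma p}}\,dx\,dy\right)^{1/p}\quad\text{if }0<\sigma<1 .$$ The standard norm is $\|h\|_{W^{s,p}}:=\sum_{k=0}^m\|h^{(k)}\|_{L^p}+|h|_{s,p}$. For $d\in\mathbb Z$ let $\mathcal E_d$ be the set of $f\in W^{s,p}(\mathbb S^1;\mathbb S^1)$ (that is, $f\in W^{s,p}(\mathbb S^1;\mathbb C)$ with $|f|=1$) of degree $d$, where the degree of $f$ is the Brezis–Nirenberg (VMO) degree: the winding number around $0$ of the continuous map $z\mapsto\frac1{2\varepsilon}\int_{-\varepsilon}^{\varepsilon}f(ze^{it})\,dt$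 for all sufficiently small $\varepsilon>0$. For a functional $\delta$ on $W^{s,p}(\mathbb S^1;\mathbb C)$ with values in $[0,\infty]$ put $$\operatorname{Dist}_{\delta}(\mathcal E_{d_1},\mathcal E_{d_2}):=\sup_{f\in\mathcal E_{d_1}}\inf_{g\in\mathcal E_{d_2}}\delta(f-g),\qquad H\text{-}\operatorname{dist}_{\delta}(\mathcal E_{d_1},\mathcal E_{d_2}):=\max\{\operatorname{Dist}_{\delta}(\mathcal E_{d_1},\mathcal E_{d_2}),\operatorname{Dist}_{\delta}(\mathcal E_{d_2},\mathcal E_{d_1})\}.$$ Say that $\delta$ is admissible for $W^{s,p}$ if either $\delta(h)=|h|_{s,p}$ or $\delta(h)=N\big(h-\frac1{2\pi}\int_{\mathbb S^1}h\big)$, where $N$ is any norm on $W^{s,p}(\mathbb S^1;\mathbb C)$ equivalent to $\|\cdot\|_{W^{s,p}}$ (or, more generally, any functional with $c\|h\|_{W^{s,p}}\le N(h)\le C\|h\|_{W^{s,p}}$ for some constants $c>0$, $C<\infty$). **Theorem 1.3.** 1. In $W^{1,1}$, with $\delta(h)=|h|_{1,1}=\int_{\mathbb S^1}|\dot h|$: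 $\operatorname{Dist}_{\delta}(\mathcal E_{d_1},\mathcal E_{d_2})=2\pi|d_1-d_2|$ for all $d_1,d_2\in\mathbb Z$. 2. If $1<p<\infty$ and $\delta$ is admissible for $W^{1/p,p}$, then there is a finite constant $C$, depending only on $p$ and $\delta$, such that in $W^{1/p,p}$ we have $H\text{-}\operatorname{dist}_{\delta}(\mathcal E_{d_1},\mathcal E_{d_2})\le C\,|d_1-d_2|^{1/p}$ for all $d_1,d_2\in\mathbb Z$. 3. If $s>0$ and $1\le p<\infty$ are such that $sp>1$, and $\delta$ is admissible for $W^{s,p}$, then in $W^{s,p}$ we have $\operatorname{Dist}_{\delta}(\mathcal E_{d_1},\mathcal E_{d_2})=\infty$ for all $d_1,d_2\in\mathbb Z$ with $d_1\ne d_2$. -/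

import Mathlib

open MeasureTheory Filter Topology
open scoped ENNReal NNReal ContDiff

namespace CircleSobolev

noncomputable instance instMeasurableSpaceCircle : MeasurableSpace Circle := borel Circle

instance instBorelSpaceCircle : BorelSpace Circle := ⟨rfl⟩

/-- Arc length on the unit circle, a measure of total mass `2π`. -/
noncomputable def arcLength : Measure Circle :=
  (volume.restrict (Set.Ioc (-Real.pi) Real.pi)).map Circle.exp

/-- The derivative `dη/dθ` of a function on the circle at the point `z`. -/
noncomputable def angularDeriv (η : Circle → ℝ) (z : Circle) : ℝ :=
  deriv (fun t : ℝ => η (z * Circle.exp t)) 0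

/-- Smooth real test functions on the circle. -/
def IsTestFunction (η : Circle → ℝ) : Prop :=
  ContDiff ℝ ∞ (fun θ : ℝ => η (Circle.exp θ))

/-- `g` is a weak (angular) derivative of `f` on the circle. -/
def IsWeakDeriv (f g : Circle → ℂ) : Prop :=
  Integrable f arcLength ∧ Integrable g arcLength ∧
    ∀ η : Circle → ℝ, IsTestFunction η →
      ∫ z, angularDeriv η z • f z ∂arcLength = -∫ z, η z • g z ∂arcLength

def WeaklyDifferentiable (f : Circle → ℂ) : Prop := ∃ g, IsWeakDeriv f g

open Classical in
/-- The weak derivative (unique up to a null set), and `0` if there is none. -/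
noncomputable def weakDeriv (f : Circle → ℂ) : Circle → ℂ :=
  if h : WeaklyDifferentiable f then h.choose else 0

/-- The Gagliardo semi-norm
`(∫∫ |f x - f y| ^ p / |x - y| ^ (1 + σ p) dx dy) ^ (1 / p)`; `dist` on `Circle` is the chordal
distance `|x - y|`. -/
noncomputable def gagliardo (σ p : ℝ) (f : Circle → ℂ) : ℝ≥0∞ :=
  (∫⁻ x, ∫⁻ y, ENNReal.ofReal (‖f x - f y‖ ^ p / dist x y ^ (1 + σ * p))
    ∂arcLength ∂arcLength) ^ (1 / p)

open Classical in
/-- The top-order `W^{s,p}` semi-norm. With `m = ⌊s⌋`, it is the `L^p` norm of the `m`-th weak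
derivative if `s = m`, and its Gagliardo semi-norm of order `s - m` otherwise. -/
noncomputable def seminorm (s p : ℝ) (f : Circle → ℂ) : ℝ≥0∞ :=
  if s = ⌊s⌋₊ then eLpNorm (weakDeriv^[⌊s⌋₊] f) (ENNReal.ofReal p) arcLength
  else gagliardo (s - ⌊s⌋₊) p (weakDeriv^[⌊s⌋₊] f)

/-- Membership in `W^{s,p}(S¹; ℂ)`, for real `s > 0` and `1 ≤ p < ∞`: the weak derivatives of
order at most `⌊s⌋` exist and are in `L^p`, and the top-order semi-norm is finite. -/
structure MemSobolev (s p : ℝ) (f : Circle → ℂ) : Prop where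
  differentiable : ∀ k < ⌊s⌋₊, WeaklyDifferentiable (weakDeriv^[k] f)
  memLp : ∀ k ≤ ⌊s⌋₊, MemLp (weakDeriv^[k] f) (ENNReal.ofReal p) arcLength
  seminorm_lt_top : seminorm s p f < ⊤

/-- The standard (full) norm of `W^{s,p}(S¹; ℂ)`. -/
noncomputable def fullNorm (s p : ℝ) (f : Circle → ℂ) : ℝ≥0∞ :=
  (∑ k ∈ Finset.range (⌊s⌋₊ + 1), eLpNorm (weakDeriv^[k] f) (ENNReal.ofReal p) arcLength) +
    seminorm s p f

/-- `N` is comparable on `W^{s,p}(S¹; ℂ)` to the standard norm; every equivalent norm is such. -/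
def IsComparableToNorm (s p : ℝ) (N : (Circle → ℂ) → ℝ≥0∞) : Prop :=
  ∃ c C : ℝ≥0, 0 < c ∧ ∀ h : Circle → ℂ, MemSobolev s p h →
    c * fullNorm s p h ≤ N h ∧ N h ≤ C * fullNorm s p h

/-- The quantity `N (h - ⨍ h)`. -/
noncomputable def moduloMean (N : (Circle → ℂ) → ℝ≥0∞) (h : Circle → ℂ) : ℝ≥0∞ :=
  N (fun z => h z - ⨍ w, h w ∂arcLength)

/-- `F` is a nowhere vanishing continuous map on the circle and its winding number around `0`
(the degree of `F / |F|`) is `d`: its argument has a continuous determination `φ` along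
`θ ↦ e^{iθ}`, which grows by `2πd` over one turn. -/
def HasContinuousDegree (F : Circle → ℂ) (d : ℤ) : Prop :=
  Continuous F ∧ (∀ z, F z ≠ 0) ∧ ∃ φ : ℝ → ℝ, Continuous φ ∧
    (∀ θ, F (Circle.exp θ) = ‖F (Circle.exp θ)‖ * Circle.exp (φ θ)) ∧
    ∀ θ, φ (θ + 2 * Real.pi) = φ θ + 2 * Real.pi * d

/-- The mean of `f` over the arc of length `2ε` centred at `z`. -/
noncomputable def arcMean (f : Circle → ℂ) (ε : ℝ) (z : Circle) : ℂ :=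
  ((2 * ε)⁻¹ : ℝ) • ∫ t in (-ε)..ε, f (z * Circle.exp t)

/-- The Brezis-Nirenberg degree of a (possibly discontinuous, VMO) map `f : S¹ → S¹`: it is the
degree of the means of `f` over arcs of radius `ε`, for all small `ε > 0`. -/
def HasDegree (f : Circle → Circle) (d : ℤ) : Prop :=
  ∀ᶠ ε in 𝓝[>] (0 : ℝ), HasContinuousDegree (arcMean (fun z => (f z : ℂ)) ε) d

/-- The class `E_d` in `W^{s,p}(S¹; S¹)`. -/
def degreeClass (s p : ℝ) (d : ℤ) : Set (Circle → Circle) :=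
  {f | MemSobolev s p (fun z => (f z : ℂ)) ∧ HasDegree f d}

/-- The one-sided distance `sup_{f ∈ E_{d₁}} inf_{g ∈ E_{d₂}} δ (f - g)` in `W^{s,p}(S¹; S¹)`,
measured with the functional `δ`. -/
noncomputable def Dist (δ : (Circle → ℂ) → ℝ≥0∞) (s p : ℝ) (d₁ d₂ : ℤ) : ℝ≥0∞ :=
  ⨆ f ∈ degreeClass s p d₁, ⨅ g ∈ degreeClass s p d₂, δ (fun z => (f z : ℂ) - (g z : ℂ))

/-- The Hausdorff distance between `E_{d₁}` and `E_{d₂}`. -/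
noncomputable def HDist (δ : (Circle → ℂ) → ℝ≥0∞) (s p : ℝ) (d₁ d₂ : ℤ) : ℝ≥0∞ :=
  max (Dist δ s p d₁ d₂) (Dist δ s p d₂ d₁)

end CircleSobolev

/-! Two families of maps carry the proof: concentrating bubbles for the upper bounds, oscillating
maps for the lower bounds.

Bubbles. To pass from degree d₁ to d₂, multiply f by b, the power D = d₂ - d₁ of the Möbius map (a -
z)/(1 - az) with a → 1. Then b → 1 away from the point 1, and |b'| is |D| times the Poisson kernel
P, which has mass 2π. In W^{1,1}, (f - fb)' = f'(1 - b) - f b'; the first term tends to 0 in L¹ by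
dominated convergence and the second has norm exactly 2π|D| (`dist_one_one_le`). In W^{1/p,p} the
same splitting of differences leaves the energy of b. Since |b(x) - b(y)| ≤ min(2, |D| max(P(x),
P(y)) |x - y|), and the integral in y of min(2, l|x - y|)^p |x - y|⁻² is at most C l, this energy is
at most C|D|, uniformly in a (`exists_gagliardoEnergy_bubble_le`). Finite critical energy forces
vanishing mean oscillation, so arc means of f stay away from 0 and the degrees of f and b add
(`eventually_norm_arcMean_ge`, `HasDegree.mul_phase`).

Oscillating maps. Let f = exp(i(d₁θ + δ sin nθ)), let g have values in the circle and V = f - g. On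
each oscillation f passes through three points spaced by an angle γ close to δ. If V were constant
at that scale, one translation would send three points of the circle into the circle, which only the
zero translation does. Quantitatively, if V varies by at most η on the scale 2π/n, then (1 - cos
γ)|V|² ≤ 20η (`wiggle_sub_norm_sq_le`).

When sp > 1, the Sobolev embedding bounds the modulus of continuity of V by its top-order semi-norm
(`exists_continuous_version`). If that semi-norm stayed below M, then for n large V would be nearly
constant at scale 2π/n, hence |f - g| < 2; maps that are nowhere antipodal have equal degrees, so d₁
= d₂ (`exists_large_distance`).

In W^{1,1}, write B = ∫|V'| and let φ be the phase of f. From Im(f' ḡ) = φ'(1 - |V|²/2) one gets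
2π(d₁ - d₂) = ∫ Im(V' ḡ) + ½∫φ'|V|². The first integral is at most B. In the second, the part δn cos
nθ of φ' contributes at most 2δB after an integration by parts, and the part d₁ contributes O(B/n),
because the three-point estimate integrates to ∫|V|² ≤ C B/n. Letting n → ∞ and δ → 0 gives B ≥
2π|d₁ - d₂| in the limit (`two_pi_mul_abs_sub_le`, `exists_forall_dist_ge`). -/

namespace CircleSobolev

/-! ### Arc length -/

/-- The parametrization of the circle by `(-π, π]`. -/
noncomputable def expIoc (t : Set.Ioc (-Real.pi) Real.pi) : Circle := Circle.exp t

/-- Injectivity on a half-open period makes the parametrization a measurable embedding, so the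
change of variables formulas built on it hold for arbitrary integrands, with no measurability to
check. -/
theorem measurableEmbedding_expIoc : MeasurableEmbedding expIoc := by
  have h : Continuous expIoc := Circle.exp.continuous.comp continuous_subtype_val
  have := (measurableSet_Ioc (a := -Real.pi) (b := Real.pi)).standardBorel
  refine h.measurable.measurableEmbedding fun s t hst => Subtype.ext ?_
  exact Circle.exp_injOn_Ioc (by linarith) s.2 t.2 hst

theorem arcLength_eq :
    arcLength = (Measure.comap Subtype.val (volume : Measure ℝ)).map expIoc := by
  have : expIoc = Circle.exp ∘ Subtype.val := rfl
  rw [this, ← Measure.map_map Circle.exp.continuous.measurable measurable_subtype_coe,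
    map_comap_subtype_coe measurableSet_Ioc, arcLength]

theorem lintegral_arcLength (F : Circle → ℝ≥0∞) :
    ∫⁻ z, F z ∂arcLength = ∫⁻ t in Set.Ioc (-Real.pi) Real.pi, F (Circle.exp t) := by
  rw [arcLength_eq, measurableEmbedding_expIoc.lintegral_map,
    ← lintegral_subtype_comap measurableSet_Ioc]
  rfl

theorem periodic_comp_exp {α : Type*} (F : Circle → α) :
    Function.Periodic (fun t : ℝ => F (Circle.exp t)) (2 * Real.pi) := fun t => by
  simp

theorem setLIntegral_Ioc_periodic {F : ℝ → ℝ≥0∞} {T : ℝ} (hT : 0 < T)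
    (hF : Function.Periodic F T) (a b : ℝ) :
    ∫⁻ t in Set.Ioc a (a + T), F t = ∫⁻ t in Set.Ioc b (b + T), F t := by
  refine (isAddFundamentalDomain_Ioc hT a).setLIntegral_eq (isAddFundamentalDomain_Ioc hT b) F ?_
  rintro ⟨g, hg⟩ x
  obtain ⟨n, rfl⟩ := AddSubgroup.mem_zmultiples_iff.1 hg
  rw [AddSubgroup.vadd_def, vadd_eq_add, add_comm]
  exact hF.zsmul n x

theorem lintegral_arcLength' (F : Circle → ℝ≥0∞) (a : ℝ) :
    ∫⁻ z, F z ∂arcLength = ∫⁻ t in Set.Ioc a (a + 2 * Real.pi), F (Circle.exp t) := by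
  rw [lintegral_arcLength, setLIntegral_Ioc_periodic (F := fun t => F (Circle.exp t))
    (by positivity) (periodic_comp_exp F) a (-Real.pi)]
  congr 3
  ring

theorem integral_arcLength {E : Type*} [NormedAddCommGroup E] [NormedSpace ℝ E] (F : Circle → E) :
    ∫ z, F z ∂arcLength = ∫ t in (-Real.pi)..Real.pi, F (Circle.exp t) := by
  rw [arcLength_eq, measurableEmbedding_expIoc.integral_map,
    intervalIntegral.integral_of_le (by linarith [Real.pi_pos]),
    ← integral_subtype_comap measurableSet_Ioc]
  rfl

theorem integral_arcLength' {E : Type*} [NormedAddCommGroup E] [NormedSpace ℝ E]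
    (F : Circle → E) (a : ℝ) :
    ∫ z, F z ∂arcLength = ∫ t in a..(a + 2 * Real.pi), F (Circle.exp t) := by
  rw [integral_arcLength, (periodic_comp_exp F).intervalIntegral_add_eq a (-Real.pi)]
  congr 1
  ring

theorem ae_arcLength_iff_interval {P : Circle → Prop} :
    (∀ᵐ z ∂arcLength, P z) ↔
      ∀ᵐ t ∂(volume.restrict (Set.Ioc (-Real.pi) Real.pi)), P (Circle.exp t) := by
  rw [arcLength_eq, measurableEmbedding_expIoc.ae_map_iff,
    ← map_comap_subtype_coe measurableSet_Ioc,
    (MeasurableEmbedding.subtype_coe measurableSet_Ioc).ae_map_iff]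
  rfl

/-- Countably many translates of one period cover the line, so null sets of the circle can be read
on all of ℝ, with no choice of base point. -/
theorem ae_arcLength_iff {P : Circle → Prop} :
    (∀ᵐ z ∂arcLength, P z) ↔ ∀ᵐ t : ℝ, P (Circle.exp t) := by
  rw [ae_arcLength_iff_interval]
  constructor
  · intro h
    have h2 : ∀ n : ℤ, ∀ᵐ t ∂(volume : Measure ℝ),
        t + n • (2 * Real.pi) ∈ Set.Ioc (-Real.pi) (-Real.pi + 2 * Real.pi) →
          P (Circle.exp t) := by
      intro n
      rw [ae_restrict_iff' measurableSet_Ioc] at h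
      have := (measurePreserving_add_right (volume : Measure ℝ)
        (n • (2 * Real.pi))).quasiMeasurePreserving.ae h
      filter_upwards [this] with t ht hmem
      have h3 := ht ⟨by linarith [hmem.1], by linarith [hmem.2]⟩
      rwa [show Circle.exp (t + n • (2 * Real.pi)) = Circle.exp t from
        Circle.periodic_exp.zsmul n t] at h3
    filter_upwards [ae_all_iff.2 h2] with t ht
    obtain ⟨n, hn, -⟩ := existsUnique_add_zsmul_mem_Ioc Real.two_pi_pos t (-Real.pi)
    exact ht n hn
  · exact fun h => ae_restrict_of_ae h

theorem arcLength_univ : arcLength Set.univ = ENNReal.ofReal (2 * Real.pi) := by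
  rw [← lintegral_one, lintegral_arcLength]
  simp [two_mul]

instance : IsFiniteMeasure arcLength := ⟨by rw [arcLength_univ]; exact ENNReal.ofReal_lt_top⟩

theorem map_mul_arcLength (w : Circle) : arcLength.map (fun z => w * z) = arcLength := by
  have hm : Measurable (fun z : Circle => w * z) := (continuous_const_mul w).measurable
  obtain ⟨s, rfl⟩ := Circle.exp_surjective w
  refine Measure.ext fun A hA => ?_
  rw [← lintegral_indicator_one hA, ← lintegral_indicator_one hA,
    lintegral_map (measurable_one.indicator hA) hm, lintegral_arcLength' _ (-Real.pi),
    lintegral_arcLength' _ (-Real.pi + s)]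
  have := (measurePreserving_add_left (volume : Measure ℝ) s).setLIntegral_comp_preimage_emb
    (measurableEmbedding_addLeft s) (fun t => A.indicator (1 : Circle → ℝ≥0∞) (Circle.exp t))
    (Set.Ioc (-Real.pi + s) (-Real.pi + s + 2 * Real.pi))
  rw [← this]
  congr 1
  · congr 1
    ext t
    simp only [Set.mem_Ioc, Set.mem_preimage]
    constructor <;> rintro ⟨h1, h2⟩ <;> constructor <;> linarith
  · ext t
    rw [Circle.exp_add]

theorem lintegral_mul_left_arcLength (F : Circle → ℝ≥0∞) (w : Circle) :
    ∫⁻ z, F (w * z) ∂arcLength = ∫⁻ z, F z ∂arcLength := by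
  conv_rhs => rw [← map_mul_arcLength w]
  exact ((Homeomorph.mulLeft w).measurableEmbedding.lintegral_map F).symm

theorem lintegral_mul_exp_arcLength (F : Circle → ℝ≥0∞) (s : ℝ) :
    ∫⁻ z, F (z * Circle.exp s) ∂arcLength = ∫⁻ z, F z ∂arcLength := by
  simp_rw [mul_comm _ (Circle.exp s)]
  exact lintegral_mul_left_arcLength F _

theorem quasiMeasurePreserving_exp :
    Measure.QuasiMeasurePreserving (fun t : ℝ => Circle.exp t) volume arcLength := by
  refine ⟨Circle.exp.continuous.measurable, Measure.AbsolutelyContinuous.mk fun A hA h => ?_⟩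
  rw [Measure.map_apply Circle.exp.continuous.measurable hA]
  have : ∀ᵐ z ∂arcLength, z ∉ A := measure_eq_zero_iff_ae_notMem.1 h
  exact measure_eq_zero_iff_ae_notMem.2 (ae_arcLength_iff.1 this)

theorem eq_of_ae_eq_of_continuous {E : Type*} [TopologicalSpace E] [T2Space E] {F G : Circle → E}
    (hF : Continuous F) (hG : Continuous G) (h : F =ᵐ[arcLength] G) : F = G := by
  have h1 : (fun t : ℝ => F (Circle.exp t)) =ᵐ[volume] fun t => G (Circle.exp t) :=
    ae_arcLength_iff.1 h
  have h2 := (Continuous.ae_eq_iff_eq volume (by fun_prop) (by fun_prop)).1 h1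
  funext z
  obtain ⟨t, rfl⟩ := Circle.exp_surjective z
  exact congrFun h2 t

theorem continuous_of_comp_exp {E : Type*} [TopologicalSpace E] {F : Circle → E}
    (h : Continuous fun t : ℝ => F (Circle.exp t)) : Continuous F := by
  rw [isLocalHomeomorph_circleExp.isOpenMap.isQuotientMap Circle.exp.continuous
    Circle.exp_surjective |>.continuous_iff]
  exact h

theorem exists_lift_of_periodic {E : Type*} {u : ℝ → E}
    (h : Function.Periodic u (2 * Real.pi)) : ∃ U : Circle → E, ∀ t, U (Circle.exp t) = u t := by
  refine ⟨fun z => u (Complex.arg z), fun t => ?_⟩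
  obtain ⟨n, hn⟩ := Circle.exp_eq_exp.1 (Circle.exp_arg (Circle.exp t))
  simp only
  rw [hn]
  simpa using h.int_mul n t

theorem integrable_arcLength_iff {E : Type*} [NormedAddCommGroup E] {F : Circle → E} :
    Integrable F arcLength ↔
      IntegrableOn (fun t => F (Circle.exp t)) (Set.Ioc (-Real.pi) Real.pi) := by
  rw [arcLength_eq, measurableEmbedding_expIoc.integrable_map_iff,
    IntegrableOn, ← map_comap_subtype_coe measurableSet_Ioc,
    (MeasurableEmbedding.subtype_coe measurableSet_Ioc).integrable_map_iff]
  rfl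

theorem intervalIntegrable_comp_exp {E : Type*} [NormedAddCommGroup E] {F : Circle → E}
    (h : Integrable F arcLength) (a b : ℝ) :
    IntervalIntegrable (fun t => F (Circle.exp t)) volume a b := by
  refine (periodic_comp_exp F).intervalIntegrable (by positivity) (t := -Real.pi) ?_ a b
  rw [intervalIntegrable_iff_integrableOn_Ioc_of_le (by linarith [Real.pi_pos]),
    show -Real.pi + 2 * Real.pi = Real.pi by ring]
  exact integrable_arcLength_iff.1 h

/-! ### Primitives of locally integrable functions -/

/-- `U` is a primitive of the locally integrable function `u`. -/
def IsPrimitive (U u : ℝ → ℂ) : Prop :=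
  ∀ a b : ℝ, IntervalIntegrable u volume a b ∧ U b - U a = ∫ t in a..b, u t

namespace IsPrimitive

variable {U u V v : ℝ → ℂ}

theorem eq_add (h : IsPrimitive U u) (a t : ℝ) : U t = U a + ∫ s in a..t, u s := by
  rw [← (h a t).2]; ring

theorem continuous (h : IsPrimitive U u) : Continuous U := by
  have : U = fun t => U 0 + ∫ s in (0 : ℝ)..t, u s := funext (h.eq_add 0)
  rw [this]
  exact continuous_const.add (intervalIntegral.continuous_primitive (fun a b => (h a b).1) 0)

theorem ae_hasDerivAt (h : IsPrimitive U u) : ∀ᵐ t, HasDerivAt U (u t) t := by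
  have hU : U = fun t => U 0 + ∫ s in (0 : ℝ)..t, u s := funext (h.eq_add 0)
  have hl : LocallyIntegrable u volume := by
    intro x
    refine ⟨Set.Ioc (x - 1) (x + 1), Ioc_mem_nhds (by linarith) (by linarith), ?_⟩
    exact (intervalIntegrable_iff_integrableOn_Ioc_of_le (by linarith)).1 (h _ _).1
  filter_upwards [_root_.LocallyIntegrable.ae_hasDerivAt_integral hl] with t ht
  rw [hU]
  exact (ht 0).const_add _

theorem absolutelyContinuousOnInterval_const {E : Type*} [NormedAddCommGroup E] (c : E)
    (a b : ℝ) : AbsolutelyContinuousOnInterval (fun _ : ℝ => c) a b :=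
  (LipschitzWith.const c).lipschitzOnWith.absolutelyContinuousOnInterval

theorem absolutelyContinuousOnInterval (h : IsPrimitive U u) (a b : ℝ) :
    AbsolutelyContinuousOnInterval U a b := by
  have hi := (h a b).1
  have hre : IntervalIntegrable (fun t => (u t).re) volume a b := ⟨hi.1.re, hi.2.re⟩
  have him : IntervalIntegrable (fun t => (u t).im) volume a b := ⟨hi.1.im, hi.2.im⟩
  have h1 := hre.absolutelyContinuousOnInterval_intervalIntegral (c := a) (by simp)
  have h2 := him.absolutelyContinuousOnInterval_intervalIntegral (c := a) (by simp)
  have h3 := (absolutelyContinuousOnInterval_const (U a) a b).add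
    ((h1.smul (absolutelyContinuousOnInterval_const (1 : ℂ) a b)).add
      (h2.smul (absolutelyContinuousOnInterval_const Complex.I a b)))
  rw [show U = _ from funext fun t => ?_]
  · exact h3
  have ht := (h a t).1
  simp only [Pi.add_apply, Pi.smul_apply', Complex.real_smul]
  rw [h.eq_add a t, mul_one]
  congr 1
  apply Complex.ext
  · have := Complex.reCLM.intervalIntegral_comp_comm ht
    simpa using this.symm
  · have := Complex.imCLM.intervalIntegral_comp_comm ht
    simpa using this.symm

/-- `U` minus the integral of `u` is absolutely continuous with derivative zero almost everywhere,
hence constant. Product and chain rules are thereby reduced to absolute continuity and a pointwise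
derivative. -/
theorem of_absolutelyContinuous (hU : ∀ a b, AbsolutelyContinuousOnInterval U a b)
    (hu : ∀ a b, IntervalIntegrable u volume a b) (hd : ∀ᵐ t, HasDerivAt U (u t) t) :
    IsPrimitive U u := by
  intro a b
  refine ⟨hu a b, ?_⟩
  have hP : IsPrimitive (fun t => ∫ s in a..t, u s) u := fun c d =>
    ⟨hu c d, intervalIntegral.integral_interval_sub_left (hu _ _) (hu _ _)⟩
  obtain ⟨C, hC⟩ := ((hU a b).sub (hP.absolutelyContinuousOnInterval a
    b)).const_of_ae_hasDerivAt_zero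
    (by
      filter_upwards [hd, hP.ae_hasDerivAt] with t h1 h2 _
      simpa using! h1.sub h2)
  have h1 := hC a (by simp)
  have h2 := hC b (by simp)
  simp only [Pi.sub_apply, intervalIntegral.integral_same, sub_zero] at h1 h2
  rw [h1, ← h2]
  ring

theorem mul (hU : IsPrimitive U u) (hV : IsPrimitive V v) :
    IsPrimitive (fun t => U t * V t) (fun t => u t * V t + U t * v t) := by
  refine of_absolutelyContinuous (fun a b => ?_) (fun a b => ?_) ?_
  · exact (hU.absolutelyContinuousOnInterval a b).smul (hV.absolutelyContinuousOnInterval a b)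
  · exact ((hU a b).1.mul_continuousOn hV.continuous.continuousOn).add
      ((hV a b).1.continuousOn_mul hU.continuous.continuousOn)
  · filter_upwards [hU.ae_hasDerivAt, hV.ae_hasDerivAt] with t h1 h2
    exact h1.mul h2

theorem of_hasDerivAt (h : ∀ t, HasDerivAt U (u t) t) (hu : Continuous u) : IsPrimitive U u :=
  fun a b => ⟨hu.intervalIntegrable a b,
    (intervalIntegral.integral_eq_sub_of_hasDerivAt (fun t _ => h t)
      (hu.intervalIntegrable a b)).symm⟩

theorem sub (hU : IsPrimitive U u) (hV : IsPrimitive V v) :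
    IsPrimitive (fun t => U t - V t) (fun t => u t - v t) := fun a b =>
  ⟨(hU a b).1.sub (hV a b).1, by
    rw [intervalIntegral.integral_sub (hU a b).1 (hV a b).1, ← (hU a b).2, ← (hV a b).2]; ring⟩

theorem conj (hU : IsPrimitive U u) :
    IsPrimitive (fun t => starRingEnd ℂ (U t)) (fun t => starRingEnd ℂ (u t)) := fun a b => by
  have hi := (hU a b).1
  refine ⟨⟨Complex.conjCLE.toContinuousLinearMap.integrable_comp hi.1,
    Complex.conjCLE.toContinuousLinearMap.integrable_comp hi.2⟩, ?_⟩
  rw [← map_sub, (hU a b).2]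
  exact (Complex.conjCLE.toContinuousLinearMap.intervalIntegral_comp_comm hi).symm

theorem congr_ae {u' : ℝ → ℂ} (hU : IsPrimitive U u) (h : u =ᵐ[volume] u') : IsPrimitive U u' :=
  fun a b => ⟨(hU a b).1.congr_ae (ae_restrict_of_ae h), by
    rw [(hU a b).2]
    exact intervalIntegral.integral_congr_ae (h.mono fun t ht _ => ht)⟩

theorem norm_sub_le (hU : IsPrimitive U u) {a b : ℝ} (hab : a ≤ b) :
    ‖U b - U a‖ₑ ≤ ∫⁻ t in Set.Ioc a b, ‖u t‖ₑ := by
  rw [(hU a b).2, intervalIntegral.integral_of_le hab]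
  exact enorm_integral_le_lintegral_enorm _

end IsPrimitive

/-! ### Weak derivatives -/

theorem angularDeriv_exp (η : Circle → ℝ) (θ : ℝ) :
    angularDeriv η (Circle.exp θ) = deriv (fun t : ℝ => η (Circle.exp t)) θ := by
  rw [angularDeriv]
  simp_rw [← Circle.exp_add]
  rw [deriv_comp_const_add (fun t : ℝ => η (Circle.exp t)) θ 0, add_zero]

theorem IsTestFunction.continuous {η : Circle → ℝ} (h : IsTestFunction η) : Continuous η :=
  continuous_of_comp_exp (ContDiff.continuous h)

theorem continuous_angularDeriv {η : Circle → ℝ} (h : IsTestFunction η) :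
    Continuous (angularDeriv η) := by
  refine continuous_of_comp_exp ?_
  simp_rw [angularDeriv_exp]
  exact ContDiff.continuous_deriv h (by norm_num)

theorem integrable_continuous_smul {η : Circle → ℝ} {f : Circle → ℂ} (hη : Continuous η)
    (hf : Integrable f arcLength) : Integrable (fun z => η z • f z) arcLength := by
  obtain ⟨C, hC⟩ := isCompact_univ.exists_bound_of_continuousOn hη.continuousOn
  exact hf.bdd_smul C hη.aestronglyMeasurable (Eventually.of_forall fun z => hC z trivial)

/-- The fundamental lemma of the calculus of variations on the circle as a manifold: a smooth
function there becomes smooth on ℝ after composition with `Circle.exp`, so it is a test function in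
the present sense. -/
theorem ae_eq_zero_of_forall_test {h : Circle → ℂ} (hi : Integrable h arcLength)
    (H : ∀ η, IsTestFunction η → ∫ z, η z • h z ∂arcLength = 0) : h =ᵐ[arcLength] 0 := by
  have : Fact (Module.finrank ℝ ℂ = 1 + 1) := ⟨by simp⟩
  refine ae_eq_zero_of_integral_contMDiff_smul_eq_zero (modelWithCornersSelf ℝ
    (EuclideanSpace ℝ (Fin 1))) hi.locallyIntegrable fun g hg _ => H g ?_
  have h1 := hg.comp (contMDiff_circleExp (m := ∞))
  exact h1.contDiff

theorem IsWeakDeriv.unique {f g g' : Circle → ℂ} (h : IsWeakDeriv f g) (h' : IsWeakDeriv f g') :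
    g =ᵐ[arcLength] g' := by
  have : g - g' =ᵐ[arcLength] 0 := by
    refine ae_eq_zero_of_forall_test (h.2.1.sub h'.2.1) fun η hη => ?_
    simp only [Pi.sub_apply, smul_sub]
    rw [integral_sub (integrable_continuous_smul hη.continuous h.2.1)
      (integrable_continuous_smul hη.continuous h'.2.1), sub_eq_zero, ← neg_inj,
      ← h.2.2 η hη, ← h'.2.2 η hη]
  filter_upwards [this] with z hz
  exact sub_eq_zero.1 hz

theorem IsWeakDeriv.congr {f f' g g' : Circle → ℂ} (h : IsWeakDeriv f g)
    (hf : f =ᵐ[arcLength] f') (hg : g =ᵐ[arcLength] g') : IsWeakDeriv f' g' := by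
  refine ⟨h.1.congr hf, h.2.1.congr hg, fun η hη => ?_⟩
  rw [integral_congr_ae (hf.mono fun z hz => by simp only [hz] :
      (fun z => angularDeriv η z • f' z) =ᵐ[arcLength] fun z => angularDeriv η z • f z),
    integral_congr_ae (hg.mono fun z hz => by simp only [hz] :
      (fun z => η z • g' z) =ᵐ[arcLength] fun z => η z • g z)]
  exact h.2.2 η hη

theorem IsWeakDeriv.sub {f f' g g' : Circle → ℂ} (h : IsWeakDeriv f g) (h' : IsWeakDeriv f' g') :
    IsWeakDeriv (fun z => f z - f' z) (fun z => g z - g' z) := by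
  refine ⟨h.1.sub h'.1, h.2.1.sub h'.2.1, fun η hη => ?_⟩
  simp only [smul_sub]
  rw [integral_sub (integrable_continuous_smul (continuous_angularDeriv hη) h.1)
    (integrable_continuous_smul (continuous_angularDeriv hη) h'.1),
    integral_sub (integrable_continuous_smul hη.continuous h.2.1)
      (integrable_continuous_smul hη.continuous h'.2.1), h.2.2 η hη, h'.2.2 η hη]
  ring

theorem isWeakDeriv_weakDeriv {f : Circle → ℂ} (h : WeaklyDifferentiable f) :
    IsWeakDeriv f (weakDeriv f) := by
  rw [weakDeriv, dif_pos h]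
  exact h.choose_spec

theorem IsWeakDeriv.weakDeriv_ae_eq {f g : Circle → ℂ} (h : IsWeakDeriv f g) :
    weakDeriv f =ᵐ[arcLength] g :=
  (isWeakDeriv_weakDeriv ⟨g, h⟩).unique h

/-- Integrate the derivative of `η U` over one full turn: the boundary terms cancel by periodicity.
-/
theorem IsWeakDeriv.of_primitive {U v : Circle → ℂ} (hv : Integrable v arcLength)
    (h : IsPrimitive (fun t => U (Circle.exp t)) (fun t => v (Circle.exp t))) :
    IsWeakDeriv U v := by
  have hc : Continuous U := continuous_of_comp_exp h.continuous
  have hU : Integrable U arcLength := by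
    obtain ⟨C, hC⟩ := isCompact_univ.exists_bound_of_continuousOn hc.continuousOn
    exact Integrable.of_bound hc.aestronglyMeasurable C
      (Eventually.of_forall fun z => hC z trivial)
  refine ⟨hU, hv, fun η hη => ?_⟩
  have hη' : ContDiff ℝ ∞ fun t : ℝ => η (Circle.exp t) := hη
  have h1 : IsPrimitive (fun t => ((η (Circle.exp t) : ℝ) : ℂ))
      (fun t => ((angularDeriv η (Circle.exp t) : ℝ) : ℂ)) := by
    refine IsPrimitive.of_hasDerivAt (fun t => ?_) ?_
    · rw [angularDeriv_exp]
      exact ((hη'.differentiable (by simp)) t).hasDerivAt.ofReal_comp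
    · exact Complex.continuous_ofReal.comp ((continuous_angularDeriv hη).comp Circle.exp.continuous)
  have h2 := (h1.mul h (-Real.pi) (-Real.pi + 2 * Real.pi)).2
  simp only [Circle.exp_add_two_pi, sub_self] at h2
  rw [← integral_arcLength'
    (fun z => (angularDeriv η z : ℂ) * U z + (η z : ℂ) * v z)] at h2
  have i1 := integrable_continuous_smul (continuous_angularDeriv hη) hU
  have i2 := integrable_continuous_smul hη.continuous hv
  simp only [Complex.real_smul] at i1 i2 ⊢
  rw [integral_add i1 i2] at h2
  exact eq_neg_of_add_eq_zero_left h2.symm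

theorem isTestFunction_const (c : ℝ) : IsTestFunction fun _ => c := contDiff_const

theorem IsWeakDeriv.integral_eq_zero {f g : Circle → ℂ} (h : IsWeakDeriv f g) :
    ∫ z, g z ∂arcLength = 0 := by
  have := h.2.2 _ (isTestFunction_const 1)
  simpa [angularDeriv] using this

/-- The du Bois-Reymond argument: a test function minus its mean `m` has a periodic primitive, which
is again a test function. Hence `h` annihilates every test function of mean zero, and `h` minus its
mean annihilates all of them. -/
theorem ae_eq_const_of_weakDeriv_zero {h : Circle → ℂ} (hh : IsWeakDeriv h 0) :
    ∃ c : ℂ, h =ᵐ[arcLength] fun _ => c := by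
  have hpi := Real.pi_pos
  set c : ℂ := ((2 * Real.pi)⁻¹ : ℝ) • ∫ z, h z ∂arcLength with hc
  refine ⟨c, ?_⟩
  have key : (fun z => h z - c) =ᵐ[arcLength] 0 := by
    refine ae_eq_zero_of_forall_test (hh.1.sub (integrable_const c)) fun ζ hζ => ?_
    have hζ' : ContDiff ℝ ∞ fun t : ℝ => ζ (Circle.exp t) := hζ
    set m : ℝ := (2 * Real.pi)⁻¹ * ∫ z, ζ z ∂arcLength with hm
    have hcont : Continuous fun t : ℝ => ζ (Circle.exp t) - m := hζ'.continuous.sub continuous_const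
    have hper : Function.Periodic (fun θ : ℝ => ∫ t in (0:ℝ)..θ, (ζ (Circle.exp t) - m))
        (2 * Real.pi) := by
      intro θ
      have e : ∫ t in θ..(θ + 2 * Real.pi), (ζ (Circle.exp t) - m) = 0 := by
        rw [intervalIntegral.integral_sub (hζ'.continuous.intervalIntegrable _ _)
          (continuous_const.intervalIntegrable _ _), ← integral_arcLength' ζ θ]
        simp only [intervalIntegral.integral_const, smul_eq_mul, hm]
        field_simp
        ring
      simp only
      rw [← intervalIntegral.integral_add_adjacent_intervals (b := θ)
        (hcont.intervalIntegrable _ _) (hcont.intervalIntegrable _ _), e, add_zero]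
    obtain ⟨η, hη⟩ := exists_lift_of_periodic hper
    have hd : ∀ θ, HasDerivAt (fun t : ℝ => η (Circle.exp t)) (ζ (Circle.exp θ) - m) θ := by
      intro θ
      simp_rw [hη]
      exact intervalIntegral.integral_hasDerivAt_right (hcont.intervalIntegrable _ _)
        hcont.stronglyMeasurable.stronglyMeasurableAtFilter hcont.continuousAt
    have hder : deriv (fun t : ℝ => η (Circle.exp t)) = fun θ => ζ (Circle.exp θ) - m :=
      funext fun θ => (hd θ).deriv
    have htest : IsTestFunction η := by
      refine contDiff_infty_iff_deriv.2 ⟨fun θ => (hd θ).differentiableAt, ?_⟩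
      rw [hder]
      exact hζ'.sub contDiff_const
    have h1 := hh.2.2 η htest
    have h2 : ∀ z, angularDeriv η z = ζ z - m := by
      intro z
      obtain ⟨t, rfl⟩ := Circle.exp_surjective z
      rw [angularDeriv_exp, hder]
    simp only [h2, Pi.zero_apply, smul_zero, integral_zero, neg_zero, sub_smul] at h1
    have i1 := integrable_continuous_smul hζ.continuous hh.1
    have i2 : Integrable (fun z => ζ z • c) arcLength :=
      integrable_continuous_smul hζ.continuous (integrable_const c)
    rw [integral_sub i1 (show Integrable (fun z => m • h z) arcLength from hh.1.smul m),
      sub_eq_zero, integral_smul] at h1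
    simp only [smul_sub]
    rw [integral_sub i1 i2, h1, integral_smul_const, hc, hm, smul_smul, mul_comm, sub_self]
  filter_upwards [key] with z hz
  exact sub_eq_zero.1 hz

/-- A weakly differentiable function on the circle has an absolutely continuous representative. -/
theorem IsWeakDeriv.exists_primitive {f g : Circle → ℂ} (h : IsWeakDeriv f g) :
    ∃ U : Circle → ℂ, Continuous U ∧ f =ᵐ[arcLength] U ∧
      IsPrimitive (fun t => U (Circle.exp t)) (fun t => g (Circle.exp t)) := by
  have hii := intervalIntegrable_comp_exp h.2.1
  -- The primitive of `g` descends to the circle because a weak derivative has mean zero.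
  have hper : Function.Periodic (fun θ : ℝ => ∫ t in (0:ℝ)..θ, g (Circle.exp t))
      (2 * Real.pi) := by
    intro θ
    simp only
    rw [← intervalIntegral.integral_add_adjacent_intervals (b := θ) (hii _ _) (hii _ _),
      ← integral_arcLength' g θ, h.integral_eq_zero, add_zero]
  obtain ⟨U, hU⟩ := exists_lift_of_periodic hper
  have hP : IsPrimitive (fun t => U (Circle.exp t)) (fun t => g (Circle.exp t)) := fun a b =>
    ⟨hii a b, by
      simp only [hU]
      exact intervalIntegral.integral_interval_sub_left (hii _ _) (hii _ _)⟩
  have h0 := h.sub (IsWeakDeriv.of_primitive h.2.1 hP)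
  simp only [sub_self] at h0
  obtain ⟨c, hc⟩ := ae_eq_const_of_weakDeriv_zero h0
  refine ⟨fun z => U z + c, (continuous_of_comp_exp hP.continuous).add continuous_const, ?_, ?_⟩
  · filter_upwards [hc] with z hz
    rw [← hz]; ring
  · intro a b
    exact ⟨hii a b, by rw [← (hP a b).2]; ring⟩

/-- Both factors have absolutely continuous versions. These are bounded, which makes the products
integrable, and they obey the classical Leibniz rule. -/
theorem IsWeakDeriv.mul {f f' g g' : Circle → ℂ} (h : IsWeakDeriv f g) (h' : IsWeakDeriv f' g') :
    IsWeakDeriv (fun z => f z * f' z) (fun z => g z * f' z + f z * g' z) := by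
  obtain ⟨U, hUc, hU, hP⟩ := h.exists_primitive
  obtain ⟨U', hUc', hU', hP'⟩ := h'.exists_primitive
  have hm := hP.mul hP'
  have hint : Integrable (fun z => g z * U' z + U z * g' z) arcLength := by
    obtain ⟨C, hC⟩ := isCompact_univ.exists_bound_of_continuousOn hUc.continuousOn
    obtain ⟨C', hC'⟩ := isCompact_univ.exists_bound_of_continuousOn hUc'.continuousOn
    exact (h.2.1.mul_bdd hUc'.aestronglyMeasurable (Eventually.of_forall
      fun z => hC' z trivial)).add
      (h'.2.1.bdd_mul hUc.aestronglyMeasurable (Eventually.of_forall fun z => hC z trivial))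
  refine (IsWeakDeriv.of_primitive (U := fun z => U z * U' z) hint hm).congr ?_ ?_
  · filter_upwards [hU, hU'] with z h1 h2
    rw [h1, h2]
  · filter_upwards [hU, hU'] with z h1 h2
    rw [h1, h2]

/-! ### Iterated weak derivatives -/

/-- `f` has the chain of successive weak derivatives `F 0, …, F n`, up to null sets. -/
theorem iterate_weakDeriv_of_chain {F : ℕ → Circle → ℂ} {n : ℕ}
    (hF : ∀ k < n, IsWeakDeriv (F k) (F (k + 1))) {f : Circle → ℂ} (hf : f =ᵐ[arcLength] F 0) :
    (∀ k ≤ n, weakDeriv^[k] f =ᵐ[arcLength] F k) ∧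
      ∀ k < n, WeaklyDifferentiable (weakDeriv^[k] f) := by
  have h1 : ∀ k ≤ n, weakDeriv^[k] f =ᵐ[arcLength] F k := by
    intro k
    induction k with
    | zero => exact fun _ => hf
    | succ k ih =>
      intro hk
      rw [Function.iterate_succ_apply']
      exact ((hF k hk).congr (ih (by omega)).symm (ae_eq_refl _)).weakDeriv_ae_eq
  exact ⟨h1, fun k hk => ⟨_, (hF k hk).congr (h1 k hk.le).symm (ae_eq_refl _)⟩⟩

/-! ### The Gagliardo energy -/

theorem dist_circle_eq (x y : Circle) : dist x y = ‖(x : ℂ) - y‖ := dist_eq_norm (x : ℂ) y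

theorem dist_exp_exp (s t : ℝ) :
    dist (Circle.exp s) (Circle.exp t) = 2 * |Real.sin ((s - t) / 2)| := by
  have h : ((Circle.exp s : ℂ) - Circle.exp t) =
      Circle.exp t * (Complex.exp (Complex.I * ((s - t : ℝ) : ℂ)) - 1) := by
    rw [mul_sub, mul_one, Circle.coe_exp, Circle.coe_exp, ← Complex.exp_add]
    congr 2
    push_cast
    ring
  rw [dist_circle_eq, h, norm_mul, Circle.norm_coe, one_mul,
    Complex.norm_exp_I_mul_ofReal_sub_one, Real.norm_eq_abs, abs_mul, abs_two]

theorem dist_exp_exp_le (s t : ℝ) : dist (Circle.exp s) (Circle.exp t) ≤ |s - t| := by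
  rw [dist_exp_exp]
  have := Real.abs_sin_le_abs (x := (s - t) / 2)
  rw [abs_div, abs_two] at this
  linarith

theorem le_dist_exp_exp {s t : ℝ} (h : |s - t| ≤ Real.pi) :
    2 / Real.pi * |s - t| ≤ dist (Circle.exp s) (Circle.exp t) := by
  rw [dist_exp_exp]
  have h1 := Real.mul_abs_le_abs_sin (x := (s - t) / 2) (by rw [abs_div, abs_two]; linarith)
  rw [abs_div, abs_two] at h1
  linarith

theorem dist_circle_le_two (x y : Circle) : dist x y ≤ 2 := by
  rw [dist_circle_eq]
  exact (norm_sub_le _ _).trans (by rw [Circle.norm_coe, Circle.norm_coe]; norm_num)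

/-- The integrand of the Gagliardo energy. -/
noncomputable def gagliardoKernel (σ p : ℝ) (f : Circle → ℂ) (x y : Circle) : ℝ≥0∞ :=
  ENNReal.ofReal (‖f x - f y‖ ^ p / dist x y ^ (1 + σ * p))

/-- The Gagliardo energy, that is the `p`-th power of the Gagliardo semi-norm. -/
noncomputable def gagliardoEnergy (σ p : ℝ) (f : Circle → ℂ) : ℝ≥0∞ :=
  ∫⁻ x, ∫⁻ y, gagliardoKernel σ p f x y ∂arcLength ∂arcLength

/-- The part of the Gagliardo energy at distance at most `R` of the diagonal. -/
noncomputable def nearEnergy (σ p R : ℝ) (f : Circle → ℂ) : ℝ≥0∞ :=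
  ∫⁻ x, ∫⁻ y, {y | dist x y ≤ R}.indicator (gagliardoKernel σ p f x) y ∂arcLength ∂arcLength

theorem gagliardo_eq (σ p : ℝ) (f : Circle → ℂ) :
    gagliardo σ p f = gagliardoEnergy σ p f ^ (1 / p) := rfl

theorem gagliardo_lt_top_iff {σ p : ℝ} (hp : 0 < p) {f : Circle → ℂ} :
    gagliardo σ p f < ⊤ ↔ gagliardoEnergy σ p f < ⊤ := by
  rw [gagliardo_eq, ENNReal.rpow_lt_top_iff_of_pos (by positivity)]

theorem nearEnergy_le (σ p R : ℝ) (f : Circle → ℂ) :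
    nearEnergy σ p R f ≤ gagliardoEnergy σ p f :=
  lintegral_mono fun x => lintegral_mono fun y =>
    Set.indicator_le_self _ (gagliardoKernel σ p f x) y

theorem gagliardoEnergy_congr_ae {σ p : ℝ} {f g : Circle → ℂ} (h : f =ᵐ[arcLength] g) :
    gagliardoEnergy σ p f = gagliardoEnergy σ p g := by
  refine lintegral_congr_ae ?_
  filter_upwards [h] with x hx
  refine lintegral_congr_ae ?_
  filter_upwards [h] with y hy
  rw [gagliardoKernel, gagliardoKernel, hx, hy]

theorem gagliardo_congr_ae {σ p : ℝ} {f g : Circle → ℂ} (h : f =ᵐ[arcLength] g) :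
    gagliardo σ p f = gagliardo σ p g := by
  rw [gagliardo_eq, gagliardo_eq, gagliardoEnergy_congr_ae h]

theorem aemeasurable_gagliardoKernel {σ p : ℝ} {f : Circle → ℂ}
    (hf : AEStronglyMeasurable f arcLength) :
    AEMeasurable (fun z : Circle × Circle => gagliardoKernel σ p f z.1 z.2)
      (arcLength.prod arcLength) := by
  have h1 : AEMeasurable (fun z : Circle × Circle => f z.1 - f z.2) (arcLength.prod arcLength) :=
    (hf.comp_fst.sub hf.comp_snd).aemeasurable
  exact ENNReal.measurable_ofReal.comp_aemeasurable ((h1.norm.pow_const p).div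
    ((measurable_dist.pow_const _).aemeasurable))

theorem aemeasurable_gagliardoKernel_right {σ p : ℝ} {f : Circle → ℂ}
    (hf : AEStronglyMeasurable f arcLength) (x : Circle) :
    AEMeasurable (gagliardoKernel σ p f x) arcLength := by
  have h1 : AEMeasurable (fun y : Circle => f x - f y) arcLength :=
    (aestronglyMeasurable_const.sub hf).aemeasurable
  exact ENNReal.measurable_ofReal.comp_aemeasurable ((h1.norm.pow_const p).div
    ((measurable_const.dist measurable_id).pow_const _).aemeasurable)

theorem gagliardoEnergy_eq_prod {σ p : ℝ} {f : Circle → ℂ}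
    (hf : AEStronglyMeasurable f arcLength) :
    gagliardoEnergy σ p f = ∫⁻ z, gagliardoKernel σ p f z.1 z.2 ∂(arcLength.prod arcLength) :=
  (lintegral_prod _ (aemeasurable_gagliardoKernel hf)).symm

theorem setLIntegral_exp_le {F : Circle → ℝ≥0∞} {I : Set ℝ} {a : ℝ}
    (hI : I ⊆ Set.Ioc a (a + 2 * Real.pi)) :
    ∫⁻ t in I, F (Circle.exp t) ≤ ∫⁻ z, F z ∂arcLength := by
  rw [lintegral_arcLength' F a]
  exact lintegral_mono_set hI

theorem aestronglyMeasurable_comp_exp {f : Circle → ℂ} (hf : AEStronglyMeasurable f arcLength) :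
    AEStronglyMeasurable (fun t : ℝ => f (Circle.exp t)) volume :=
  hf.comp_quasiMeasurePreserving quasiMeasurePreserving_exp

/-- At distance at most `R` the weight in the kernel is at least `R ^ (-(1 + σ p))`. The indicator
is kept because in the critical case smallness comes only from the energy near the diagonal. -/
theorem enorm_sub_rpow_le {σ p R : ℝ} (hp : 1 ≤ p) (hσ : 0 ≤ σ) (f : Circle → ℂ) {x y : Circle}
    (hxy : dist x y ≤ R) :
    ‖f x - f y‖ₑ ^ p ≤ ENNReal.ofReal R ^ (1 + σ * p) *
      {y | dist x y ≤ R}.indicator (gagliardoKernel σ p f x) y := by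
  have hp0 : 0 < p := by linarith
  have hR : 0 ≤ R := dist_nonneg.trans hxy
  have he : 0 ≤ 1 + σ * p := by positivity
  rw [Set.indicator_of_mem (by exact hxy), gagliardoKernel]
  rcases eq_or_ne x y with rfl | hne
  · simp [hp0]
  have hd : 0 < dist x y := dist_pos.2 hne
  rw [← ofReal_norm, ENNReal.ofReal_rpow_of_nonneg (norm_nonneg _) hp0.le,
    ENNReal.ofReal_rpow_of_nonneg hR he, ← ENNReal.ofReal_mul (by positivity)]
  refine ENNReal.ofReal_le_ofReal ?_
  rw [mul_div_assoc', le_div_iff₀ (by positivity), mul_comm]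
  gcongr

/-- The mean oscillation of a function between two arcs is controlled by its Gagliardo energy. -/
theorem lintegral_lintegral_enorm_sub_le {σ p R : ℝ} (hp : 1 ≤ p) (hσ : 0 ≤ σ) {f : Circle → ℂ}
    (hf : AEStronglyMeasurable f arcLength) {I J : Set ℝ} {a b : ℝ} (hIm : MeasurableSet I)
    (hJm : MeasurableSet J) (hI : I ⊆ Set.Ioc a (a + 2 * Real.pi))
    (hJ : J ⊆ Set.Ioc b (b + 2 * Real.pi))
    (hR : ∀ s ∈ I, ∀ t ∈ J, dist (Circle.exp s) (Circle.exp t) ≤ R) :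
    ∫⁻ s in I, ∫⁻ t in J, ‖f (Circle.exp s) - f (Circle.exp t)‖ₑ ≤
      (volume I * volume J) ^ (1 - 1 / p) * ENNReal.ofReal R ^ (1 / p + σ) *
        nearEnergy σ p R f ^ (1 / p) := by
  have hp0 : 0 < p := by linarith
  have hfe := aestronglyMeasurable_comp_exp hf
  set μ := volume.restrict I with hμ
  set ν := volume.restrict J with hν
  have : IsFiniteMeasure μ := ⟨by
    rw [hμ, Measure.restrict_apply_univ]
    exact (measure_mono hI).trans_lt measure_Ioc_lt_top⟩
  have : IsFiniteMeasure ν := ⟨by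
    rw [hν, Measure.restrict_apply_univ]
    exact (measure_mono hJ).trans_lt measure_Ioc_lt_top⟩
  have hD : AEStronglyMeasurable
      (fun z : ℝ × ℝ => f (Circle.exp z.1) - f (Circle.exp z.2)) (μ.prod ν) :=
    (hfe.mono_measure Measure.restrict_le_self).comp_fst.sub
      (hfe.mono_measure Measure.restrict_le_self).comp_snd
  -- Hölder on the product `I × J`, from `L¹` to `L^p`; the `p`-th powers are then dominated by the
  -- kernel.
  have h1 := eLpNorm'_le_eLpNorm'_mul_rpow_measure_univ one_pos hp hD
  simp only [eLpNorm', ENNReal.rpow_one, div_one] at h1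
  rw [lintegral_prod _ hD.enorm, lintegral_prod _ (hD.enorm.pow_const p),
    ← Set.univ_prod_univ, Measure.prod_prod, hμ, hν, Measure.restrict_apply_univ,
    Measure.restrict_apply_univ] at h1
  refine h1.trans ?_
  have h2 : ∫⁻ s in I, ∫⁻ t in J, ‖f (Circle.exp s) - f (Circle.exp t)‖ₑ ^ p ≤
      ENNReal.ofReal R ^ (1 + σ * p) * nearEnergy σ p R f := by
    calc _ ≤ ∫⁻ s in I, ∫⁻ t in J, ENNReal.ofReal R ^ (1 + σ * p) *
          {y | dist (Circle.exp s) y ≤ R}.indicator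
            (gagliardoKernel σ p f (Circle.exp s)) (Circle.exp t) := by
          refine setLIntegral_mono' hIm fun s hs => setLIntegral_mono' hJm fun t ht => ?_
          exact enorm_sub_rpow_le hp hσ f (hR s hs t ht)
      _ ≤ ∫⁻ s in I, ENNReal.ofReal R ^ (1 + σ * p) * ∫⁻ y,
          {y | dist (Circle.exp s) y ≤ R}.indicator
            (gagliardoKernel σ p f (Circle.exp s)) y ∂arcLength := by
          refine lintegral_mono fun s => ?_
          rw [lintegral_const_mul' _ _ (by finiteness)]
          gcongr
          exact setLIntegral_exp_le (F := {y | dist (Circle.exp s) y ≤ R}.indicator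
            (gagliardoKernel σ p f (Circle.exp s))) hJ
      _ ≤ _ := by
          rw [lintegral_const_mul' _ _ (by finiteness)]
          gcongr
          exact setLIntegral_exp_le (F := fun x => ∫⁻ y, {y | dist x y ≤ R}.indicator
            (gagliardoKernel σ p f x) y ∂arcLength) hI
  calc _ ≤ (ENNReal.ofReal R ^ (1 + σ * p) * nearEnergy σ p R f) ^ (1 / p) *
        (volume I * volume J) ^ (1 - 1 / p) := by gcongr
    _ = _ := by
      rw [ENNReal.mul_rpow_of_nonneg _ _ (by positivity), ← ENNReal.rpow_mul,
        show (1 + σ * p) * (1 / p) = 1 / p + σ by field_simp]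
      ring

/-! ### Integrals of the kernel -/

theorem lintegral_le_of_le_symm {F : Circle → ℝ≥0∞} {k : ℝ → ℝ≥0∞} (x : Circle)
    (h1 : ∀ t ∈ Set.Ioc 0 Real.pi, F (x * Circle.exp t) ≤ k t)
    (h2 : ∀ t ∈ Set.Ioc 0 Real.pi, F (x * Circle.exp (-t)) ≤ k t) :
    ∫⁻ z, F z ∂arcLength ≤ 2 * ∫⁻ t in Set.Ioi 0, k t := by
  have hpi := Real.pi_pos
  rw [← lintegral_mul_left_arcLength F x, lintegral_arcLength,
    ← Set.Ioc_union_Ioc_eq_Ioc (b := 0) (by linarith) hpi.le]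
  refine (lintegral_union_le _ _ _).trans ?_
  rw [two_mul]
  refine add_le_add ?_ ?_
  · have := (Measure.measurePreserving_neg (volume : Measure ℝ)).setLIntegral_comp_preimage_emb
      (Homeomorph.neg ℝ).measurableEmbedding (fun t => F (x * Circle.exp t))
      (Set.Ioc (-Real.pi) 0)
    rw [← this]
    have hs : Neg.neg ⁻¹' Set.Ioc (-Real.pi) 0 = Set.Ico 0 Real.pi := by
      ext t
      simp only [Set.mem_preimage, Set.mem_Ioc, Set.mem_Ico]
      constructor <;> rintro ⟨h1, h2⟩ <;> constructor <;> linarith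
    rw [hs, setLIntegral_congr Ico_ae_eq_Ioc]
    refine (setLIntegral_mono' measurableSet_Ioc h2).trans (lintegral_mono_set fun t ht => ht.1)
  · exact (setLIntegral_mono' measurableSet_Ioc h1).trans (lintegral_mono_set fun t ht => ht.1)

theorem dist_mul_exp (x : Circle) (t : ℝ) : dist x (x * Circle.exp t) =
    dist (Circle.exp 0) (Circle.exp t) := by
  have : (x : ℂ) - (x * Circle.exp t : Circle) = x * (1 - Circle.exp t) := by
    rw [Circle.coe_mul]; ring
  rw [dist_circle_eq, dist_circle_eq, this, norm_mul, Circle.norm_coe, one_mul, Circle.exp_zero,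
    Circle.coe_one]

/-- By scaling, the integral is of order `l ^ (σ p)`: it converges near `x` because `σ < 1`, and far
from `x` because `σ p > 0`. The point is that `C` does not depend on `l`, which will be as large as
the peak of a Poisson kernel. -/
theorem exists_lintegral_min_le {σ p : ℝ} (hσ : 0 < σ) (hσ1 : σ < 1) (hp : 1 ≤ p) :
    ∃ C : ℝ, 0 < C ∧ ∀ l : ℝ, 0 < l → ∀ x : Circle,
      ∫⁻ y, ENNReal.ofReal (min 2 (l * dist x y) ^ p / dist x y ^ (1 + σ * p)) ∂arcLength ≤
        ENNReal.ofReal (C * l ^ (σ * p)) := by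
  have hpi := Real.pi_pos
  have hp0 : 0 < p := by linarith
  have hσp : 0 < σ * p := by positivity
  -- `q > σ p` gives integrability at `0`, while `q ≤ 1 + σ p` leaves a nonpositive power of the
  -- chord `r`, into which the lower bound `r ≥ (2 / π) t` can be inserted.
  set q := min p (1 + σ * p) with hq
  have hqp : q ≤ p := min_le_left _ _
  have hq1 : q ≤ 1 + σ * p := min_le_right _ _
  have hqs : σ * p < q := lt_min (by nlinarith) (by linarith)
  have hq0 : 0 < q := hσp.trans hqs
  set C1 : ℝ := 2 ^ (p - q) * (2 / Real.pi) ^ (q - 1 - σ * p) with hC1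
  set C2 : ℝ := 2 ^ p * (2 / Real.pi) ^ (-(1 + σ * p)) with hC2
  have hC1p : 0 < C1 := by positivity
  have hC2p : 0 < C2 := by positivity
  refine ⟨2 * (C1 / (q - σ * p) + C2 / (σ * p)), ?_, fun l hl x => ?_⟩
  · have : 0 < q - σ * p := by linarith
    positivity
  have hb1 : ∀ r t : ℝ, 0 < t → 2 / Real.pi * t ≤ r →
      min 2 (l * r) ^ p / r ^ (1 + σ * p) ≤ C1 * l ^ q * t ^ (q - 1 - σ * p) := by
    intro r t ht hr
    have hr0 : 0 < r := lt_of_lt_of_le (by positivity) hr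
    have hm : 0 < min 2 (l * r) := lt_min two_pos (by positivity)
    have e1 : min 2 (l * r) ^ p ≤ 2 ^ (p - q) * (l * r) ^ q := by
      calc min 2 (l * r) ^ p = min 2 (l * r) ^ (p - q) * min 2 (l * r) ^ q := by
            rw [← Real.rpow_add hm]; congr 1; ring
        _ ≤ 2 ^ (p - q) * (l * r) ^ q := by
            gcongr
            · exact min_le_left _ _
            · exact min_le_right _ _
    calc _ ≤ 2 ^ (p - q) * (l * r) ^ q / r ^ (1 + σ * p) := by gcongr
      _ = 2 ^ (p - q) * l ^ q * r ^ (q - 1 - σ * p) := by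
          rw [Real.mul_rpow hl.le hr0.le, show q - 1 - σ * p = q - (1 + σ * p) by ring,
            Real.rpow_sub hr0]
          ring
      _ ≤ 2 ^ (p - q) * l ^ q * (2 / Real.pi * t) ^ (q - 1 - σ * p) := by
          gcongr 2 ^ (p - q) * l ^ q * ?_
          exact Real.rpow_le_rpow_of_nonpos (by positivity) hr (by linarith)
      _ = _ := by
          rw [Real.mul_rpow (by positivity) ht.le, hC1]
          ring
  have hb2 : ∀ r t : ℝ, 0 < t → 2 / Real.pi * t ≤ r →
      min 2 (l * r) ^ p / r ^ (1 + σ * p) ≤ C2 * t ^ (-(1 + σ * p)) := by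
    intro r t ht hr
    have hr0 : 0 < r := lt_of_lt_of_le (by positivity) hr
    have hm : 0 < min 2 (l * r) := lt_min two_pos (by positivity)
    calc _ ≤ 2 ^ p / r ^ (1 + σ * p) := by
          gcongr
          exact min_le_left _ _
      _ = 2 ^ p * r ^ (-(1 + σ * p)) := by rw [Real.rpow_neg hr0.le]; rfl
      _ ≤ 2 ^ p * (2 / Real.pi * t) ^ (-(1 + σ * p)) := by
          gcongr 2 ^ p * ?_
          exact Real.rpow_le_rpow_of_nonpos (by positivity) hr (by linarith)
      _ = _ := by
          rw [Real.mul_rpow (by positivity) ht.le, hC2]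
          ring
  -- The majorant switches at the angle `1 / l`, where the two terms of the minimum are comparable.
  set k : ℝ → ℝ≥0∞ := fun t => if t ≤ 1 / l then ENNReal.ofReal (C1 * l ^ q * t ^ (q - 1 - σ * p))
    else ENNReal.ofReal (C2 * t ^ (-(1 + σ * p))) with hk
  have hF : ∀ r t : ℝ, 0 < t → 2 / Real.pi * t ≤ r →
      ENNReal.ofReal (min 2 (l * r) ^ p / r ^ (1 + σ * p)) ≤ k t := by
    intro r t ht hr
    simp only [hk]
    split_ifs
    · exact ENNReal.ofReal_le_ofReal (hb1 r t ht hr)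
    · exact ENNReal.ofReal_le_ofReal (hb2 r t ht hr)
  refine (lintegral_le_of_le_symm x (k := k) (fun t ht => hF _ t ht.1 ?_)
    (fun t ht => hF _ t ht.1 ?_)).trans ?_
  · rw [dist_mul_exp]
    have := le_dist_exp_exp (s := 0) (t := t)
      (by rw [zero_sub, abs_neg, abs_of_pos ht.1]; exact ht.2)
    rwa [zero_sub, abs_neg, abs_of_pos ht.1] at this
  · rw [dist_mul_exp]
    have := le_dist_exp_exp (s := 0) (t := -t)
      (by rw [zero_sub, neg_neg, abs_of_pos ht.1]; exact ht.2)
    rwa [zero_sub, neg_neg, abs_of_pos ht.1] at this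
  have hl1 : 0 < 1 / l := by positivity
  have hk1 : ∫⁻ t in Set.Ioc 0 (1 / l), k t = ENNReal.ofReal (C1 / (q - σ * p) * l ^ (σ * p)) := by
    rw [setLIntegral_congr_fun (g := fun t => ENNReal.ofReal (C1 * l ^ q * t ^ (q - 1 - σ * p)))
      measurableSet_Ioc (fun t ht => by simp only [hk]; rw [if_pos ht.2]),
      ← ofReal_integral_eq_lintegral_ofReal, ← intervalIntegral.integral_of_le hl1.le,
      intervalIntegral.integral_const_mul, integral_rpow (Or.inl (by linarith))]
    · congr 1
      rw [Real.zero_rpow (by linarith), sub_zero, one_div, Real.inv_rpow hl.le,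
        show q - 1 - σ * p + 1 = q - σ * p by ring, Real.rpow_sub hl]
      have : 0 < q - σ * p := by linarith
      field_simp
    · rw [← IntegrableOn, ← intervalIntegrable_iff_integrableOn_Ioc_of_le hl1.le]
      exact (intervalIntegral.intervalIntegrable_rpow' (by linarith)).const_mul _
    · refine (ae_restrict_iff' measurableSet_Ioc).2 (Eventually.of_forall fun t ht => ?_)
      have := ht.1
      positivity
  have hk2 : ∫⁻ t in Set.Ioi (1 / l), k t = ENNReal.ofReal (C2 / (σ * p) * l ^ (σ * p)) := by
    rw [setLIntegral_congr_fun (g := fun t => ENNReal.ofReal (C2 * t ^ (-(1 + σ * p))))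
      measurableSet_Ioi (fun t ht => by simp only [hk]; rw [if_neg (not_le.2 ht)]),
      ← ofReal_integral_eq_lintegral_ofReal, integral_const_mul,
      integral_Ioi_rpow_of_lt (by linarith) hl1]
    · congr 1
      rw [one_div, Real.inv_rpow hl.le, show -(1 + σ * p) + 1 = -(σ * p) by ring,
        Real.rpow_neg hl.le, inv_inv]
      field_simp
    · exact (integrableOn_Ioi_rpow_of_lt (by linarith) hl1).const_mul _
    · refine (ae_restrict_iff' measurableSet_Ioi).2 (Eventually.of_forall fun t ht => ?_)
      have : 0 < t := hl1.trans ht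
      positivity
  rw [← Set.Ioc_union_Ioi_eq_Ioi hl1.le]
  refine (mul_le_mul_right (lintegral_union_le _ _ _) _).trans ?_
  have : 0 < q - σ * p := by linarith
  rw [hk1, hk2, ← ENNReal.ofReal_add (by positivity) (by positivity),
    show (2 : ℝ≥0∞) = ENNReal.ofReal 2 by simp, ← ENNReal.ofReal_mul (by norm_num)]
  refine ENNReal.ofReal_le_ofReal (le_of_eq ?_)
  ring

/-! ### Smooth functions -/

/-- A smooth complex function on the circle. -/
def IsSmooth (F : Circle → ℂ) : Prop := ContDiff ℝ ∞ fun t : ℝ => F (Circle.exp t)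

/-- The angular derivative of a complex function. -/
noncomputable def circleDeriv (F : Circle → ℂ) (z : Circle) : ℂ :=
  deriv (fun t : ℝ => F (z * Circle.exp t)) 0

theorem circleDeriv_exp (F : Circle → ℂ) (θ : ℝ) :
    circleDeriv F (Circle.exp θ) = deriv (fun t : ℝ => F (Circle.exp t)) θ := by
  rw [circleDeriv]
  simp_rw [← Circle.exp_add]
  rw [deriv_comp_const_add (fun t : ℝ => F (Circle.exp t)) θ 0, add_zero]

theorem exists_norm_le_of_continuous {F : Circle → ℂ} (h : Continuous F) :
    ∃ C : ℝ, 0 < C ∧ ∀ z, ‖F z‖ ≤ C := by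
  obtain ⟨C, hC⟩ := isCompact_univ.exists_bound_of_continuousOn h.continuousOn
  exact ⟨max C 1, by positivity, fun z => (hC z trivial).trans (le_max_left _ _)⟩

theorem integrable_of_continuous {F : Circle → ℂ} (h : Continuous F) : Integrable F arcLength := by
  obtain ⟨C, -, hC⟩ := exists_norm_le_of_continuous h
  exact Integrable.of_bound h.aestronglyMeasurable C (Eventually.of_forall hC)

theorem memLp_of_continuous {F : Circle → ℂ} (h : Continuous F) (p : ℝ≥0∞) :
    MemLp F p arcLength := by
  obtain ⟨C, -, hC⟩ := exists_norm_le_of_continuous h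
  exact MemLp.of_bound h.aestronglyMeasurable C (Eventually.of_forall hC)

namespace IsSmooth

variable {F : Circle → ℂ}

theorem continuous (h : IsSmooth F) : Continuous F := continuous_of_comp_exp (ContDiff.continuous h)

theorem const (c : ℂ) : IsSmooth fun _ => c := contDiff_const

theorem hasDerivAt (h : IsSmooth F) (t : ℝ) :
    HasDerivAt (fun t : ℝ => F (Circle.exp t)) (circleDeriv F (Circle.exp t)) t := by
  rw [circleDeriv_exp]
  exact (ContDiff.differentiable h (by simp) t).hasDerivAt

theorem circleDeriv (h : IsSmooth F) : IsSmooth (circleDeriv F) := by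
  rw [IsSmooth]
  simp_rw [circleDeriv_exp]
  exact (contDiff_infty_iff_deriv.1 h).2

theorem isPrimitive (h : IsSmooth F) : IsPrimitive (fun t => F (Circle.exp t))
    (fun t => CircleSobolev.circleDeriv F (Circle.exp t)) :=
  IsPrimitive.of_hasDerivAt h.hasDerivAt (h.circleDeriv.continuous.comp Circle.exp.continuous)

theorem isWeakDeriv (h : IsSmooth F) : IsWeakDeriv F (CircleSobolev.circleDeriv F) :=
  IsWeakDeriv.of_primitive (integrable_of_continuous h.circleDeriv.continuous) h.isPrimitive

theorem iterate (h : IsSmooth F) (k : ℕ) : IsSmooth (CircleSobolev.circleDeriv^[k] F) := by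
  induction k with
  | zero => exact h
  | succ k ih => rw [Function.iterate_succ_apply']; exact ih.circleDeriv

theorem exists_lipschitz (h : IsSmooth F) :
    ∃ L : ℝ, 0 < L ∧ ∀ x y, ‖F x - F y‖ ≤ L * dist x y := by
  obtain ⟨C, hC, hb⟩ := exists_norm_le_of_continuous h.circleDeriv.continuous
  have hpi := Real.pi_pos
  refine ⟨C * (Real.pi / 2), by positivity, fun x y => ?_⟩
  obtain ⟨s, rfl⟩ := Circle.exp_surjective x
  set t := s + Complex.arg ((y / Circle.exp s : Circle) : ℂ) with ht
  have hy : y = Circle.exp t := by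
    rw [ht, Circle.exp_add, Circle.exp_arg, mul_div_cancel]
  have hst : |s - t| ≤ Real.pi := by
    rw [ht, sub_add_cancel_left, abs_neg]
    exact Complex.abs_arg_le_pi _
  have h1 : ‖F (Circle.exp s) - F (Circle.exp t)‖ ≤ C * |s - t| := by
    have := Convex.norm_image_sub_le_of_norm_hasDerivWithin_le (𝕜 := ℝ)
      (f := fun t : ℝ => F (Circle.exp t)) (s := Set.univ) (C := C)
      (fun t _ => (h.hasDerivAt t).hasDerivWithinAt) (fun t _ => hb _) convex_univ
      (Set.mem_univ t) (Set.mem_univ s)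
    simpa using this
  have h2 := le_dist_exp_exp hst
  rw [hy]
  calc _ ≤ C * |s - t| := h1
    _ = C * (Real.pi / 2) * (2 / Real.pi * |s - t|) := by field_simp
    _ ≤ _ := by gcongr

end IsSmooth

/-! ### Membership in Sobolev spaces -/

theorem gagliardoEnergy_le_of_le_min {σ p A l : ℝ} (hp : 0 < p) (hA : 0 ≤ A) {F : Circle → ℂ}
    (h : ∀ x y, ‖F x - F y‖ ≤ A * min 2 (l * dist x y)) :
    gagliardoEnergy σ p F ≤ ∫⁻ x, ENNReal.ofReal (A ^ p) * ∫⁻ y,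
      ENNReal.ofReal (min 2 (l * dist x y) ^ p / dist x y ^ (1 + σ * p)) ∂arcLength ∂arcLength := by
  refine lintegral_mono fun x => ?_
  rw [← lintegral_const_mul' _ _ (by finiteness)]
  refine lintegral_mono fun y => ?_
  rcases hA.eq_or_lt with rfl | hA
  · have : ‖F x - F y‖ = 0 := le_antisymm (by simpa using h x y) (norm_nonneg _)
    simp [gagliardoKernel, this, hp.ne']
  have hm : 0 ≤ min 2 (l * dist x y) :=
    nonneg_of_mul_nonneg_right ((norm_nonneg _).trans (h x y)) hA
  rw [gagliardoKernel, ← ENNReal.ofReal_mul (by positivity), mul_div_assoc',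
    ← Real.mul_rpow hA.le hm]
  refine ENNReal.ofReal_le_ofReal ?_
  gcongr
  exact h x y

theorem IsSmooth.gagliardo_lt_top {F : Circle → ℂ} (h : IsSmooth F) {σ p : ℝ} (hσ : 0 < σ)
    (hσ1 : σ < 1) (hp : 1 ≤ p) : gagliardo σ p F < ⊤ := by
  rw [gagliardo_lt_top_iff (by linarith)]
  obtain ⟨A, hA, hb⟩ := exists_norm_le_of_continuous h.continuous
  obtain ⟨L, hL, hl⟩ := h.exists_lipschitz
  obtain ⟨C, hC, hk⟩ := exists_lintegral_min_le hσ hσ1 hp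
  refine (gagliardoEnergy_le_of_le_min (A := A) (l := L / A) (by linarith) hA.le
    fun x y => ?_).trans_lt
    ((lintegral_mono fun x => mul_le_mul_right (hk (L / A) (by positivity) x) _).trans_lt ?_)
  · rw [mul_min_of_nonneg _ _ hA.le]
    refine le_min ?_ ?_
    · linarith [norm_sub_le (F x) (F y), hb x, hb y]
    · refine (hl x y).trans (le_of_eq ?_)
      field_simp
  · rw [lintegral_const]
    finiteness

theorem gagliardoKernel_le_add {σ p a b : ℝ} (hp : 1 ≤ p) {f : Circle → ℂ} {x y : Circle}
    (ha : 0 ≤ a) (hb : 0 ≤ b) (h : ‖f x - f y‖ ≤ a + b) :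
    gagliardoKernel σ p f x y ≤ 2 ^ (p - 1) * (ENNReal.ofReal (a ^ p / dist x y ^ (1 + σ * p)) +
      ENNReal.ofReal (b ^ p / dist x y ^ (1 + σ * p))) := by
  have hp0 : 0 ≤ p := by linarith
  have h2 : (2 : ℝ≥0∞) ^ (p - 1) = ENNReal.ofReal (2 ^ (p - 1)) := by
    rw [← ENNReal.ofReal_rpow_of_pos two_pos]; simp
  rw [gagliardoKernel, ← ENNReal.ofReal_add (by positivity) (by positivity), h2,
    ← ENNReal.ofReal_mul (by positivity), ← add_div, mul_div_assoc']
  refine ENNReal.ofReal_le_ofReal ?_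
  gcongr
  calc ‖f x - f y‖ ^ p ≤ (a + b) ^ p := by gcongr
    _ ≤ _ := by
      have := NNReal.rpow_add_le_mul_rpow_add_rpow ⟨a, ha⟩ ⟨b, hb⟩ hp
      exact_mod_cast this

theorem gagliardoEnergy_le_add {σ p : ℝ} (hp : 1 ≤ p) {f g h : Circle → ℂ}
    (hf : AEStronglyMeasurable f arcLength)
    (H : ∀ x y, ‖h x - h y‖ ≤ ‖f x - f y‖ + ‖g x - g y‖) :
    gagliardoEnergy σ p h ≤ 2 ^ (p - 1) * (gagliardoEnergy σ p f + gagliardoEnergy σ p g) := by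
  have h2 : (2 : ℝ≥0∞) ^ (p - 1) ≠ ⊤ := by finiteness
  calc _ ≤ ∫⁻ x, ∫⁻ y, 2 ^ (p - 1) * (gagliardoKernel σ p f x y + gagliardoKernel σ p g x y)
        ∂arcLength ∂arcLength :=
        lintegral_mono fun x => lintegral_mono fun y =>
          gagliardoKernel_le_add hp (norm_nonneg _) (norm_nonneg _) (H x y)
    _ = 2 ^ (p - 1) * ∫⁻ x, (∫⁻ y, gagliardoKernel σ p f x y ∂arcLength +
          ∫⁻ y, gagliardoKernel σ p g x y ∂arcLength) ∂arcLength := by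
        rw [← lintegral_const_mul' _ _ h2]
        refine lintegral_congr fun x => ?_
        rw [lintegral_const_mul' _ _ h2,
          lintegral_add_left' (aemeasurable_gagliardoKernel_right hf x)]
    _ = _ := by
        rw [lintegral_add_left' (aemeasurable_gagliardoKernel hf).lintegral_prod_right']
        rfl

/-- The top-order semi-norm, computed from any version of the top-order derivative. -/
theorem seminorm_eq_of_ae {s p : ℝ} {f h : Circle → ℂ}
    (hf : weakDeriv^[⌊s⌋₊] f =ᵐ[arcLength] h) :
    seminorm s p f = if s = ⌊s⌋₊ then eLpNorm h (ENNReal.ofReal p) arcLength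
      else gagliardo (s - ⌊s⌋₊) p h := by
  rw [seminorm, eLpNorm_congr_ae hf, gagliardo_congr_ae hf]

theorem frac_pos_of_ne {s : ℝ} (hs : 0 < s) (h : s ≠ ⌊s⌋₊) : 0 < s - ⌊s⌋₊ :=
  sub_pos.2 (lt_of_le_of_ne (Nat.floor_le hs.le) h.symm)

theorem frac_lt_one (s : ℝ) : s - ⌊s⌋₊ < 1 := by linarith [Nat.lt_floor_add_one s]

theorem IsSmooth.memSobolev {F : Circle → ℂ} (h : IsSmooth F) {s p : ℝ} (hs : 0 < s)
    (hp : 1 ≤ p) : MemSobolev s p F := by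
  obtain ⟨h1, h2⟩ := iterate_weakDeriv_of_chain
    (F := fun k => CircleSobolev.circleDeriv^[k] F) (n := ⌊s⌋₊)
    (fun k _ => by
      simp only [Function.iterate_succ_apply']
      exact (h.iterate k).isWeakDeriv) (ae_eq_refl F)
  refine ⟨h2, fun k hk => (memLp_of_continuous (h.iterate k).continuous _).ae_eq (h1 k hk).symm, ?_⟩
  rw [seminorm_eq_of_ae (h1 _ le_rfl)]
  split_ifs with hi
  · exact (memLp_of_continuous (h.iterate _).continuous _).2
  · exact (h.iterate _).gagliardo_lt_top (frac_pos_of_ne hs hi) (frac_lt_one s) hp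

theorem MemSobolev.isWeakDeriv {s p : ℝ} {f : Circle → ℂ} (h : MemSobolev s p f) {k : ℕ}
    (hk : k < ⌊s⌋₊) : IsWeakDeriv (weakDeriv^[k] f) (weakDeriv^[k + 1] f) := by
  rw [Function.iterate_succ_apply']
  exact isWeakDeriv_weakDeriv (h.differentiable k hk)

theorem MemSobolev.sub {s p : ℝ} (hp : 1 ≤ p) {f g : Circle → ℂ} (hf : MemSobolev s p f)
    (hg : MemSobolev s p g) : MemSobolev s p fun z => f z - g z := by
  obtain ⟨h1, h2⟩ := iterate_weakDeriv_of_chain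
    (F := fun k z => weakDeriv^[k] f z - weakDeriv^[k] g z) (n := ⌊s⌋₊)
    (fun k hk => (hf.isWeakDeriv hk).sub (hg.isWeakDeriv hk))
    (f := fun z => f z - g z) (ae_eq_refl _)
  refine ⟨h2, fun k hk => ((hf.memLp k hk).sub (hg.memLp k hk)).ae_eq (h1 k hk).symm, ?_⟩
  rw [seminorm_eq_of_ae (h1 _ le_rfl)]
  have hfs := hf.seminorm_lt_top
  have hgs := hg.seminorm_lt_top
  rw [seminorm] at hfs hgs
  split_ifs at * with hi
  · exact ((hf.memLp _ le_rfl).sub (hg.memLp _ le_rfl)).2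
  · rw [gagliardo_lt_top_iff (by linarith)] at hfs hgs ⊢
    refine (gagliardoEnergy_le_add hp (hf.memLp _ le_rfl).1
      (g := weakDeriv^[⌊s⌋₊] g) fun x y => ?_).trans_lt (by finiteness)
    rw [sub_sub_sub_comm]
    exact norm_sub_le _ _

theorem MemSobolev.sub_const {s p : ℝ} (hs : 0 < s) (hp : 1 ≤ p) {f : Circle → ℂ}
    (hf : MemSobolev s p f) (c : ℂ) : MemSobolev s p fun z => f z - c :=
  hf.sub hp ((IsSmooth.const c).memSobolev hs hp)

theorem MemSobolev.integrable {s p : ℝ} (hp : 1 ≤ p) {f : Circle → ℂ} (h : MemSobolev s p f)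
    {k : ℕ} (hk : k ≤ ⌊s⌋₊) : Integrable (weakDeriv^[k] f) arcLength :=
  (h.memLp k hk).integrable (by rw [ENNReal.one_le_ofReal]; exact hp)

/-! ### Arc means -/

theorem arcMean_exp (f : Circle → ℂ) (ε θ : ℝ) :
    arcMean f ε (Circle.exp θ) =
      ((2 * ε)⁻¹ : ℝ) • ∫ t in (θ - ε)..(θ + ε), f (Circle.exp t) := by
  rw [arcMean]
  simp_rw [← Circle.exp_add]
  rw [intervalIntegral.integral_comp_add_left (fun t => f (Circle.exp t)) θ]
  rfl

theorem arcMean_congr_ae {f g : Circle → ℂ} (h : f =ᵐ[arcLength] g) (ε : ℝ) :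
    arcMean f ε = arcMean g ε := by
  funext z
  obtain ⟨θ, rfl⟩ := Circle.exp_surjective z
  rw [arcMean_exp, arcMean_exp]
  congr 1
  exact intervalIntegral.integral_congr_ae ((ae_arcLength_iff.1 h).mono fun t ht _ => ht)

theorem continuous_arcMean {f : Circle → ℂ} (hf : Integrable f arcLength) (ε : ℝ) :
    Continuous (arcMean f ε) := by
  have hi := intervalIntegrable_comp_exp hf
  have hc := intervalIntegral.continuous_primitive hi 0
  refine continuous_of_comp_exp ?_
  simp_rw [arcMean_exp]
  have : ∀ θ : ℝ, ∫ t in (θ - ε)..(θ + ε), f (Circle.exp t) =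
      (∫ t in (0:ℝ)..(θ + ε), f (Circle.exp t)) - ∫ t in (0:ℝ)..(θ - ε), f (Circle.exp t) :=
    fun θ => (intervalIntegral.integral_interval_sub_left (hi _ _) (hi _ _)).symm
  simp_rw [this]
  refine Continuous.const_smul ?_ ((2 * ε)⁻¹ : ℝ)
  exact ((hc.comp (continuous_id.add continuous_const)).sub
    (hc.comp (continuous_id.sub continuous_const)))

theorem intervalIntegrable_comp_mul_exp {f : Circle → ℂ} (hf : Integrable f arcLength)
    (z : Circle) (a b : ℝ) : IntervalIntegrable (fun t => f (z * Circle.exp t)) volume a b := by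
  obtain ⟨θ, rfl⟩ := Circle.exp_surjective z
  simp_rw [← Circle.exp_add]
  have := (intervalIntegrable_comp_exp hf (θ + a) (θ + b)).comp_add_left θ
  simpa using this

theorem arcMean_sub {f g : Circle → ℂ} (hf : Integrable f arcLength) (hg : Integrable g arcLength)
    (ε : ℝ) (z : Circle) :
    arcMean (fun z => f z - g z) ε z = arcMean f ε z - arcMean g ε z := by
  rw [arcMean, arcMean, arcMean, ← smul_sub, intervalIntegral.integral_sub
    (intervalIntegrable_comp_mul_exp hf z _ _) (intervalIntegrable_comp_mul_exp hg z _ _)]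

theorem norm_arcMean_le {f : Circle → ℂ} {ε η : ℝ} (hε : 0 < ε) {z : Circle}
    (h : ∀ t : ℝ, |t| ≤ ε → ‖f (z * Circle.exp t)‖ ≤ η) : ‖arcMean f ε z‖ ≤ η := by
  have h1 : ‖∫ t in (-ε)..ε, f (z * Circle.exp t)‖ ≤ η * |ε - -ε| :=
    intervalIntegral.norm_integral_le_of_norm_le_const fun t ht => h t (by
      rw [Set.uIoc_of_le (by linarith)] at ht
      exact abs_le.2 ⟨ht.1.le, ht.2⟩)
  rw [arcMean, norm_smul, Real.norm_eq_abs, abs_of_pos (by positivity)]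
  rw [sub_neg_eq_add, ← two_mul, abs_of_pos (by positivity)] at h1
  calc _ ≤ (2 * ε)⁻¹ * (η * (2 * ε)) := by gcongr
    _ = η := by field_simp

theorem arcMean_const (c : ℂ) {ε : ℝ} (hε : 0 < ε) (z : Circle) :
    arcMean (fun _ => c) ε z = c := by
  rw [arcMean, intervalIntegral.integral_const, smul_smul, sub_neg_eq_add, ← two_mul,
    inv_mul_cancel₀ (by positivity), one_smul]

theorem arcMean_mul_const (f : Circle → ℂ) (c : ℂ) (ε : ℝ) (z : Circle) :
    arcMean (fun w => f w * c) ε z = arcMean f ε z * c := by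
  rw [arcMean, arcMean, intervalIntegral.integral_mul_const, smul_mul_assoc]

theorem dist_mul_exp_le (z : Circle) (t : ℝ) : dist (z * Circle.exp t) z ≤ |t| := by
  rw [dist_comm, dist_mul_exp]
  simpa using dist_exp_exp_le 0 t

theorem eventually_oscillation_le {G : Circle → ℂ} (hG : Continuous G) {η : ℝ} (hη : 0 < η) :
    ∀ᶠ ε in 𝓝[>] (0 : ℝ), ∀ z : Circle, ∀ t : ℝ, |t| ≤ ε → ‖G (z * Circle.exp t) - G z‖ ≤ η := by
  have hu := CompactSpace.uniformContinuous_of_continuous hG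
  obtain ⟨δ, hδ, h⟩ := Metric.uniformContinuous_iff.1 hu η hη
  filter_upwards [Ioo_mem_nhdsGT hδ] with ε hε z t ht
  rw [← dist_eq_norm]
  exact (h ((dist_mul_exp_le z t).trans_lt (ht.trans_lt hε.2))).le

theorem eventually_arcMean_close {G : Circle → ℂ} (hG : Continuous G) {η : ℝ} (hη : 0 < η) :
    ∀ᶠ ε in 𝓝[>] (0 : ℝ), ∀ z : Circle, ‖arcMean G ε z - G z‖ ≤ η := by
  filter_upwards [eventually_oscillation_le hG hη, self_mem_nhdsWithin] with ε hε hpos z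
  have := arcMean_sub (integrable_of_continuous hG) (integrable_const (G z)) ε z
  rw [arcMean_const _ hpos] at this
  rw [← this]
  exact norm_arcMean_le hpos (hε z)

/-! ### Degree -/

theorem continuous_coe_circle {h : Circle → Circle} (hh : Continuous h) :
    Continuous fun z => (h z : ℂ) := continuous_subtype_val.comp hh

/-- By the intermediate value theorem, a continuous function that misses the integers stays between
two consecutive ones, so two of its values cannot differ by a nonzero integer. -/
theorem eq_zero_of_avoids_int {b : ℝ → ℝ} (hb : Continuous b) (h : ∀ t, ∀ n : ℤ, b t ≠ n)
    {x y : ℝ} {n : ℤ} (hxy : b y = b x + n) : n = 0 := by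
  have key : ∀ x y : ℝ, ∀ n : ℤ, b y = b x + n → n ≤ 0 := by
    intro x y n hxy
    by_contra! hn
    have hn1 : (1 : ℝ) ≤ n := by exact_mod_cast hn
    obtain ⟨t, ht⟩ := mem_range_of_exists_le_of_exists_ge hb (c := (⌈b x⌉ : ℝ))
      ⟨x, Int.le_ceil _⟩ ⟨y, by rw [hxy]; linarith [Int.ceil_lt_add_one (b x)]⟩
    exact h t _ ht
  refine le_antisymm (key x y n hxy) ?_
  have := key y x (-n) (by rw [hxy]; push_cast; ring)
  omega

/-- Two continuous maps into the unit circle that are nowhere antipodal have the same degree. -/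
theorem HasContinuousDegree.eq_of_norm_sub_lt_two {F G : Circle → ℂ} {d d' : ℤ}
    (hF : HasContinuousDegree F d) (hG : HasContinuousDegree G d') (hF1 : ∀ z, ‖F z‖ = 1)
    (hG1 : ∀ z, ‖G z‖ = 1) (h : ∀ z, ‖F z - G z‖ < 2) : d = d' := by
  obtain ⟨-, -, φ, hφc, hφ, hφp⟩ := hF
  obtain ⟨-, -, ψ, hψc, hψ, hψp⟩ := hG
  have hpi := Real.pi_pos
  -- This quotient is an integer exactly where the phases differ by an odd multiple of `π`, that is,
  -- where the values are antipodal. Over one turn it grows by `d - d'`.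
  have key := eq_zero_of_avoids_int (b := fun t => (φ t - ψ t - Real.pi) / (2 * Real.pi))
    (by fun_prop) (x := 0) (y := 0 + 2 * Real.pi) (n := d - d') (fun t n hn => ?_) (by
      simp only [hφp, hψp]
      push_cast
      field_simp
      ring)
  · omega
  · have h1 : φ t = ψ t + Real.pi + n * (2 * Real.pi) := by
      field_simp at hn
      linarith
    have h2 : Circle.exp (φ t) = Circle.exp (ψ t) * Circle.exp Real.pi := by
      rw [h1, ← Circle.exp_add]
      exact Circle.periodic_exp.int_mul n _
    have h3 := h (Circle.exp t)
    rw [hφ, hψ, hF1, hG1, h2, Circle.coe_mul, Circle.coe_exp Real.pi, Complex.exp_pi_mul_I] at h3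
    have : ((1 : ℝ) : ℂ) * ((Circle.exp (ψ t) : ℂ) * -1) - ((1 : ℝ) : ℂ) * Circle.exp (ψ t) =
      -2 * Circle.exp (ψ t) := by push_cast; ring
    rw [this, norm_mul, Circle.norm_coe] at h3
    norm_num at h3

/-- Rouché's argument: `G / F` stays in the unit disc around `1`, so its principal argument is
continuous and periodic and can be added to the phase of `F` without changing its growth. -/
theorem HasContinuousDegree.of_close {F G : Circle → ℂ} {d : ℤ} (hF : HasContinuousDegree F d)
    (hG : Continuous G) (h : ∀ z, ‖G z - F z‖ < ‖F z‖) : HasContinuousDegree G d := by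
  obtain ⟨hFc, hF0, φ, hφc, hφ, hφp⟩ := hF
  have hG0 : ∀ z, G z ≠ 0 := fun z hz => by
    have := h z
    rw [hz, zero_sub, norm_neg] at this
    exact lt_irrefl _ this
  have hslit : ∀ z, G z / F z ∈ Complex.slitPlane := by
    intro z
    refine Complex.mem_slitPlane_of_norm_lt_one (z := G z / F z - 1) ?_ |> fun h => by
      simpa using h
    rw [div_sub_one (hF0 z), norm_div, div_lt_one (norm_pos_iff.2 (hF0 z))]
    exact h z
  refine ⟨hG, hG0, fun θ => φ θ + Complex.arg (G (Circle.exp θ) / F (Circle.exp θ)), ?_, ?_, ?_⟩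
  · refine hφc.add (continuous_iff_continuousAt.2 fun θ => ?_)
    refine (Complex.continuousAt_arg (hslit _)).comp
      (f := fun θ : ℝ => G (Circle.exp θ) / F (Circle.exp θ)) (Continuous.continuousAt ?_)
    exact (hG.comp Circle.exp.continuous).div (hFc.comp Circle.exp.continuous) fun _ => hF0 _
  · intro θ
    simp only
    set z := Circle.exp θ
    have h1 := Complex.norm_mul_exp_arg_mul_I (G z / F z)
    have hF' : (‖F z‖ : ℂ) ≠ 0 := by simpa using hF0 z
    rw [Circle.exp_add, Circle.coe_mul, Circle.coe_exp (Complex.arg _)]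
    calc G z = F z * (G z / F z) := by field_simp [hF0 z]
      _ = (‖F z‖ * Circle.exp (φ θ)) *
          (‖G z / F z‖ * Complex.exp (Complex.arg (G z / F z) * Complex.I)) := by
        rw [h1, ← hφ θ]
      _ = _ := by
        rw [norm_div]
        push_cast
        field_simp
  · intro θ
    simp only [Circle.exp_add_two_pi, hφp]
    ring

/-- `φ` is a continuous phase of `h`, growing by `2πd` over one turn. -/
def IsPhase (h : Circle → Circle) (φ : ℝ → ℝ) (d : ℤ) : Prop :=
  Continuous φ ∧ (∀ θ, h (Circle.exp θ) = Circle.exp (φ θ)) ∧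
    ∀ θ, φ (θ + 2 * Real.pi) = φ θ + 2 * Real.pi * d

theorem IsPhase.continuous {h : Circle → Circle} {φ : ℝ → ℝ} {d : ℤ} (hφ : IsPhase h φ d) :
    Continuous h := by
  refine continuous_of_comp_exp ?_
  simp_rw [hφ.2.1]
  exact Circle.exp.continuous.comp hφ.1

theorem IsPhase.hasContinuousDegree {h : Circle → Circle} {φ : ℝ → ℝ} {d : ℤ}
    (hφ : IsPhase h φ d) : HasContinuousDegree (fun z => (h z : ℂ)) d :=
  ⟨continuous_coe_circle hφ.continuous, fun z => Circle.coe_ne_zero _, φ, hφ.1,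
    fun θ => by simp only [hφ.2.1 θ, Circle.norm_coe]; simp, hφ.2.2⟩

theorem HasContinuousDegree.mul_phase {F : Circle → ℂ} {d D : ℤ} (hF : HasContinuousDegree F d)
    {h : Circle → Circle} {χ : ℝ → ℝ} (hχ : IsPhase h χ D) :
    HasContinuousDegree (fun z => F z * h z) (d + D) := by
  obtain ⟨hFc, hF0, φ, hφc, hφ, hφp⟩ := hF
  refine ⟨hFc.mul (continuous_coe_circle hχ.continuous),
    fun z => mul_ne_zero (hF0 z) (Circle.coe_ne_zero _), fun θ => φ θ + χ θ, hφc.add hχ.1,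
    fun θ => ?_, fun θ => ?_⟩
  · simp only [norm_mul, Circle.norm_coe, mul_one, Circle.exp_add, Circle.coe_mul, hχ.2.1]
    rw [← mul_assoc, ← hφ θ]
  · simp only [hφp, hχ.2.2]
    push_cast
    ring

theorem norm_eq_one_of_ae_eq {f : Circle → Circle} {G : Circle → ℂ} (hG : Continuous G)
    (h : (fun z => (f z : ℂ)) =ᵐ[arcLength] G) (z : Circle) : ‖G z‖ = 1 := by
  have : (fun z => ‖G z‖) = fun _ => (1 : ℝ) :=
    eq_of_ae_eq_of_continuous hG.norm continuous_const (by
      filter_upwards [h] with z hz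
      rw [← hz, Circle.norm_coe])
  exact congrFun this z

/-- The Brezis-Nirenberg degree of a map with a continuous version is the degree of the latter. -/
theorem hasDegree_iff_of_ae_eq {f : Circle → Circle} {G : Circle → ℂ} (hG : Continuous G)
    (h : (fun z => (f z : ℂ)) =ᵐ[arcLength] G) {d : ℤ} :
    HasDegree f d ↔ HasContinuousDegree G d := by
  have h1 := norm_eq_one_of_ae_eq hG h
  have hclose := eventually_arcMean_close hG (η := 1 / 4) (by norm_num)
  rw [HasDegree]
  simp_rw [arcMean_congr_ae h]
  constructor
  · intro hd
    obtain ⟨ε, h2, h3⟩ := (hd.and hclose).exists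
    refine h2.of_close hG fun z => ?_
    have h4 := h3 z
    have h5 := norm_sub_norm_le (G z) (G z - arcMean G ε z)
    rw [sub_sub_cancel, h1] at h5
    rw [norm_sub_rev] at h4
    linarith
  · intro hd
    filter_upwards [hclose] with ε hε
    refine hd.of_close (continuous_arcMean (integrable_of_continuous hG) ε) fun z => ?_
    rw [h1]
    linarith [hε z]

theorem IsPhase.hasDegree {h : Circle → Circle} {φ : ℝ → ℝ} {d : ℤ} (hφ : IsPhase h φ d) :
    HasDegree h d :=
  (hasDegree_iff_of_ae_eq (continuous_coe_circle hφ.continuous) (ae_eq_refl _)).2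
    hφ.hasContinuousDegree

theorem integrable_circle {f : Circle → Circle}
    (hf : AEStronglyMeasurable (fun z => (f z : ℂ)) arcLength) :
    Integrable (fun z => (f z : ℂ)) arcLength :=
  Integrable.of_bound hf 1 (Eventually.of_forall fun _ => (Circle.norm_coe _).le)

/-- On short arcs `h` is nearly constant, so the arc mean of `f h` is within `1 / 4` of the arc mean
of `f` times `h`. As `f` may be discontinuous, the lower bound `1 / 2` on its means is what makes
this perturbation harmless. -/
theorem HasDegree.mul_phase {f : Circle → Circle} {d D : ℤ} (hd : HasDegree f d)
    (hf : AEStronglyMeasurable (fun z => (f z : ℂ)) arcLength)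
    (hlow : ∀ᶠ ε in 𝓝[>] (0 : ℝ), ∀ z, 1 / 2 ≤ ‖arcMean (fun z => (f z : ℂ)) ε z‖)
    {h : Circle → Circle} {χ : ℝ → ℝ} (hχ : IsPhase h χ D) :
    HasDegree (fun z => f z * h z) (d + D) := by
  have hhc : Continuous fun z => (h z : ℂ) := continuous_coe_circle hχ.continuous
  have hfi := integrable_circle hf
  have hfh : Integrable (fun z => (f z : ℂ) * h z) arcLength :=
    hfi.mul_bdd (c := 1) hhc.aestronglyMeasurable
      (Eventually.of_forall fun z => (Circle.norm_coe _).le)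
  filter_upwards [hd, hlow, eventually_oscillation_le hhc (η := 1 / 4) (by norm_num),
    self_mem_nhdsWithin] with ε h1 h2 h3 hpos
  simp only [Circle.coe_mul]
  refine (h1.mul_phase hχ).of_close (continuous_arcMean hfh ε) fun z => ?_
  rw [norm_mul, Circle.norm_coe, mul_one, ← arcMean_mul_const, ← arcMean_sub hfh (hfi.mul_const _)]
  refine lt_of_le_of_lt (norm_arcMean_le (η := 1 / 4) hpos fun t ht => ?_)
    (lt_of_lt_of_le (by norm_num) (h2 z))
  rw [← mul_sub, norm_mul, Circle.norm_coe, one_mul]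
  exact h3 z t ht

/-! ### Sobolev embedding -/

/-- The difference of two averages is the average of `f (exp s) - f (exp t)` over the product of the
two arcs. -/
theorem enorm_average_sub_average_le {f : Circle → ℂ} (hf : Integrable f arcLength)
    {a b l l' : ℝ} (hl : 0 < l) (hl' : 0 < l') :
    ‖l⁻¹ • (∫ t in a..(a + l), f (Circle.exp t)) - l'⁻¹ • ∫ t in b..(b + l'), f (Circle.exp t)‖ₑ ≤
      ENNReal.ofReal (l * l')⁻¹ * ∫⁻ s in Set.Ioc a (a + l), ∫⁻ t in Set.Ioc b (b + l'),
        ‖f (Circle.exp s) - f (Circle.exp t)‖ₑ := by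
  have hI := (intervalIntegrable_iff_integrableOn_Ioc_of_le (by linarith)).1
    (intervalIntegrable_comp_exp hf a (a + l))
  have hJ := (intervalIntegrable_iff_integrableOn_Ioc_of_le (by linarith)).1
    (intervalIntegrable_comp_exp hf b (b + l'))
  have key : l⁻¹ • (∫ t in a..(a + l), f (Circle.exp t)) -
      l'⁻¹ • (∫ t in b..(b + l'), f (Circle.exp t)) =
      (l * l')⁻¹ • ∫ s in Set.Ioc a (a + l), ∫ t in Set.Ioc b (b + l'),
        (f (Circle.exp s) - f (Circle.exp t)) := by
    have h1 : ∀ s, ∫ t in Set.Ioc b (b + l'), (f (Circle.exp s) - f (Circle.exp t)) =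
        l' • f (Circle.exp s) - ∫ t in Set.Ioc b (b + l'), f (Circle.exp t) := by
      intro s
      rw [integral_sub (integrable_const _) hJ, integral_const, measureReal_restrict_apply_univ,
        Real.volume_real_Ioc_of_le (by linarith), add_sub_cancel_left]
    simp_rw [h1]
    rw [integral_sub (show Integrable (fun s => l' • f (Circle.exp s)) _ from hI.smul l')
      (integrable_const _), integral_const, integral_smul,
      measureReal_restrict_apply_univ,
      Real.volume_real_Ioc_of_le (by linarith), add_sub_cancel_left,
      intervalIntegral.integral_of_le (by linarith), intervalIntegral.integral_of_le (by linarith),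
      smul_sub, smul_smul, smul_smul]
    congr 2 <;> field_simp
  rw [key, enorm_smul]
  refine mul_le_mul' ?_ ((enorm_integral_le_lintegral_enorm _).trans
    (lintegral_mono fun s => enorm_integral_le_lintegral_enorm _))
  rw [Real.enorm_eq_ofReal (by positivity)]

theorem setLIntegral_enorm_le {σ : Set ℝ} {a p : ℝ} (hp : 1 ≤ p)
    (hσa : σ ⊆ Set.Ioc a (a + 2 * Real.pi)) {f : Circle → ℂ}
    (hf : AEStronglyMeasurable f arcLength) :
    ∫⁻ t in σ, ‖f (Circle.exp t)‖ₑ ≤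
      eLpNorm f (ENNReal.ofReal p) arcLength * volume σ ^ (1 - 1 / p) := by
  have hp0 : 0 < p := by linarith
  have h1 := eLpNorm'_le_eLpNorm'_mul_rpow_measure_univ (μ := volume.restrict σ) one_pos hp
    ((aestronglyMeasurable_comp_exp hf).mono_measure Measure.restrict_le_self)
  simp only [eLpNorm', ENNReal.rpow_one, div_one, Measure.restrict_apply_univ] at h1
  refine h1.trans ?_
  gcongr
  rw [eLpNorm_eq_lintegral_rpow_enorm_toReal (by simpa using hp0) ENNReal.ofReal_ne_top,
    ENNReal.toReal_ofReal hp0.le]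
  gcongr
  exact setLIntegral_exp_le (F := fun z => ‖f z‖ₑ ^ p) hσa

theorem lintegral_enorm_le_eLpNorm {p : ℝ} (hp : 1 ≤ p) {f : Circle → ℂ}
    (hf : AEStronglyMeasurable f arcLength) :
    ∫⁻ z, ‖f z‖ₑ ∂arcLength ≤
      eLpNorm f (ENNReal.ofReal p) arcLength * ENNReal.ofReal (2 * Real.pi) ^ (1 - 1 / p) := by
  rw [lintegral_arcLength' _ 0]
  have := setLIntegral_enorm_le (a := 0) hp subset_rfl hf
  rwa [Real.volume_Ioc, add_sub_cancel_left] at this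

/-- Poincaré inequality, in the mean. -/
theorem lintegral_enorm_le_gagliardo {σ p : ℝ} (hσ : 0 ≤ σ) (hp : 1 ≤ p) :
    ∃ C : ℝ≥0∞, C ≠ ⊤ ∧ ∀ f : Circle → ℂ, Integrable f arcLength → ∫ z, f z ∂arcLength = 0 →
      ∫⁻ z, ‖f z‖ₑ ∂arcLength ≤ C * gagliardo σ p f := by
  have hp0 : 0 < p := by linarith
  have hpi := Real.pi_pos
  have h1p : 0 ≤ 1 - 1 / p := by
    rw [sub_nonneg, div_le_one hp0]; exact hp
  set T := ENNReal.ofReal (2 * Real.pi) with hT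
  have hT0 : T ≠ 0 := by simp [hT, hpi]
  have hTt : T ≠ ⊤ := ENNReal.ofReal_ne_top
  refine ⟨T⁻¹ * ((T * T) ^ (1 - 1 / p) * ENNReal.ofReal 2 ^ (1 / p + σ)), ?_, fun f hf h0 => ?_⟩
  · finiteness
  -- As `f` has mean zero, `2π f(x)` is the integral over `y` of `f(x) - f(y)`.
  have h1 : ∀ x, T * ‖f x‖ₑ ≤ ∫⁻ y, ‖f x - f y‖ₑ ∂arcLength := by
    intro x
    have h2 : ∫ y, (f x - f y) ∂arcLength = (2 * Real.pi) • f x := by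
      rw [integral_sub (integrable_const _) hf, h0, sub_zero, integral_const, measureReal_def,
        arcLength_univ, ENNReal.toReal_ofReal (by positivity)]
    calc T * ‖f x‖ₑ = ‖(2 * Real.pi) • f x‖ₑ := by
          rw [enorm_smul, Real.enorm_eq_ofReal (by positivity)]
      _ ≤ _ := by rw [← h2]; exact enorm_integral_le_lintegral_enorm _
  have h3 := lintegral_lintegral_enorm_sub_le (a := 0) (b := 0) (R := 2) hp hσ hf.1
    measurableSet_Ioc measurableSet_Ioc subset_rfl subset_rfl
    (fun s _ t _ => dist_circle_le_two _ _)
  rw [Real.volume_Ioc, add_sub_cancel_left, ← hT] at h3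
  have h4 : T * ∫⁻ z, ‖f z‖ₑ ∂arcLength ≤
      (T * T) ^ (1 - 1 / p) * ENNReal.ofReal 2 ^ (1 / p + σ) * gagliardo σ p f := by
    rw [← lintegral_const_mul' _ _ hTt]
    refine (lintegral_mono h1).trans ?_
    rw [lintegral_arcLength' _ 0]
    simp_rw [lintegral_arcLength' _ 0]
    refine h3.trans ?_
    rw [gagliardo_eq]
    gcongr
    exact nearEnergy_le _ _ _ _
  calc _ = T⁻¹ * (T * ∫⁻ z, ‖f z‖ₑ ∂arcLength) := by
        rw [← mul_assoc, ENNReal.inv_mul_cancel hT0 hTt, one_mul]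
    _ ≤ T⁻¹ * ((T * T) ^ (1 - 1 / p) * ENNReal.ofReal 2 ^ (1 / p + σ) * gagliardo σ p f) := by
        gcongr
    _ = _ := by ring

theorem enorm_sub_le_of_isPrimitive {U v : Circle → ℂ}
    (h : IsPrimitive (fun t => U (Circle.exp t)) (fun t => v (Circle.exp t))) (x y : Circle) :
    ‖U x - U y‖ₑ ≤ ∫⁻ z, ‖v z‖ₑ ∂arcLength := by
  obtain ⟨b, rfl⟩ := Circle.exp_surjective x
  obtain ⟨a, rfl⟩ := Circle.exp_surjective y
  obtain ⟨n, hn, -⟩ := existsUnique_add_zsmul_mem_Ioc Real.two_pi_pos b a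
  have hb : Circle.exp b = Circle.exp (b + n • (2 * Real.pi)) :=
    (Circle.periodic_exp.zsmul n b).symm
  rw [hb]
  refine (h.norm_sub_le hn.1.le).trans ?_
  refine setLIntegral_exp_le (F := fun z => ‖v z‖ₑ) (a := a) fun t ht => ⟨ht.1, ht.2.trans hn.2⟩

/-- A function of mean zero is at each point the average of its differences, and each difference is
at most the total variation. -/
theorem IsWeakDeriv.ae_enorm_le {w w' : Circle → ℂ} (h : IsWeakDeriv w w')
    (h0 : ∫ z, w z ∂arcLength = 0) : ∀ᵐ z ∂arcLength, ‖w z‖ₑ ≤ ∫⁻ z, ‖w' z‖ₑ ∂arcLength := by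
  obtain ⟨U, hUc, hU, hP⟩ := h.exists_primitive
  have hpi := Real.pi_pos
  set T := ENNReal.ofReal (2 * Real.pi) with hT
  have hT0 : T ≠ 0 := by simp [hT, hpi]
  have hTt : T ≠ ⊤ := ENNReal.ofReal_ne_top
  have hU0 : ∫ z, U z ∂arcLength = 0 := by rw [← h0]; exact integral_congr_ae hU.symm
  filter_upwards [hU] with x hx
  rw [hx]
  have h2 : ∫ y, (U x - U y) ∂arcLength = (2 * Real.pi) • U x := by
    rw [integral_sub (integrable_const _) (integrable_of_continuous hUc), hU0, sub_zero,
      integral_const, measureReal_def,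
      arcLength_univ, ENNReal.toReal_ofReal (by positivity)]
  have h3 : T * ‖U x‖ₑ ≤ T * ∫⁻ z, ‖w' z‖ₑ ∂arcLength := by
    calc T * ‖U x‖ₑ = ‖(2 * Real.pi) • U x‖ₑ := by
          rw [enorm_smul, Real.enorm_eq_ofReal (by positivity)]
      _ ≤ ∫⁻ y, ‖U x - U y‖ₑ ∂arcLength := by rw [← h2]; exact enorm_integral_le_lintegral_enorm _
      _ ≤ ∫⁻ y, (∫⁻ z, ‖w' z‖ₑ ∂arcLength) ∂arcLength :=
          lintegral_mono fun y => enorm_sub_le_of_isPrimitive hP x y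
      _ = _ := by rw [lintegral_const, arcLength_univ, mul_comm]
  exact (ENNReal.mul_le_mul_iff_right hT0 hTt).1 h3

theorem MemSobolev.integral_eq_zero {s p : ℝ} {u : Circle → ℂ} (h : MemSobolev s p u) {k : ℕ}
    (hk : k < ⌊s⌋₊) : ∫ z, weakDeriv^[k + 1] u z ∂arcLength = 0 :=
  (h.isWeakDeriv hk).integral_eq_zero

theorem exists_lintegral_top_le {s p : ℝ} (hs : 1 ≤ s) (hp : 1 ≤ p) :
    ∃ C : ℝ≥0∞, C ≠ ⊤ ∧ ∀ u : Circle → ℂ, MemSobolev s p u →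
      ∫⁻ z, ‖weakDeriv^[⌊s⌋₊] u z‖ₑ ∂arcLength ≤ C * seminorm s p u := by
  have hm : 1 ≤ ⌊s⌋₊ := Nat.one_le_floor_iff _ |>.2 hs
  have h1p : 0 ≤ 1 - 1 / p := by
    rw [sub_nonneg, div_le_one (by linarith)]; exact hp
  by_cases hi : s = ⌊s⌋₊
  · refine ⟨ENNReal.ofReal (2 * Real.pi) ^ (1 - 1 / p), by finiteness, fun u hu => ?_⟩
    rw [seminorm, if_pos hi, mul_comm]
    exact lintegral_enorm_le_eLpNorm hp (hu.memLp _ le_rfl).1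
  · obtain ⟨C, hC, h⟩ := lintegral_enorm_le_gagliardo (frac_pos_of_ne (by linarith) hi).le hp
    refine ⟨C, hC, fun u hu => ?_⟩
    rw [seminorm, if_neg hi]
    refine h _ (hu.integrable hp le_rfl) ?_
    obtain ⟨m, hm'⟩ := Nat.exists_eq_add_of_le' hm
    have := hu.integral_eq_zero (k := m) (by omega)
    rwa [← hm'] at this

/-- Descending induction from the top order, `j` counting the orders below it. A derivative of order
at least `1` has mean zero on the circle, so it is bounded by the `L¹` norm of the next one. -/
theorem exists_lintegral_deriv_le {s p : ℝ} (hp : 1 ≤ p) (j : ℕ) :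
    ∃ C : ℝ≥0∞, C ≠ ⊤ ∧ ∀ u : Circle → ℂ, MemSobolev s p u → ∀ k, 1 ≤ k → k + j = ⌊s⌋₊ →
      ∫⁻ z, ‖weakDeriv^[k] u z‖ₑ ∂arcLength ≤ C * seminorm s p u := by
  induction j with
  | zero =>
    by_cases hs : 1 ≤ s
    · obtain ⟨C, hC, h⟩ := exists_lintegral_top_le hs hp
      refine ⟨C, hC, fun u hu k _ hk' => ?_⟩
      rw [show k = ⌊s⌋₊ from hk']
      exact h u hu
    · refine ⟨0, by simp, fun u _ k hk hk' => ?_⟩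
      rw [Nat.floor_eq_zero.2 (not_le.1 hs)] at hk'
      omega
  | succ j ih =>
    obtain ⟨C, hC, h⟩ := ih
    refine ⟨ENNReal.ofReal (2 * Real.pi) * C, by finiteness, fun u hu k hk hk' => ?_⟩
    obtain ⟨i, rfl⟩ := Nat.exists_eq_add_of_le' hk
    have h1 := (hu.isWeakDeriv (k := i + 1) (by omega)).ae_enorm_le
      (hu.integral_eq_zero (by omega))
    have h2 := h u hu (i + 1 + 1) (by omega) (by omega)
    calc _ ≤ ∫⁻ _, C * seminorm s p u ∂arcLength :=
          lintegral_mono_ae (h1.mono fun z hz => hz.trans h2)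
      _ = _ := by rw [lintegral_const, arcLength_univ]; ring

/-- Equi-integrability of the first weak derivative. -/
theorem exists_modulus_lintegral_deriv {s p : ℝ} (hs : 1 ≤ s) (hp : 1 ≤ p) (hsp : 1 < s * p) :
    ∃ W : ℕ → ℝ≥0∞, Tendsto W atTop (𝓝 0) ∧ ∀ u : Circle → ℂ, MemSobolev s p u →
      ∀ (k : ℕ) (a b : ℝ), a ≤ b → b ≤ a + (1 / 4) ^ k →
        ∫⁻ t in Set.Ioc a b, ‖weakDeriv u (Circle.exp t)‖ₑ ≤ W k * seminorm s p u := by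
  have hp0 : 0 < p := by linarith
  have hm : 1 ≤ ⌊s⌋₊ := Nat.one_le_floor_iff _ |>.2 hs
  have h1p : 0 ≤ 1 - 1 / p := by
    rw [sub_nonneg, div_le_one (by linarith)]; exact hp
  have hpi := Real.pi_gt_three
  have hpow : ∀ k : ℕ, ((1 : ℝ) / 4) ^ k ≤ 1 := fun k => pow_le_one₀ (by norm_num) (by norm_num)
  have hgeom : ∀ r : ℝ, 0 ≤ r → r < 1 → ∀ e : ℝ, 0 < e →
      Tendsto (fun k : ℕ => ENNReal.ofReal (r ^ k) ^ e) atTop (𝓝 0) := by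
    intro r hr hr1 e he
    have h1 : Tendsto (fun k : ℕ => ENNReal.ofReal (r ^ k)) atTop (𝓝 0) := by
      simpa using ENNReal.tendsto_ofReal (tendsto_pow_atTop_nhds_zero_of_lt_one hr hr1)
    have h2 := ((ENNReal.continuous_rpow_const (y := e)).tendsto 0).comp h1
    simpa [he, Function.comp_def] using h2
  -- If `⌊s⌋ ≥ 2` the first derivative is bounded. If `s = 1`, then `p > 1` and Hölder gains a
  -- positive power of the length. There remains `1 < s < 2`.
  rcases hm.lt_or_eq with hm2 | hm1
  · obtain ⟨C, hC, h⟩ := exists_lintegral_deriv_le (s := s) hp (⌊s⌋₊ - 2)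
    refine ⟨fun k => ENNReal.ofReal ((1 / 4) ^ k) ^ (1 : ℝ) * C, ?_, fun u hu k a b hab hb => ?_⟩
    · simpa using ENNReal.Tendsto.mul_const (hgeom (1 / 4) (by norm_num) (by norm_num) 1 one_pos)
        (Or.inr hC)
    have h1 := (hu.isWeakDeriv (k := 1) (by omega)).ae_enorm_le
      (hu.integral_eq_zero (by omega))
    have h2 := h u hu 2 (by omega) (by omega)
    have h3 : ∀ᵐ t : ℝ, ‖weakDeriv u (Circle.exp t)‖ₑ ≤ C * seminorm s p u :=
      ae_arcLength_iff.1 (h1.mono fun z hz => hz.trans h2)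
    calc _ ≤ ∫⁻ _ in Set.Ioc a b, C * seminorm s p u := lintegral_mono_ae (ae_restrict_of_ae h3)
      _ = ENNReal.ofReal (b - a) * C * seminorm s p u := by
          rw [setLIntegral_const, Real.volume_Ioc]; ring
      _ ≤ _ := by
          simp only [ENNReal.rpow_one]
          gcongr
          linarith
  by_cases hi : s = ⌊s⌋₊
  · have hp1 : 1 < p := by
      rw [hi, ← hm1] at hsp
      simpa using hsp
    have he : 0 < 1 - 1 / p := by
      rw [sub_pos, div_lt_one hp0]; exact hp1
    refine ⟨fun k => ENNReal.ofReal ((1 / 4) ^ k) ^ (1 - 1 / p),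
      hgeom _ (by norm_num) (by norm_num) _ he, fun u hu k a b hab hb => ?_⟩
    have h1 := setLIntegral_enorm_le (σ := Set.Ioc a b) (a := a) hp
      (fun t ht => ⟨ht.1, by linarith [ht.2, hpow k]⟩) (hu.memLp 1 hm).1
    rw [seminorm, if_pos hi, ← hm1, mul_comm]
    refine h1.trans ?_
    rw [Real.volume_Ioc]
    simp only [Function.iterate_one]
    gcongr
    linarith
  · set σ := s - ⌊s⌋₊ with hσ
    have hσ0 : 0 < σ := frac_pos_of_ne (by linarith) hi
    obtain ⟨C, hC, hL1⟩ := exists_lintegral_top_le hs hp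
    have he : 0 < 1 - 1 / p + σ := by linarith
    refine ⟨fun k => ENNReal.ofReal ((1 / 2) ^ k) ^ (1 - 1 / p + σ) +
      ENNReal.ofReal ((1 / 2) ^ k) ^ (1 : ℝ) * C, ?_, fun u hu k a b hab hb => ?_⟩
    · simpa using (hgeom (1 / 2) (by norm_num) (by norm_num) _ he).add
        (ENNReal.Tendsto.mul_const (hgeom (1 / 2) (by norm_num) (by norm_num) 1 one_pos)
          (Or.inr hC))
    -- The arc has length at most `L ^ 2` and is compared with a longer one of length `L`. The
    -- oscillation between the two is controlled by the Gagliardo energy, and the rest is a fraction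
    -- at most `L` of the full `L¹` norm. This works even for `p = 1`, where Hölder gains nothing.
    set L : ℝ := (1 / 2) ^ k with hL
    have hL0 : 0 < L := by positivity
    have hLL : (1 / 4 : ℝ) ^ k = L * L := by
      rw [hL, ← mul_pow]; norm_num
    have hL1' : L ≤ 1 := pow_le_one₀ (by norm_num) (by norm_num)
    have hbL : b ≤ a + L := by nlinarith
    set Λ := ENNReal.ofReal L with hΛ
    have hΛ0 : Λ ≠ 0 := by simp [hΛ, hL0]
    have hΛt : Λ ≠ ⊤ := ENNReal.ofReal_ne_top
    have hint := hu.integrable hp (k := 1) hm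
    have hmeas := hint.1
    simp only [Function.iterate_one] at hint hmeas
    set h := weakDeriv u with hh
    have hme : AEMeasurable (fun t : ℝ => ‖h (Circle.exp t)‖ₑ) volume :=
      (aestronglyMeasurable_comp_exp hmeas).enorm
    have htop : ∫⁻ z, ‖h z‖ₑ ∂arcLength ≤ C * seminorm s p u := by
      have := hL1 u hu
      rwa [← hm1] at this
    have hosc := lintegral_lintegral_enorm_sub_le (σ := σ) (R := L) (a := a) (b := a)
      hp hσ0.le hmeas
      (measurableSet_Ioc (a := a) (b := b)) (measurableSet_Ioc (a := a) (b := a + L))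
      (fun t ht => ⟨ht.1, by linarith [ht.2]⟩) (fun t ht => ⟨ht.1, by linarith [ht.2]⟩)
      (fun s hs t ht => (dist_exp_exp_le s t).trans
        (abs_le.2 ⟨by linarith [hs.1, ht.2], by linarith [ht.1, hs.2]⟩))
    have hsemi : nearEnergy σ p L h ^ (1 / p) ≤ seminorm s p u := by
      rw [seminorm, if_neg hi, ← hm1, gagliardo_eq]
      gcongr
      simp only [Function.iterate_one, Nat.cast_one] at *
      rw [show s - 1 = σ by rw [hσ, ← hm1]; simp]
      exact nearEnergy_le _ _ _ _
    rw [Real.volume_Ioc, Real.volume_Ioc, add_sub_cancel_left, ← hΛ] at hosc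
    have hba : ENNReal.ofReal (b - a) ≤ Λ * Λ := by
      rw [hΛ, ← ENNReal.ofReal_mul hL0.le]
      exact ENNReal.ofReal_le_ofReal (by linarith)
    have hba' : ENNReal.ofReal (b - a) ≤ Λ := ENNReal.ofReal_le_ofReal (by linarith)
    have hosc2 : ∫⁻ s in Set.Ioc a b, ∫⁻ t in Set.Ioc a (a + L),
        ‖h (Circle.exp s) - h (Circle.exp t)‖ₑ ≤ Λ * (Λ ^ (1 - 1 / p + σ) * seminorm s p u) := by
      refine hosc.trans ?_
      calc _ ≤ (Λ * Λ) ^ (1 - 1 / p) * Λ ^ (1 / p + σ) * seminorm s p u := by gcongr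
        _ = _ := by
          rw [ENNReal.mul_rpow_of_nonneg _ _ h1p, ← ENNReal.rpow_add _ _ hΛ0 hΛt,
            ← ENNReal.rpow_add _ _ hΛ0 hΛt, ← mul_assoc]
          congr 1
          nth_rewrite 2 [← ENNReal.rpow_one Λ]
          rw [← ENNReal.rpow_add _ _ hΛ0 hΛt]
          congr 1
          ring
    have key : Λ * ∫⁻ t in Set.Ioc a b, ‖h (Circle.exp t)‖ₑ ≤
        Λ * ((Λ ^ (1 - 1 / p + σ) + Λ ^ (1 : ℝ) * C) * seminorm s p u) := by
      calc Λ * ∫⁻ t in Set.Ioc a b, ‖h (Circle.exp t)‖ₑ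
          = ∫⁻ s in Set.Ioc a b, ∫⁻ t in Set.Ioc a (a + L), ‖h (Circle.exp s)‖ₑ := by
            rw [← lintegral_const_mul' _ _ hΛt]
            refine lintegral_congr fun s => ?_
            rw [setLIntegral_const, Real.volume_Ioc, add_sub_cancel_left, mul_comm]
        _ ≤ ∫⁻ s in Set.Ioc a b, ∫⁻ t in Set.Ioc a (a + L),
            (‖h (Circle.exp s) - h (Circle.exp t)‖ₑ + ‖h (Circle.exp t)‖ₑ) := by
            refine lintegral_mono fun s => lintegral_mono fun t => ?_
            have := enorm_add_le (h (Circle.exp s) - h (Circle.exp t)) (h (Circle.exp t))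
            rwa [sub_add_cancel] at this
        _ = (∫⁻ s in Set.Ioc a b, ∫⁻ t in Set.Ioc a (a + L),
              ‖h (Circle.exp s) - h (Circle.exp t)‖ₑ) +
            ENNReal.ofReal (b - a) * ∫⁻ t in Set.Ioc a (a + L), ‖h (Circle.exp t)‖ₑ := by
            simp_rw [lintegral_add_right' _ hme.restrict]
            rw [lintegral_add_right' _ aemeasurable_const, setLIntegral_const, Real.volume_Ioc,
              mul_comm (ENNReal.ofReal (b - a))]
        _ ≤ Λ * (Λ ^ (1 - 1 / p + σ) * seminorm s p u) + Λ * Λ * (C * seminorm s p u) := by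
            gcongr
            refine le_trans (setLIntegral_exp_le (F := fun z => ‖h z‖ₑ) (a := a) ?_) htop
            exact fun t ht => ⟨ht.1, by linarith [ht.2]⟩
        _ = _ := by rw [ENNReal.rpow_one]; ring
    exact (ENNReal.mul_le_mul_iff_right hΛ0 hΛt).1 key

/-- When `l`, `l'` and `R` are comparable the factor is of order `R ^ (s - 1 / p)`, a positive power
exactly when `s p > 1`; this drives the Morrey argument. -/
theorem norm_average_sub_average_le {s p : ℝ} (hs : 0 ≤ s) (hp : 1 ≤ p) {f : Circle → ℂ}
    (hf : Integrable f arcLength) (hfin : gagliardo s p f ≠ ⊤) {a b l l' R : ℝ} (hl : 0 < l)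
    (hl' : 0 < l') (hl2 : l ≤ 2 * Real.pi) (hl2' : l' ≤ 2 * Real.pi)
    (hR : ∀ t ∈ Set.Ioc a (a + l), ∀ t' ∈ Set.Ioc b (b + l'), |t - t'| ≤ R) :
    ‖l⁻¹ • (∫ t in a..(a + l), f (Circle.exp t)) - l'⁻¹ • ∫ t in b..(b + l'), f (Circle.exp t)‖ ≤
      (l * l') ^ (-(1 / p)) * R ^ (1 / p + s) * (gagliardo s p f).toReal := by
  have hp0 : 0 < p := by linarith
  have hR0 : 0 ≤ R := (abs_nonneg _).trans
    (hR (a + l) ⟨by linarith, le_rfl⟩ (b + l') ⟨by linarith, le_rfl⟩)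
  have h1 := lintegral_lintegral_enorm_sub_le (σ := s) (R := R) (a := a) (b := b) hp hs hf.1
      (measurableSet_Ioc (a := a) (b := a + l)) (measurableSet_Ioc (a := b) (b := b + l'))
      (fun t ht => ⟨ht.1, by linarith [ht.2]⟩) (fun t ht => ⟨ht.1, by linarith [ht.2]⟩)
      (fun t ht t' ht' => (dist_exp_exp_le t t').trans (hR t ht t' ht'))
  have h2 := (enorm_average_sub_average_le hf hl hl' (a := a) (b := b)).trans
    (mul_le_mul_right h1 _)
  have h3 : nearEnergy s p R f ^ (1 / p) ≤ gagliardo s p f := by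
    rw [gagliardo_eq]
    gcongr
    exact nearEnergy_le _ _ _ _
  rw [Real.volume_Ioc, Real.volume_Ioc, add_sub_cancel_left, add_sub_cancel_left,
    ← ENNReal.ofReal_mul hl.le, ENNReal.ofReal_rpow_of_pos (by positivity),
    ENNReal.ofReal_rpow_of_nonneg hR0 (by positivity), ← ENNReal.ofReal_mul (by positivity)] at h2
  have h4 := h2.trans (mul_le_mul_right (mul_le_mul_right h3 _) _)
  rw [← ENNReal.ofReal_toReal hfin, ← ENNReal.ofReal_mul (by positivity),
    ← ENNReal.ofReal_mul (by positivity), ← ofReal_norm,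
    ENNReal.ofReal_le_ofReal_iff (by positivity)] at h4
  refine h4.trans (le_of_eq ?_)
  have hll : 0 < l * l' := by positivity
  have h5 : (l * l') ^ (-(1 / p)) = (l * l')⁻¹ * (l * l') ^ (1 - 1 / p) := by
    rw [← Real.rpow_neg_one, ← Real.rpow_add hll]
    congr 1
    ring
  rw [h5]
  ring

/-- Fractional Morrey embedding: a version that is continuous along arcs. -/
theorem exists_continuous_version_of_gagliardo {s p : ℝ} (hs : 0 < s) (hp : 1 ≤ p)
    (hsp : 1 < s * p) :
    ∃ K ρ : ℝ, 0 < K ∧ 0 < ρ ∧ ρ < 1 ∧ ∀ f : Circle → ℂ, Integrable f arcLength →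
      gagliardo s p f ≠ ⊤ → ∃ U : Circle → ℂ, Continuous U ∧ f =ᵐ[arcLength] U ∧
        ∀ (k : ℕ) (a b : ℝ), |a - b| ≤ (1 / 2) ^ k →
          ‖U (Circle.exp a) - U (Circle.exp b)‖ ≤ K * ρ ^ k * (gagliardo s p f).toReal := by
  have hp0 : 0 < p := by linarith
  have hpi := Real.pi_gt_three
  have hα : 0 < s - 1 / p := by
    rw [sub_pos, div_lt_iff₀ hp0]; exact hsp
  -- The constant given by arcs of lengths `l = x` and `l' ≥ x / 2` whose points are at most `R = 2
  -- x` apart.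
  set K₀ : ℝ := 2 ^ (1 / p) * 2 ^ (1 / p + s) with hK₀
  have hK₀p : 0 < K₀ := by positivity
  set ρ : ℝ := (1 / 2) ^ (s - 1 / p) with hρ
  have hρ0 : 0 < ρ := by positivity
  have hρ1 : ρ < 1 := Real.rpow_lt_one (by norm_num) (by norm_num) hα
  have h1ρ : 0 < 1 - ρ := by linarith
  refine ⟨K₀ + 2 * (K₀ / (1 - ρ)), ρ, by positivity, hρ0, hρ1, fun f hf hfin => ?_⟩
  set S := (gagliardo s p f).toReal with hS
  have hS0 : 0 ≤ S := ENNReal.toReal_nonneg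
  -- Averages over the arcs of length `(1 / 2) ^ k` to the right of `θ`. They converge at a
  -- geometric rate, and their limit is the continuous version.
  set A : ℕ → ℝ → ℂ := fun k θ =>
    ((1 / 2 : ℝ) ^ k)⁻¹ • ∫ t in θ..(θ + (1 / 2) ^ k), f (Circle.exp t) with hA
  have hest : ∀ (k : ℕ) (a b l' : ℝ), |a - b| ≤ (1 / 2) ^ k → (1 / 2) ^ (k + 1) ≤ l' →
      l' ≤ (1 / 2) ^ k → ‖A k a - l'⁻¹ • ∫ t in b..(b + l'), f (Circle.exp t)‖ ≤
        K₀ * S * ρ ^ k := by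
    intro k a b l' hab h1 h2
    set x : ℝ := (1 / 2) ^ k with hx
    have hx0 : 0 < x := by positivity
    have hx1 : x ≤ 1 := pow_le_one₀ (by norm_num) (by norm_num)
    rw [pow_succ, ← hx] at h1
    have hl' : 0 < l' := by linarith
    refine (norm_average_sub_average_le hs.le hp hf hfin (R := 2 * x) hx0 hl' (by linarith)
      (by linarith) fun t ht t' ht' => ?_).trans ?_
    · have := abs_le.1 hab
      exact abs_le.2 ⟨by linarith [ht.1, ht'.2], by linarith [ht.2, ht'.1]⟩
    have hρk : ρ ^ k = x ^ (s - 1 / p) := by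
      rw [hρ, hx, ← Real.rpow_natCast, ← Real.rpow_natCast, ← Real.rpow_mul (by norm_num),
        ← Real.rpow_mul (by norm_num), mul_comm]
    calc (x * l') ^ (-(1 / p)) * (2 * x) ^ (1 / p + s) * S
        ≤ (x * (x * (1 / 2))) ^ (-(1 / p)) * (2 * x) ^ (1 / p + s) * S := by
          gcongr ?_ * _ * _
          refine Real.rpow_le_rpow_of_nonpos (by positivity) (by gcongr) ?_
          rw [neg_nonpos]; positivity
      _ = K₀ * S * ρ ^ k := by
          have e : x ^ (s - 1 / p) = x ^ (-(1 / p)) * x ^ (-(1 / p)) * x ^ (1 / p + s) := by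
            rw [← Real.rpow_add hx0, ← Real.rpow_add hx0]
            congr 1
            ring
          rw [hρk, hK₀, e, Real.mul_rpow hx0.le (by positivity), Real.mul_rpow hx0.le (by norm_num),
            Real.mul_rpow two_pos.le hx0.le, one_div 2, Real.inv_rpow two_pos.le,
            Real.rpow_neg two_pos.le (1 / p), inv_inv]
          ring
  have hstep : ∀ θ k, dist (A k θ) (A (k + 1) θ) ≤ K₀ * S * ρ ^ k := fun θ k => by
    rw [dist_eq_norm]
    refine hest k θ θ _ (by simp) le_rfl ?_
    rw [pow_succ]
    have : (0 : ℝ) < (1 / 2) ^ k := by positivity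
    linarith
  have hcauchy : ∀ θ, CauchySeq fun k => A k θ := fun θ =>
    cauchySeq_of_le_geometric _ _ hρ1 (hstep θ)
  choose V hV using fun θ => cauchySeq_tendsto_of_complete (hcauchy θ)
  have hVA : ∀ k θ, dist (A k θ) (V θ) ≤ K₀ * S * ρ ^ k / (1 - ρ) := fun k θ =>
    dist_le_of_le_geometric_of_tendsto _ _ hρ1 (hstep θ) (hV θ) k
  have hmod : ∀ (k : ℕ) (a b : ℝ), |a - b| ≤ (1 / 2) ^ k →
      ‖V a - V b‖ ≤ (K₀ + 2 * (K₀ / (1 - ρ))) * ρ ^ k * S := by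
    intro k a b hab
    have h1 := hVA k a
    have h2 := hVA k b
    have h3 : dist (A k a) (A k b) ≤ K₀ * S * ρ ^ k := by
      rw [dist_eq_norm]
      refine hest k a b _ hab ?_ le_rfl
      rw [pow_succ]
      have : (0 : ℝ) < (1 / 2) ^ k := by positivity
      linarith
    rw [← dist_eq_norm]
    calc dist (V a) (V b) ≤ dist (V a) (A k a) + dist (A k a) (A k b) + dist (A k b) (V b) :=
          dist_triangle4 _ _ _ _
      _ ≤ K₀ * S * ρ ^ k / (1 - ρ) + K₀ * S * ρ ^ k + K₀ * S * ρ ^ k / (1 - ρ) := by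
          rw [dist_comm (V a)]
          gcongr
      _ = _ := by ring
  have hper : Function.Periodic V (2 * Real.pi) := by
    intro θ
    refine tendsto_nhds_unique (hV (θ + 2 * Real.pi)) ?_
    have : (fun k => A k (θ + 2 * Real.pi)) = fun k => A k θ := by
      funext k
      simp only [hA]
      congr 1
      rw [add_right_comm, ← intervalIntegral.integral_comp_add_right
        (fun t => f (Circle.exp t))]
      simp
    rw [this]
    exact hV θ
  have hVc : Continuous V := by
    refine continuous_iff_continuousAt.2 fun a => Metric.continuousAt_iff.2 fun η hη => ?_
    have hlim : Tendsto (fun k : ℕ => (K₀ + 2 * (K₀ / (1 - ρ))) * ρ ^ k * S) atTop (𝓝 0) := by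
      simpa using ((tendsto_pow_atTop_nhds_zero_of_lt_one hρ0.le hρ1).const_mul
        (K₀ + 2 * (K₀ / (1 - ρ)))).mul_const S
    obtain ⟨k, hk⟩ := (hlim.eventually (gt_mem_nhds hη)).exists
    refine ⟨(1 / 2) ^ k, by positivity, fun {b} hb => ?_⟩
    rw [dist_eq_norm]
    exact (hmod k b a hb.le).trans_lt hk
  obtain ⟨U, hU⟩ := exists_lift_of_periodic hper
  refine ⟨U, continuous_of_comp_exp (by simpa only [hU] using hVc), ?_, fun k a b hab => ?_⟩
  · refine ae_arcLength_iff.2 ?_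
    have hii := intervalIntegrable_comp_exp hf
    have hP : IsPrimitive (fun t => ∫ s in (0 : ℝ)..t, f (Circle.exp s))
        (fun t => f (Circle.exp t)) := fun c d =>
      ⟨hii c d, intervalIntegral.integral_interval_sub_left (hii _ _) (hii _ _)⟩
    filter_upwards [hP.ae_hasDerivAt] with t ht
    rw [hU]
    -- The averages are right difference quotients of a primitive of `f`, so by Lebesgue
    -- differentiation their limit is `f` almost everywhere.
    refine tendsto_nhds_unique ?_ (hV t)
    have h1 := ht.tendsto_slope_zero_right
    have h2 : Tendsto (fun k : ℕ => ((1 : ℝ) / 2) ^ k) atTop (𝓝[>] 0) :=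
      tendsto_nhdsWithin_iff.2 ⟨tendsto_pow_atTop_nhds_zero_of_lt_one (by norm_num) (by norm_num),
        Eventually.of_forall fun k => by simp⟩
    refine (h1.comp h2).congr fun k => ?_
    simp only [Function.comp_apply, hA]
    rw [(hP t (t + (1 / 2) ^ k)).2]
  · rw [hU, hU]
    exact hmod k a b hab

/-- Sobolev embedding: when `sp > 1`, functions in `W^{s,p}` have continuous versions, with a
modulus of continuity controlled by the top-order semi-norm. -/
theorem exists_continuous_version {s p : ℝ} (hs : 0 < s) (hp : 1 ≤ p) (hsp : 1 < s * p) :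
    ∃ W : ℕ → ℝ≥0∞, Tendsto W atTop (𝓝 0) ∧ ∀ u : Circle → ℂ, MemSobolev s p u →
      ∃ U : Circle → ℂ, Continuous U ∧ u =ᵐ[arcLength] U ∧
        ∀ (k : ℕ) (a b : ℝ), |a - b| ≤ (1 / 4) ^ k →
          ‖U (Circle.exp a) - U (Circle.exp b)‖ₑ ≤ W k * seminorm s p u := by
  rcases lt_or_ge s 1 with hs1 | hs1
  · have h0 : ⌊s⌋₊ = 0 := Nat.floor_eq_zero.2 hs1
    have hne : s ≠ ⌊s⌋₊ := by rw [h0]; simpa using hs.ne'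
    obtain ⟨K, ρ, hK, hρ, hρ1, h⟩ := exists_continuous_version_of_gagliardo hs hp hsp
    refine ⟨fun k => ENNReal.ofReal (K * ρ ^ k), ?_, fun u hu => ?_⟩
    · have := ENNReal.tendsto_ofReal
        ((tendsto_pow_atTop_nhds_zero_of_lt_one hρ.le hρ1).const_mul K)
      simpa using this
    have hsem : seminorm s p u = gagliardo s p u := by
      rw [seminorm, if_neg hne, h0]
      simp
    have hfin := hu.seminorm_lt_top
    rw [hsem] at hfin ⊢
    obtain ⟨U, hUc, hU, hb⟩ := h u (hu.integrable hp (Nat.zero_le _)) hfin.ne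
    refine ⟨U, hUc, hU, fun k a b hab => ?_⟩
    rw [← ofReal_norm, ← ENNReal.ofReal_toReal hfin.ne, ← ENNReal.ofReal_mul (by positivity)]
    refine ENNReal.ofReal_le_ofReal (hb k a b (hab.trans ?_))
    gcongr
    norm_num
  · obtain ⟨W, hW, h⟩ := exists_modulus_lintegral_deriv hs1 hp hsp
    refine ⟨W, hW, fun u hu => ?_⟩
    obtain ⟨U, hUc, hU, hP⟩ := (hu.isWeakDeriv (k := 0)
      (Nat.one_le_floor_iff _ |>.2 hs1)).exists_primitive
    refine ⟨U, hUc, hU, fun k a b hab => ?_⟩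
    wlog hle : a ≤ b generalizing a b
    · rw [← enorm_neg, neg_sub]
      exact this b a (by rwa [abs_sub_comm]) (le_of_not_ge hle)
    rw [← enorm_neg, neg_sub]
    exact (hP.norm_sub_le hle).trans (h u hu k a b hle (by linarith [(abs_le.1 hab).1]))

/-! ### Oscillating maps -/

theorem IsPhase.isSmooth {h : Circle → Circle} {φ : ℝ → ℝ} {d : ℤ} (hφ : IsPhase h φ d)
    (hs : ContDiff ℝ ∞ φ) : IsSmooth fun z => (h z : ℂ) := by
  rw [IsSmooth]
  simp_rw [hφ.2.1, Circle.coe_exp]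
  exact Complex.contDiff_exp.comp ((Complex.ofRealCLM.contDiff.comp hs).mul contDiff_const)

theorem IsPhase.mem_degreeClass {h : Circle → Circle} {φ : ℝ → ℝ} {d : ℤ} (hφ : IsPhase h φ d)
    (hs : ContDiff ℝ ∞ φ) {s p : ℝ} (hs0 : 0 < s) (hp : 1 ≤ p) : h ∈ degreeClass s p d :=
  ⟨(hφ.isSmooth hs).memSobolev hs0 hp, hφ.hasDegree⟩

/-- The phase `dθ + δ sin nθ`. -/
noncomputable def wigglePhase (d : ℤ) (δ : ℝ) (n : ℕ) (θ : ℝ) : ℝ := d * θ + δ * Real.sin (n * θ)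

/-- The map `e^{iθ} ↦ e^{i(dθ + δ sin nθ)}`. -/
noncomputable def wiggle (d : ℤ) (δ : ℝ) (n : ℕ) (z : Circle) : Circle :=
  z ^ d * Circle.exp (δ * ((z : ℂ) ^ n).im)

theorem contDiff_wigglePhase (d : ℤ) (δ : ℝ) (n : ℕ) : ContDiff ℝ ∞ (wigglePhase d δ n) := by
  unfold wigglePhase
  fun_prop

theorem isPhase_wiggle (d : ℤ) (δ : ℝ) (n : ℕ) : IsPhase (wiggle d δ n) (wigglePhase d δ n) d := by
  refine ⟨(contDiff_wigglePhase d δ n).continuous, fun θ => ?_, fun θ => ?_⟩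
  · rw [wiggle, wigglePhase, Circle.exp_add, Circle.exp_intCast_mul]
    congr 3
    rw [← Circle.coe_pow, ← Circle.exp_natCast_mul, Circle.coe_exp, Complex.exp_ofReal_mul_I_im]
  · rw [wigglePhase, wigglePhase, mul_add (n : ℝ), Real.sin_add_nat_mul_two_pi]
    ring

/-- If `f₀, f₁, f₂` are equally spaced on an arc of the circle and the `fₖ - uₖ` lie on the circle
then `u₁` is small as soon as the `uₖ` are close to each other. -/
theorem norm_sq_le_of_three_points {f₀ f₁ f₂ u₀ u₁ u₂ : ℂ} {γ η : ℝ} (hf₀ : ‖f₀‖ = 1)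
    (hf₁ : ‖f₁‖ = 1) (hf₂ : ‖f₂‖ = 1) (hsum : f₀ + f₂ = (2 * Real.cos γ) • f₁)
    (h₀ : ‖f₀ - u₀‖ = 1) (h₁ : ‖f₁ - u₁‖ = 1) (h₂ : ‖f₂ - u₂‖ = 1) (h₀₁ : ‖u₀ - u₁‖ ≤ η)
    (h₂₁ : ‖u₂ - u₁‖ ≤ η) : (1 - Real.cos γ) * ‖u₁‖ ^ 2 ≤ 6 * η := by
  -- Expanding the square: a translation by `-u` keeps `f` on the circle only if `2⟨f, u⟩ = |u|²`.
  have key : ∀ f u : ℂ, ‖f‖ = 1 → ‖f - u‖ = 1 → 2 * inner ℝ f u = ‖u‖ ^ 2 := by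
    intro f u hf hu
    have := norm_sub_sq_real f u
    rw [hf, hu] at this
    linarith
  have hle2 : ∀ f u : ℂ, ‖f‖ = 1 → ‖f - u‖ = 1 → ‖u‖ ≤ 2 := by
    intro f u hf hu
    have := norm_sub_le f (f - u)
    rw [sub_sub_cancel, hf, hu] at this
    linarith
  have hη : 0 ≤ η := (norm_nonneg _).trans h₀₁
  have hu₁ := hle2 f₁ u₁ hf₁ h₁
  -- Replacing `u` by `u₁` costs `2η` in the inner product and `4η` in the square, as both norms are
  -- at most `2`.
  have diff : ∀ f u : ℂ, ‖f‖ = 1 → ‖f - u‖ = 1 → ‖u - u₁‖ ≤ η →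
      ‖u₁‖ ^ 2 - 2 * inner ℝ f u₁ ≤ 6 * η := by
    intro f u hf hu hd
    have h1 := key f u hf hu
    have h2 := hle2 f u hf hu
    have h3 := real_inner_le_norm f (u - u₁)
    rw [hf, one_mul, inner_sub_right] at h3
    have h4 : ‖u₁‖ ≤ ‖u‖ + η := by
      have := norm_sub_norm_le u₁ u
      rw [norm_sub_rev] at hd
      linarith
    nlinarith [norm_nonneg u, norm_nonneg u₁]
  have d0 := diff f₀ u₀ hf₀ h₀ h₀₁
  have d2 := diff f₂ u₂ hf₂ h₂ h₂₁
  have k1 := key f₁ u₁ hf₁ h₁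
  -- The two outer points together force `2⟨f₀ + f₂, u₁⟩` to be nearly `2|u₁|²`, while by the middle
  -- point it equals `2 cos γ |u₁|²`; so `(1 - cos γ)|u₁|²` is small.
  have hs : inner ℝ f₀ u₁ + inner ℝ f₂ u₁ = 2 * Real.cos γ * inner ℝ f₁ u₁ := by
    rw [← inner_add_left, hsum, real_inner_smul_left]
  rw [mul_right_comm, k1] at hs
  linarith

/-- At `2πk/n` the sine vanishes; a quarter period to either side it is `±1`. The three phases are
therefore `φ - γ`, `φ`, `φ + γ`. -/
theorem wiggle_three_points (d : ℤ) (δ : ℝ) {n : ℕ} (hn : 0 < n) (k : ℤ) :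
    (wiggle d δ n (Circle.exp (2 * Real.pi * k / n - Real.pi / (2 * n))) : ℂ) +
      wiggle d δ n (Circle.exp (2 * Real.pi * k / n + Real.pi / (2 * n))) =
    (2 * Real.cos (δ + d * Real.pi / (2 * n))) •
      (wiggle d δ n (Circle.exp (2 * Real.pi * k / n)) : ℂ) := by
  have hn' : (n : ℝ) ≠ 0 := by exact_mod_cast hn.ne'
  set γ := δ + d * Real.pi / (2 * n) with hγ
  set φ := wigglePhase d δ n (2 * Real.pi * k / n) with hφ
  have e1 : (n : ℝ) * (2 * Real.pi * k / n) = k * (2 * Real.pi) := by field_simp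
  have e2 : (n : ℝ) * (Real.pi / (2 * n)) = Real.pi / 2 := by field_simp
  have h0 : φ = d * (2 * Real.pi * k / n) := by
    rw [hφ, wigglePhase, e1, ← zero_add ((k : ℝ) * (2 * Real.pi)), Real.sin_add_int_mul_two_pi]
    simp
  have h1 : wigglePhase d δ n (2 * Real.pi * k / n - Real.pi / (2 * n)) = φ - γ := by
    have e3 : Real.sin (k * (2 * Real.pi) - Real.pi / 2) = -1 := by
      rw [sub_eq_add_neg, add_comm, Real.sin_add_int_mul_two_pi, Real.sin_neg, Real.sin_pi_div_two]
    rw [wigglePhase, mul_sub (n : ℝ), e1, e2, e3, h0, hγ]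
    field_simp
    ring
  have h2 : wigglePhase d δ n (2 * Real.pi * k / n + Real.pi / (2 * n)) = φ + γ := by
    rw [wigglePhase, mul_add (n : ℝ), e1, e2, add_comm ((k : ℝ) * _),
      Real.sin_add_int_mul_two_pi, Real.sin_pi_div_two, h0, hγ]
    field_simp
    ring
  simp only [(isPhase_wiggle d δ n).2.1, h1, h2, ← hφ]
  rw [sub_eq_add_neg, Circle.exp_add, Circle.exp_add, Circle.coe_mul, Circle.coe_mul, ← mul_add,
    Circle.coe_exp (-γ), Circle.coe_exp γ, Complex.real_smul, mul_comm]
  congr 1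
  push_cast
  rw [Complex.two_cos, add_comm]

/-- A map with values in the circle that stays, up to an additive constant, close to an
oscillating map on the scale of the oscillations, is close to it. -/
theorem wiggle_sub_norm_sq_le {d : ℤ} {δ : ℝ} {n : ℕ} (hn : 0 < n) {G : Circle → ℂ}
    (hG : ∀ z, ‖G z‖ = 1) {θ η : ℝ}
    (h : ∀ t, |t - θ| ≤ 2 * Real.pi / n →
      ‖((wiggle d δ n (Circle.exp t) : ℂ) - G (Circle.exp t)) -
        ((wiggle d δ n (Circle.exp θ) : ℂ) - G (Circle.exp θ))‖ ≤ η) :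
    (1 - Real.cos (δ + d * Real.pi / (2 * n))) *
      ‖(wiggle d δ n (Circle.exp θ) : ℂ) - G (Circle.exp θ)‖ ^ 2 ≤ 20 * η := by
  have hpi := Real.pi_pos
  have hn' : (0 : ℝ) < n := by exact_mod_cast hn
  set V : ℝ → ℂ := fun t => (wiggle d δ n (Circle.exp t) : ℂ) - G (Circle.exp t) with hV
  -- The nearest such centre `t₁` is within `π/n` of `θ`, so all three points lie in the window of
  -- radius `2π/n`.
  set k := round (θ * n / (2 * Real.pi)) with hk
  set t₁ := 2 * Real.pi * k / n with ht₁
  have hround : |t₁ - θ| ≤ Real.pi / n := by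
    have h1 := abs_sub_round (θ * n / (2 * Real.pi))
    have h2 : t₁ - θ = -(2 * Real.pi / n) * (θ * n / (2 * Real.pi) - k) := by
      rw [ht₁]; field_simp; ring
    rw [h2, abs_mul, abs_neg, abs_of_pos (by positivity)]
    calc _ ≤ 2 * Real.pi / n * (1 / 2) := by gcongr
      _ = _ := by ring
  have hd : (0 : ℝ) < Real.pi / n := by positivity
  have hd2 : Real.pi / (2 * n) = Real.pi / n / 2 := by field_simp
  have hd3 : 2 * Real.pi / n = 2 * (Real.pi / n) := by ring
  have hb := abs_le.1 hround
  have c0 : ‖V (t₁ - Real.pi / (2 * n)) - V θ‖ ≤ η :=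
    h _ (abs_le.2 ⟨by linarith, by linarith⟩)
  have c1 : ‖V t₁ - V θ‖ ≤ η := h _ (abs_le.2 ⟨by linarith, by linarith⟩)
  have c2 : ‖V (t₁ + Real.pi / (2 * n)) - V θ‖ ≤ η :=
    h _ (abs_le.2 ⟨by linarith, by linarith⟩)
  have hη : 0 ≤ η := (norm_nonneg _).trans c1
  have tri : ∀ t, ‖V t - V θ‖ ≤ η → ‖V t - V t₁‖ ≤ 2 * η := by
    intro t ht
    have := norm_sub_le (V t - V θ) (V t₁ - V θ)
    rw [sub_sub_sub_cancel_right] at this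
    linarith
  have hone : ∀ t, ‖(wiggle d δ n (Circle.exp t) : ℂ) - V t‖ = 1 := fun t => by
    simp only [hV]
    rw [sub_sub_cancel, hG]
  -- Comparing with `t₁` instead of `θ` doubles `η`, which gives `12η`; returning to `θ` costs at
  -- most `2 · 4η`, for a total of `20η`.
  have main := norm_sq_le_of_three_points (Circle.norm_coe _) (Circle.norm_coe _)
    (Circle.norm_coe _) (wiggle_three_points d δ hn k) (hone _) (hone _) (hone _) (tri _ c0)
    (tri _ c2)
  have hle2 : ∀ t, ‖V t‖ ≤ 2 := fun t => by
    have := norm_sub_le (wiggle d δ n (Circle.exp t) : ℂ) (G (Circle.exp t))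
    rw [hG, Circle.norm_coe] at this
    linarith
  have h1 : ‖V θ‖ ≤ ‖V t₁‖ + η := by
    have := norm_sub_norm_le (V θ) (V t₁)
    rw [norm_sub_rev] at c1
    linarith
  have h2 : ‖V θ‖ ^ 2 ≤ ‖V t₁‖ ^ 2 + 4 * η := by
    nlinarith [hle2 θ, hle2 t₁, norm_nonneg (V θ), norm_nonneg (V t₁)]
  have h3 := Real.neg_one_le_cos (δ + d * Real.pi / (2 * n))
  have h4 := Real.cos_le_one (δ + d * Real.pi / (2 * n))
  change (1 - Real.cos (δ + d * Real.pi / (2 * n))) * ‖V θ‖ ^ 2 ≤ 20 * η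
  nlinarith

/-! ### The supercritical case -/

/-- The bound `M` fixes a scale below which `f - g` is nearly constant, and `f` is made to oscillate
below that scale. The constant `c` is invisible to oscillations; it serves the distances taken
modulo the mean, and `c = 0` the semi-norm. -/
theorem exists_large_distance {s p : ℝ} (hs : 0 < s) (hp : 1 ≤ p) (hsp : 1 < s * p) {d₁ d₂ : ℤ}
    (hd : d₁ ≠ d₂) {M : ℝ≥0∞} (hM : M ≠ ⊤) :
    ∃ f ∈ degreeClass s p d₁, ∀ g ∈ degreeClass s p d₂, ∀ c : ℂ,
      M ≤ seminorm s p fun z => (f z : ℂ) - g z - c := by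
  obtain ⟨W, hW, hemb⟩ := exists_continuous_version hs hp hsp
  -- With `δ = 1` and `n` large, the angle `γ` lies between `1/2` and `3/2`, so `1 - cos γ ≥ κ`. An
  -- oscillation at most `κ/10` then gives `κ|f - g|² ≤ 2κ`, hence `|f - g| < 2`.
  set κ : ℝ := 1 - Real.cos (1 / 2) with hκ
  have hpi := Real.pi_gt_three
  have hκ0 : 0 < κ := by
    have := Real.cos_lt_cos_of_nonneg_of_le_pi (x := 0) (y := 1 / 2) le_rfl
      (by linarith) (by norm_num)
    rw [Real.cos_zero] at this
    linarith
  have hlim : Tendsto (fun k => W k * M) atTop (𝓝 0) := by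
    simpa using ENNReal.Tendsto.mul_const hW (Or.inr hM)
  obtain ⟨k, hk⟩ := (hlim.eventually (gt_mem_nhds (ENNReal.ofReal_pos.2
    (show 0 < κ / 10 by positivity)))).exists
  have hev1 : ∀ᶠ n : ℕ in atTop, 2 * Real.pi / (n : ℝ) < (1 / 4) ^ k :=
    (tendsto_const_div_atTop_nhds_zero_nat (2 * Real.pi)).eventually (gt_mem_nhds (by positivity))
  have hev2 : ∀ᶠ n : ℕ in atTop, |(d₁ : ℝ) * Real.pi / 2| / (n : ℝ) < 1 / 2 :=
    (tendsto_const_div_atTop_nhds_zero_nat _).eventually (gt_mem_nhds (by norm_num))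
  obtain ⟨n, hn1, hn2, hn0⟩ := (hev1.and (hev2.and (eventually_gt_atTop 0))).exists
  have hn' : (0 : ℝ) < n := by exact_mod_cast hn0
  refine ⟨wiggle d₁ 1 n, (isPhase_wiggle d₁ 1 n).mem_degreeClass (contDiff_wigglePhase _ _ _) hs hp,
    fun g hg c => ?_⟩
  by_contra! hlt
  set F : Circle → ℂ := fun z => (wiggle d₁ 1 n z : ℂ) with hF
  have hFs : IsSmooth F := (isPhase_wiggle d₁ 1 n).isSmooth (contDiff_wigglePhase _ _ _)
  obtain ⟨U, hUc, hU, hmod⟩ := hemb _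
    (((hFs.memSobolev hs hp).sub hp hg.1).sub_const hs hp c)
  set G : Circle → ℂ := fun z => F z - U z - c with hG
  have hGc : Continuous G := (hFs.continuous.sub hUc).sub continuous_const
  have hgG : (fun z => (g z : ℂ)) =ᵐ[arcLength] G := by
    filter_upwards [hU] with z hz
    simp only [hG, ← hz]
    ring
  have hG1 := norm_eq_one_of_ae_eq hGc hgG
  have hdegG := (hasDegree_iff_of_ae_eq hGc hgG).1 hg.2
  have hγ : Real.cos (1 + d₁ * Real.pi / (2 * n)) ≤ Real.cos (1 / 2) := by
    have h1 : (d₁ : ℝ) * Real.pi / (2 * n) = d₁ * Real.pi / 2 / n := by field_simp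
    have h2 : |(d₁ : ℝ) * Real.pi / 2 / n| < 1 / 2 := by
      rwa [abs_div, abs_of_pos hn']
    rw [h1]
    have := abs_lt.1 h2
    exact Real.cos_le_cos_of_nonneg_of_le_pi (by norm_num) (by linarith) (by linarith)
  refine hd ((isPhase_wiggle d₁ 1 n).hasContinuousDegree.eq_of_norm_sub_lt_two hdegG
    (fun z => Circle.norm_coe _) hG1 fun z => ?_)
  obtain ⟨θ, rfl⟩ := Circle.exp_surjective z
  have hosc := wiggle_sub_norm_sq_le (d := d₁) (δ := 1) hn0 hG1 (θ := θ) (η := κ / 10)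
    fun t ht => by
      have h1 := (hmod k t θ (ht.trans hn1.le)).trans
        ((mul_le_mul_right hlt.le _).trans hk.le)
      rw [← ofReal_norm, ENNReal.ofReal_le_ofReal_iff (by positivity)] at h1
      have h2 : ∀ z, F z - G z = U z + c := fun z => by simp only [hG]; ring
      change ‖(F (Circle.exp t) - G (Circle.exp t)) - (F (Circle.exp θ) - G (Circle.exp θ))‖ ≤ _
      rw [h2, h2, add_sub_add_right_eq_sub]
      exact h1
  change ‖F (Circle.exp θ) - G (Circle.exp θ)‖ < 2
  change (1 - Real.cos (1 + d₁ * Real.pi / (2 * n))) *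
    ‖F (Circle.exp θ) - G (Circle.exp θ)‖ ^ 2 ≤ _ at hosc
  have h3 : κ * ‖F (Circle.exp θ) - G (Circle.exp θ)‖ ^ 2 ≤ κ * 2 := by
    refine le_trans ?_ (hosc.trans (by linarith))
    gcongr
    linarith
  have h4 := le_of_mul_le_mul_left h3 hκ0
  nlinarith [norm_nonneg (F (Circle.exp θ) - G (Circle.exp θ))]

theorem dist_seminorm_eq_top {s p : ℝ} (hs : 0 < s) (hp : 1 ≤ p) (hsp : 1 < s * p) {d₁ d₂ : ℤ}
    (hd : d₁ ≠ d₂) : Dist (seminorm s p) s p d₁ d₂ = ⊤ := by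
  refine ENNReal.eq_top_of_forall_nnreal_le fun M => ?_
  obtain ⟨f, hf, h⟩ := exists_large_distance hs hp hsp hd (M := M) ENNReal.coe_ne_top
  refine le_iSup₂_of_le f hf (le_iInf₂ fun g hg => ?_)
  simpa using h g hg 0

theorem seminorm_le_fullNorm (s p : ℝ) (h : Circle → ℂ) : seminorm s p h ≤ fullNorm s p h :=
  le_add_self

theorem dist_moduloMean_eq_top {s p : ℝ} (hs : 0 < s) (hp : 1 ≤ p) (hsp : 1 < s * p) {d₁ d₂ : ℤ}
    (hd : d₁ ≠ d₂) {N : (Circle → ℂ) → ℝ≥0∞} (hN : IsComparableToNorm s p N) :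
    Dist (moduloMean N) s p d₁ d₂ = ⊤ := by
  obtain ⟨c, C, hc, hcC⟩ := hN
  have hc' : (c : ℝ≥0∞) ≠ 0 := by exact_mod_cast hc.ne'
  refine ENNReal.eq_top_of_forall_nnreal_le fun M => ?_
  obtain ⟨f, hf, h⟩ := exists_large_distance hs hp hsp hd (M := M / c) (by finiteness)
  refine le_iSup₂_of_le f hf (le_iInf₂ fun g hg => ?_)
  set u : Circle → ℂ := fun z => (f z : ℂ) - g z with hu
  have hmem : MemSobolev s p u := hf.1.sub hp hg.1
  rw [moduloMean]
  calc (M : ℝ≥0∞) = c * (M / c) := (ENNReal.mul_div_cancel hc' ENNReal.coe_ne_top).symm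
    _ ≤ c * seminorm s p fun z => u z - ⨍ w, u w ∂arcLength := by
        gcongr
        exact h g hg _
    _ ≤ c * fullNorm s p fun z => u z - ⨍ w, u w ∂arcLength := by
        gcongr
        exact seminorm_le_fullNorm _ _ _
    _ ≤ _ := (hcC _ (hmem.sub_const hs hp _)).1

/-! ### Möbius transformations of the circle -/

/-- The Möbius transformation `z ↦ (a - z) / (1 - a z)` of the circle. -/
noncomputable def moebius (a : ℝ) (z : Circle) : Circle :=
  -z * Circle.exp (-2 * Complex.arg (1 - a * z))

/-- A phase of the Möbius transformation. -/
noncomputable def moebiusPhase (a θ : ℝ) : ℝ :=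
  θ + Real.pi - 2 * Complex.arg (1 - a * Circle.exp θ)

/-- The Poisson kernel of the disc at the point `a`. -/
noncomputable def poisson (a : ℝ) (z : Circle) : ℝ := (1 - a ^ 2) / ‖(1 - a * z : ℂ)‖ ^ 2

theorem one_sub_mul_mem_slitPlane {a : ℝ} (ha0 : 0 ≤ a) (ha1 : a < 1) (z : Circle) :
    (1 - a * z : ℂ) ∈ Complex.slitPlane := by
  have := Complex.mem_slitPlane_of_norm_lt_one (z := -(a * z : ℂ)) (by
    rw [norm_neg, norm_mul, Circle.norm_coe, mul_one, Complex.norm_real, Real.norm_eq_abs,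
      abs_of_nonneg ha0]
    exact ha1)
  rwa [← sub_eq_add_neg] at this

theorem one_sub_mul_ne_zero {a : ℝ} (ha0 : 0 ≤ a) (ha1 : a < 1) (z : Circle) :
    (1 - a * z : ℂ) ≠ 0 :=
  Complex.slitPlane_ne_zero (one_sub_mul_mem_slitPlane ha0 ha1 z)

theorem poisson_pos {a : ℝ} (ha0 : 0 ≤ a) (ha1 : a < 1) (z : Circle) : 0 < poisson a z := by
  have h1 : 0 < ‖(1 - a * z : ℂ)‖ := norm_pos_iff.2 (one_sub_mul_ne_zero ha0 ha1 z)
  have h2 : 0 < 1 - a ^ 2 := by nlinarith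
  exact div_pos h2 (by positivity)

theorem continuous_poisson {a : ℝ} (ha0 : 0 ≤ a) (ha1 : a < 1) : Continuous (poisson a) := by
  refine continuous_const.div ?_ fun z => ?_
  · exact ((continuous_const.sub (continuous_const.mul continuous_subtype_val)).norm).pow 2
  · exact pow_ne_zero _ (norm_ne_zero_iff.2 (one_sub_mul_ne_zero ha0 ha1 z))

/-- With `w = 1 - a z` one has `w̄ / w = exp(-2i arg w)`, and `-z w̄ = a - z` on the circle. The
definition through `arg` provides circle values and a global phase at once. -/
theorem coe_moebius {a : ℝ} (ha0 : 0 ≤ a) (ha1 : a < 1) (z : Circle) :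
    (moebius a z : ℂ) = (a - z) / (1 - a * z) := by
  set w : ℂ := 1 - a * z with hw
  have hw0 : w ≠ 0 := one_sub_mul_ne_zero ha0 ha1 z
  have h1 : Complex.exp ((-2 * Complex.arg w : ℝ) * Complex.I) * w = starRingEnd ℂ w := by
    have h2 := Complex.norm_mul_exp_arg_mul_I w
    have h3 : starRingEnd ℂ w = ‖w‖ * Complex.exp (-(Complex.arg w * Complex.I)) := by
      conv_lhs => rw [← h2]
      rw [map_mul, Complex.conj_ofReal, ← Complex.exp_conj]
      simp
    rw [h3]
    nth_rewrite 2 [← h2]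
    rw [mul_left_comm, ← Complex.exp_add]
    congr 2
    push_cast
    ring
  have h4 : (z : ℂ) * starRingEnd ℂ (z : ℂ) = 1 := by
    rw [Complex.mul_conj, Circle.normSq_coe, Complex.ofReal_one]
  rw [eq_div_iff hw0, moebius, Circle.coe_mul, Circle.coe_neg, Circle.coe_exp, ← hw,
    mul_assoc, h1, hw]
  simp only [map_sub, map_one, map_mul, Complex.conj_ofReal]
  linear_combination (a : ℂ) * h4

theorem contDiff_moebiusPhase {a : ℝ} (ha0 : 0 ≤ a) (ha1 : a < 1) :
    ContDiff ℝ ∞ (moebiusPhase a) := by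
  unfold moebiusPhase
  refine (contDiff_id.add contDiff_const).sub (contDiff_const.mul ?_)
  have h1 : ContDiff ℝ ∞ fun θ : ℝ => (1 - a * Circle.exp θ : ℂ) := by
    simp_rw [Circle.coe_exp]
    exact contDiff_const.sub (contDiff_const.mul
      (Complex.contDiff_exp.comp (Complex.ofRealCLM.contDiff.mul contDiff_const)))
  have h2 : ContDiff ℝ ∞ fun θ : ℝ => Complex.log (1 - a * Circle.exp θ) := by
    refine contDiff_iff_contDiffAt.2 fun θ => ?_
    exact ((Complex.contDiffAt_log (n := ∞)
      (one_sub_mul_mem_slitPlane ha0 ha1 _)).restrict_scalars ℝ).comp θ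
      h1.contDiffAt
  simp_rw [← Complex.log_im]
  exact Complex.imCLM.contDiff.comp h2

theorem isPhase_moebius {a : ℝ} (ha0 : 0 ≤ a) (ha1 : a < 1) :
    IsPhase (moebius a) (moebiusPhase a) 1 := by
  refine ⟨(contDiff_moebiusPhase ha0 ha1).continuous, fun θ => ?_, fun θ => ?_⟩
  · have e : moebiusPhase a θ = θ + Real.pi + -2 * Complex.arg (1 - a * Circle.exp θ) := by
      rw [moebiusPhase]; ring
    rw [moebius, e, Circle.exp_add, Circle.exp_add]
    congr 1
    ext
    rw [Circle.coe_mul, Circle.coe_neg, Circle.coe_exp Real.pi, Complex.exp_pi_mul_I]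
    ring
  · rw [moebiusPhase, moebiusPhase, Circle.exp_add_two_pi]
    push_cast
    ring

theorem hasDerivAt_moebiusPhase {a : ℝ} (ha0 : 0 ≤ a) (ha1 : a < 1) (θ : ℝ) :
    HasDerivAt (moebiusPhase a) (poisson a (Circle.exp θ)) θ := by
  have h1 : HasDerivAt (fun θ : ℝ => (1 - a * Circle.exp θ : ℂ))
      (-(a * (Circle.exp θ * Complex.I))) θ := by
    simp_rw [Circle.coe_exp]
    have h2 : HasDerivAt (fun θ : ℝ => (θ : ℂ) * Complex.I) Complex.I θ := by
      simpa using (Complex.ofRealCLM.hasDerivAt (x := θ)).mul_const Complex.I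
    exact (h2.cexp.const_mul (a : ℂ)).const_sub 1
  have h2 := h1.clog_real (one_sub_mul_mem_slitPlane ha0 ha1 _)
  have h3 := Complex.imCLM.hasFDerivAt.comp_hasDerivAt θ h2
  have h4 := ((hasDerivAt_id θ).add_const Real.pi).sub (h3.const_mul 2)
  have hw := one_sub_mul_ne_zero ha0 ha1 (Circle.exp θ)
  have e : poisson a (Circle.exp θ) = 1 - 2 * Complex.imCLM
      (-(a * (Circle.exp θ * Complex.I)) / (1 - a * Circle.exp θ)) := by
    have hn : (0 : ℝ) < Complex.normSq (1 - a * Circle.exp θ) := Complex.normSq_pos.2 hw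
    have hz : Complex.normSq (Circle.exp θ : ℂ) = 1 := Circle.normSq_coe _
    rw [poisson, ← Complex.normSq_eq_norm_sq, Complex.imCLM_apply, Complex.div_im]
    generalize (Circle.exp θ : ℂ) = w at hn hz ⊢
    rw [eq_comm]
    field_simp
    rw [Complex.normSq_apply] at hz ⊢
    simp
    linear_combination (-a ^ 2) * hz
  have hfun : moebiusPhase a = (fun x => id x + Real.pi) - fun y =>
      2 * (Complex.imCLM ∘ fun t : ℝ => Complex.log (1 - a * Circle.exp t)) y := by
    funext t
    simp [moebiusPhase, Complex.log_im]
  rw [e, hfun]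
  exact h4

/-- The Poisson kernel is the derivative of a phase of degree `1`, so its mass is the growth of that
phase over one turn. -/
theorem lintegral_poisson {a : ℝ} (ha0 : 0 ≤ a) (ha1 : a < 1) :
    ∫⁻ z, ENNReal.ofReal (poisson a z) ∂arcLength = ENNReal.ofReal (2 * Real.pi) := by
  have hc := continuous_poisson ha0 ha1
  have hint : Integrable (poisson a) arcLength := by
    obtain ⟨C, hC⟩ := isCompact_univ.exists_bound_of_continuousOn hc.continuousOn
    exact Integrable.of_bound hc.aestronglyMeasurable C (Eventually.of_forall fun z => hC z trivial)
  rw [← ofReal_integral_eq_lintegral_ofReal hint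
    (Eventually.of_forall fun z => (poisson_pos ha0 ha1 z).le), integral_arcLength' _ 0,
    intervalIntegral.integral_eq_sub_of_hasDerivAt
      (fun t _ => hasDerivAt_moebiusPhase ha0 ha1 t)
      ((hc.comp Circle.exp.continuous).intervalIntegrable _ _), (isPhase_moebius ha0 ha1).2.2]
  congr 1
  push_cast
  ring

/-- The difference factors exactly, with modulus the geometric mean of the two Poisson values times
`|x - y|`; the maximum bounds it. -/
theorem norm_moebius_sub_le {a : ℝ} (ha0 : 0 ≤ a) (ha1 : a < 1) (x y : Circle) :
    ‖(moebius a x : ℂ) - moebius a y‖ ≤ max (poisson a x) (poisson a y) * dist x y := by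
  have hx := one_sub_mul_ne_zero ha0 ha1 x
  have hy := one_sub_mul_ne_zero ha0 ha1 y
  have hx' : 0 < ‖(1 - a * x : ℂ)‖ := norm_pos_iff.2 hx
  have hy' : 0 < ‖(1 - a * y : ℂ)‖ := norm_pos_iff.2 hy
  have h2 : 0 < 1 - a ^ 2 := by nlinarith
  have e : (moebius a x : ℂ) - moebius a y =
      ((-(1 - a ^ 2) : ℝ) : ℂ) * (x - y) / ((1 - a * x) * (1 - a * y)) := by
    rw [coe_moebius ha0 ha1, coe_moebius ha0 ha1]
    push_cast
    field_simp
    ring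
  rw [e, norm_div, norm_mul, norm_mul, Complex.norm_real, norm_neg, Real.norm_eq_abs,
    abs_of_pos h2, ← dist_circle_eq, mul_comm _ (dist x y), mul_div_assoc, mul_comm]
  gcongr
  rcases le_total ‖(1 - a * x : ℂ)‖ ‖(1 - a * y : ℂ)‖ with h | h
  · refine le_max_of_le_left ?_
    rw [poisson, sq ‖(1 - a * x : ℂ)‖]
    gcongr
  · refine le_max_of_le_right ?_
    rw [poisson, sq ‖(1 - a * y : ℂ)‖]
    gcongr

theorem norm_pow_sub_pow_le {u v : ℂ} (hu : ‖u‖ = 1) (hv : ‖v‖ = 1) (n : ℕ) :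
    ‖u ^ n - v ^ n‖ ≤ n * ‖u - v‖ := by
  induction n with
  | zero => simp
  | succ n ih =>
    have : u ^ (n + 1) - v ^ (n + 1) = u ^ n * (u - v) + (u ^ n - v ^ n) * v := by ring
    rw [this]
    refine (norm_add_le _ _).trans ?_
    rw [norm_mul, norm_mul, norm_pow, hu, hv, one_pow, one_mul, mul_one]
    push_cast
    linarith

theorem norm_zpow_sub_zpow_le (x y : Circle) (D : ℤ) :
    ‖((x ^ D : Circle) : ℂ) - (y ^ D : Circle)‖ ≤ |(D : ℝ)| * ‖(x : ℂ) - y‖ := by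
  obtain ⟨n, rfl | rfl⟩ := D.eq_nat_or_neg
  · simpa using norm_pow_sub_pow_le (Circle.norm_coe x) (Circle.norm_coe y) n
  · have h := norm_pow_sub_pow_le (Circle.norm_coe x⁻¹) (Circle.norm_coe y⁻¹) n
    rw [Circle.coe_inv_eq_conj, Circle.coe_inv_eq_conj, ← map_sub, Complex.norm_conj] at h
    simp only [zpow_neg, zpow_natCast, Int.cast_neg, Int.cast_natCast, abs_neg, Nat.abs_cast]
    rw [← inv_pow, ← inv_pow, Circle.coe_pow, Circle.coe_pow, Circle.coe_inv_eq_conj,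
      Circle.coe_inv_eq_conj]
    exact h

/-! ### Maps of prescribed degree concentrating at a point -/

/-- Maps of degree `D`, converging to `1` away from a point. -/
noncomputable def bubble (D : ℤ) (j : ℕ) (z : Circle) : Circle :=
  moebius (1 - 1 / (j + 2 : ℝ)) z ^ D

/-- A phase of `bubble D j`. -/
noncomputable def bubblePhase (D : ℤ) (j : ℕ) (θ : ℝ) : ℝ :=
  D * moebiusPhase (1 - 1 / (j + 2 : ℝ)) θ

theorem bubble_param_nonneg (j : ℕ) : (0 : ℝ) ≤ 1 - 1 / (j + 2 : ℝ) := by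
  rw [sub_nonneg, div_le_one (by positivity)]
  have : (0 : ℝ) ≤ j := Nat.cast_nonneg j
  linarith

theorem bubble_param_lt_one (j : ℕ) : 1 - 1 / (j + 2 : ℝ) < 1 := by
  have : (0 : ℝ) < 1 / (j + 2 : ℝ) := by positivity
  linarith

theorem contDiff_bubblePhase (D : ℤ) (j : ℕ) : ContDiff ℝ ∞ (bubblePhase D j) :=
  contDiff_const.mul (contDiff_moebiusPhase (bubble_param_nonneg j) (bubble_param_lt_one j))

theorem isPhase_bubble (D : ℤ) (j : ℕ) : IsPhase (bubble D j) (bubblePhase D j) D := by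
  have h := isPhase_moebius (bubble_param_nonneg j) (bubble_param_lt_one j)
  refine ⟨(contDiff_bubblePhase D j).continuous, fun θ => ?_, fun θ => ?_⟩
  · rw [bubble, bubblePhase, h.2.1, Circle.exp_intCast_mul]
  · rw [bubblePhase, bubblePhase, h.2.2]
    push_cast
    ring

theorem isSmooth_bubble (D : ℤ) (j : ℕ) : IsSmooth fun z => (bubble D j z : ℂ) :=
  (isPhase_bubble D j).isSmooth (contDiff_bubblePhase D j)

theorem tendsto_bubble (D : ℤ) {z : Circle} (hz : z ≠ 1) :
    Tendsto (fun j => (bubble D j z : ℂ)) atTop (𝓝 1) := by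
  have hz' : (1 - z : ℂ) ≠ 0 := by
    rw [sub_ne_zero]
    intro h
    exact hz (Circle.ext (by rw [← h, Circle.coe_one]))
  have h1 : Tendsto (fun j : ℕ => 1 - 1 / (j + 2 : ℝ)) atTop (𝓝 1) := by
    have := (tendsto_const_div_atTop_nhds_zero_nat (1 : ℝ)).comp (tendsto_add_atTop_nat 2)
    simpa [Function.comp_def] using this.const_sub 1
  have h2 : Tendsto (fun j : ℕ => ((1 - 1 / (j + 2 : ℝ) : ℝ) : ℂ)) atTop (𝓝 1) := by
    simpa [Function.comp_def] using (Complex.continuous_ofReal.tendsto 1).comp h1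
  have h3 : Tendsto (fun j : ℕ => (moebius (1 - 1 / (j + 2 : ℝ)) z : ℂ)) atTop (𝓝 1) := by
    have := (h2.sub_const (z : ℂ)).div ((h2.mul_const (z : ℂ)).const_sub 1) (by simpa using hz')
    rw [one_mul, div_self hz'] at this
    refine this.congr fun j => ?_
    rw [coe_moebius (bubble_param_nonneg j) (bubble_param_lt_one j)]
    rfl
  have h4 := h3.zpow₀ D (Or.inl one_ne_zero)
  rw [one_zpow] at h4
  refine h4.congr fun j => ?_
  rw [bubble, Circle.coe_zpow]

theorem IsPhase.circleDeriv_eq {h : Circle → Circle} {φ : ℝ → ℝ} {d : ℤ} (hφ : IsPhase h φ d)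
    {θ φ' : ℝ} (hd : HasDerivAt φ φ' θ) :
    circleDeriv (fun z => (h z : ℂ)) (Circle.exp θ) = φ' * Complex.I * h (Circle.exp θ) := by
  rw [circleDeriv_exp]
  simp_rw [hφ.2.1, Circle.coe_exp]
  have h1 : HasDerivAt (fun t : ℝ => (φ t : ℂ) * Complex.I) (φ' * Complex.I) θ :=
    hd.ofReal_comp.mul_const Complex.I
  rw [h1.cexp.deriv, mul_comm]

theorem enorm_circleDeriv_bubble (D : ℤ) (j : ℕ) (z : Circle) :
    ‖circleDeriv (fun z => (bubble D j z : ℂ)) z‖ₑ =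
      ENNReal.ofReal |(D : ℝ)| * ENNReal.ofReal (poisson (1 - 1 / (j + 2 : ℝ)) z) := by
  obtain ⟨θ, rfl⟩ := Circle.exp_surjective z
  have h := (hasDerivAt_moebiusPhase (bubble_param_nonneg j) (bubble_param_lt_one j) θ).const_mul
    (D : ℝ)
  have hp := poisson_pos (bubble_param_nonneg j) (bubble_param_lt_one j) (Circle.exp θ)
  rw [(isPhase_bubble D j).circleDeriv_eq h, ← ofReal_norm, norm_mul, norm_mul, Circle.norm_coe,
    Complex.norm_I, mul_one, mul_one, Complex.norm_real, norm_mul, Real.norm_eq_abs,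
    Real.norm_eq_abs, abs_of_pos hp, ENNReal.ofReal_mul (abs_nonneg _)]

theorem lintegral_enorm_circleDeriv_bubble (D : ℤ) (j : ℕ) :
    ∫⁻ z, ‖circleDeriv (fun z => (bubble D j z : ℂ)) z‖ₑ ∂arcLength =
      ENNReal.ofReal (2 * Real.pi * |(D : ℝ)|) := by
  simp_rw [enorm_circleDeriv_bubble]
  rw [lintegral_const_mul' _ _ ENNReal.ofReal_ne_top,
    lintegral_poisson (bubble_param_nonneg j) (bubble_param_lt_one j),
    ← ENNReal.ofReal_mul (abs_nonneg _), mul_comm]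

/-- Each term of the maximum involves the Poisson kernel at one point only, so the energy splits
into two integrals exchanged by symmetry. -/
theorem norm_bubble_sub_le (D : ℤ) (j : ℕ) (x y : Circle) :
    ‖(bubble D j x : ℂ) - bubble D j y‖ ≤
      max (min 2 (|(D : ℝ)| * poisson (1 - 1 / (j + 2 : ℝ)) x * dist x y))
        (min 2 (|(D : ℝ)| * poisson (1 - 1 / (j + 2 : ℝ)) y * dist x y)) := by
  have h1 := norm_zpow_sub_zpow_le (moebius (1 - 1 / (j + 2 : ℝ)) x)
    (moebius (1 - 1 / (j + 2 : ℝ)) y) D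
  have h2 := norm_moebius_sub_le (bubble_param_nonneg j) (bubble_param_lt_one j) x y
  have h3 : ‖(bubble D j x : ℂ) - bubble D j y‖ ≤ 2 := by
    rw [← dist_circle_eq]; exact dist_circle_le_two _ _
  rw [← min_max_distrib_left]
  refine le_min h3 (h1.trans ?_)
  calc _ ≤ |(D : ℝ)| * (max (poisson (1 - 1 / (j + 2 : ℝ)) x)
        (poisson (1 - 1 / (j + 2 : ℝ)) y) * dist x y) := by gcongr
    _ = _ := by
      rw [← mul_assoc, mul_max_of_nonneg _ _ (abs_nonneg _),
        max_mul_of_nonneg _ _ dist_nonneg]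

/-- Criticality enters through `σ p = 1`: the inner integral is then linear in `|D| P(x)`, and `P`
has mass `2π` however concentrated it is. Hence the uniformity in `j`. -/
theorem exists_gagliardoEnergy_bubble_le {p : ℝ} (hp : 1 < p) :
    ∃ C : ℝ, 0 < C ∧ ∀ (D : ℤ) (j : ℕ), D ≠ 0 →
      gagliardoEnergy (1 / p) p (fun z => (bubble D j z : ℂ)) ≤ ENNReal.ofReal (C * |(D : ℝ)|) := by
  have hp0 : 0 < p := by linarith
  have hpi := Real.pi_pos
  have hpp : 1 / p * p = 1 := by field_simp
  obtain ⟨C, hC, hk⟩ := exists_lintegral_min_le (σ := 1 / p) (by positivity)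
    (by rw [div_lt_one hp0]; exact hp) hp.le
  refine ⟨4 * Real.pi * C, by positivity, fun D j hD => ?_⟩
  set P := poisson (1 - 1 / (j + 2 : ℝ)) with hP
  have hPc : Continuous P := continuous_poisson (bubble_param_nonneg j) (bubble_param_lt_one j)
  have hPp : ∀ z, 0 < P z := poisson_pos (bubble_param_nonneg j) (bubble_param_lt_one j)
  have hD' : 0 < |(D : ℝ)| := abs_pos.2 (by exact_mod_cast hD)
  set K : Circle → Circle → ℝ≥0∞ := fun x y => ENNReal.ofReal
    (min 2 (|(D : ℝ)| * P x * dist x y) ^ p / dist x y ^ (1 + 1 / p * p)) with hK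
  have hKm : Measurable (Function.uncurry K) := by
    refine ENNReal.measurable_ofReal.comp (Measurable.div ?_ (measurable_dist.pow_const _))
    refine (Measurable.min measurable_const ?_).pow_const p
    exact (measurable_const.mul (hPc.measurable.comp measurable_fst)).mul measurable_dist
  have hle : ∀ x y, gagliardoKernel (1 / p) p (fun z => (bubble D j z : ℂ)) x y ≤
      K x y + K y x := by
    intro x y
    have h1 := norm_bubble_sub_le D j x y
    rw [gagliardoKernel]
    rcases le_max_iff.1 h1 with h | h
    · refine le_add_right (ENNReal.ofReal_le_ofReal ?_)
      gcongr
    · refine le_add_left (ENNReal.ofReal_le_ofReal ?_)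
      rw [dist_comm y x]
      gcongr
  have hKint : ∫⁻ x, ∫⁻ y, K x y ∂arcLength ∂arcLength ≤
      ENNReal.ofReal (C * |(D : ℝ)|) * ENNReal.ofReal (2 * Real.pi) := by
    calc _ ≤ ∫⁻ x, ENNReal.ofReal (C * |(D : ℝ)|) * ENNReal.ofReal (P x) ∂arcLength := by
          refine lintegral_mono fun x => (hk (|(D : ℝ)| * P x) (mul_pos hD' (hPp x)) x).trans ?_
          rw [hpp, Real.rpow_one, ← mul_assoc, ENNReal.ofReal_mul (by positivity)]
      _ = _ := by
          rw [lintegral_const_mul' _ _ ENNReal.ofReal_ne_top,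
            lintegral_poisson (bubble_param_nonneg j) (bubble_param_lt_one j)]
  calc _ ≤ ∫⁻ x, ∫⁻ y, (K x y + K y x) ∂arcLength ∂arcLength :=
        lintegral_mono fun x => lintegral_mono fun y => hle x y
    _ = (∫⁻ x, ∫⁻ y, K x y ∂arcLength ∂arcLength) + ∫⁻ x, ∫⁻ y, K y x ∂arcLength ∂arcLength := by
        rw [← lintegral_add_left (show Measurable fun x => ∫⁻ y, K x y ∂arcLength from
          hKm.lintegral_prod_right')]
        refine lintegral_congr fun x => lintegral_add_left (hKm.comp measurable_prodMk_left) _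
    _ = 2 * ∫⁻ x, ∫⁻ y, K x y ∂arcLength ∂arcLength := by
        rw [lintegral_lintegral_swap (f := fun x y => K y x)
          (hKm.comp measurable_swap).aemeasurable, two_mul]
    _ ≤ 2 * (ENNReal.ofReal (C * |(D : ℝ)|) * ENNReal.ofReal (2 * Real.pi)) := by gcongr
    _ = _ := by
        rw [← ENNReal.ofReal_mul (by positivity), show (2 : ℝ≥0∞) = ENNReal.ofReal 2 by simp,
          ← ENNReal.ofReal_mul two_pos.le]
        congr 1
        ring

/-! ### The critical case -/

theorem nearEnergy_mono {σ p R R' : ℝ} (h : R ≤ R') (f : Circle → ℂ) :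
    nearEnergy σ p R f ≤ nearEnergy σ p R' f :=
  lintegral_mono fun _ => lintegral_mono fun y =>
    Set.indicator_le_indicator_of_subset (fun _ hy => le_trans hy h) (fun _ => zero_le) y

/-- Dominated convergence: the strips shrink to the diagonal, where the kernel is zero since its
numerator is. -/
theorem tendsto_nearEnergy {σ p : ℝ} (hp : 0 < p) {f : Circle → ℂ}
    (hf : AEStronglyMeasurable f arcLength) (hfin : gagliardoEnergy σ p f ≠ ⊤) :
    Tendsto (fun n : ℕ => nearEnergy σ p (1 / (n + 1 : ℝ)) f) atTop (𝓝 0) := by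
  have hk := aemeasurable_gagliardoKernel (σ := σ) (p := p) hf
  have hms : ∀ R : ℝ, MeasurableSet {z : Circle × Circle | dist z.1 z.2 ≤ R} := fun R =>
    measurableSet_le measurable_dist measurable_const
  have heq : ∀ R, nearEnergy σ p R f = ∫⁻ z, {z : Circle × Circle | dist z.1 z.2 ≤ R}.indicator
      (fun z => gagliardoKernel σ p f z.1 z.2) z ∂(arcLength.prod arcLength) := by
    intro R
    rw [lintegral_prod _ (hk.indicator (hms R))]
    rfl
  simp_rw [heq]
  have h0 : (0 : ℝ≥0∞) = ∫⁻ _, 0 ∂(arcLength.prod arcLength) := by simp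
  rw [h0]
  refine tendsto_lintegral_of_dominated_convergence'
    (fun z => gagliardoKernel σ p f z.1 z.2) (fun n => hk.indicator (hms _))
    (fun n => Eventually.of_forall fun z => Set.indicator_le_self _ _ z) ?_
    (Eventually.of_forall fun z => ?_)
  · rw [← gagliardoEnergy_eq_prod hf]
    exact hfin
  · rcases eq_or_ne z.1 z.2 with h | h
    · have : gagliardoKernel σ p f z.1 z.2 = 0 := by
        rw [gagliardoKernel, h]
        simp [hp.ne']
      refine tendsto_const_nhds.congr fun n => ?_
      by_cases hz : z ∈ {z : Circle × Circle | dist z.1 z.2 ≤ 1 / (n + 1 : ℝ)}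
      · rw [Set.indicator_of_mem hz, this]
      · rw [Set.indicator_of_notMem hz]
    · refine tendsto_const_nhds.congr' ?_
      have := tendsto_one_div_add_atTop_nhds_zero_nat.eventually
        (gt_mem_nhds (dist_pos.2 h))
      filter_upwards [this] with n hn
      rw [Set.indicator_of_notMem]
      exact not_le.2 hn

/-- Maps of finite critical energy have vanishing mean oscillation; in particular their arc means
stay away from zero. -/
theorem eventually_norm_arcMean_ge {p : ℝ} (hp : 1 ≤ p) {f : Circle → Circle}
    (hf : AEStronglyMeasurable (fun z => (f z : ℂ)) arcLength)
    (hfin : gagliardoEnergy (1 / p) p (fun z => (f z : ℂ)) ≠ ⊤) :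
    ∀ᶠ ε in 𝓝[>] (0 : ℝ), ∀ z, 1 / 2 ≤ ‖arcMean (fun z => (f z : ℂ)) ε z‖ := by
  have hp0 : 0 < p := by linarith
  have hpi := Real.pi_gt_three
  have hfi := integrable_circle hf
  have hlim := ((ENNReal.continuous_rpow_const (y := 1 / p)).tendsto 0).comp
    (tendsto_nearEnergy hp0 hf hfin)
  rw [ENNReal.zero_rpow_of_pos (by positivity)] at hlim
  obtain ⟨n, hn⟩ := (hlim.eventually (gt_mem_nhds
    (show (0 : ℝ≥0∞) < ENNReal.ofReal (1 / 2) by simp))).exists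
  simp only [Function.comp_apply] at hn
  filter_upwards [Ioo_mem_nhdsGT (show (0 : ℝ) < 1 / (n + 1 : ℝ) / 2 by positivity),
    Ioo_mem_nhdsGT (show (0 : ℝ) < 1 by norm_num)] with ε hε hε1 z
  obtain ⟨θ, rfl⟩ := Circle.exp_surjective z
  have hε0 : 0 < ε := hε.1
  set l := 2 * ε with hl
  have hl0 : 0 < l := by positivity
  set a := θ - ε with ha
  have hal : θ + ε = a + l := by rw [ha, hl]; ring
  set m := arcMean (fun z => (f z : ℂ)) ε (Circle.exp θ) with hm
  have hm' : m = l⁻¹ • ∫ t in a..(a + l), (f (Circle.exp t) : ℂ) := by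
    rw [hm, arcMean_exp, hal]
  have hosc := lintegral_lintegral_enorm_sub_le (σ := 1 / p) (R := l) (a := a) (b := a) hp
    (by positivity) hf (measurableSet_Ioc (a := a) (b := a + l))
    (measurableSet_Ioc (a := a) (b := a + l)) (fun t ht => ⟨ht.1, by linarith [ht.2, hε1.2]⟩)
    (fun t ht => ⟨ht.1, by linarith [ht.2, hε1.2]⟩)
    (fun s hs t ht => (dist_exp_exp_le s t).trans
      (abs_le.2 ⟨by linarith [hs.1, ht.2], by linarith [ht.1, hs.2]⟩))
  have hE : nearEnergy (1 / p) p l (fun z => (f z : ℂ)) ^ (1 / p) ≤ ENNReal.ofReal (1 / 2) := by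
    refine le_trans ?_ hn.le
    gcongr
    exact nearEnergy_mono (by linarith [hε.2]) _
  set Λ := ENNReal.ofReal l with hΛ
  have hΛ0 : Λ ≠ 0 := by simp [hΛ, hl0]
  have hΛt : Λ ≠ ⊤ := ENNReal.ofReal_ne_top
  rw [Real.volume_Ioc, add_sub_cancel_left, ← hΛ] at hosc
  -- For `σ = 1/p` the powers of the arc length cancel, so the mean oscillation is bounded by the
  -- near energy alone.
  have hpow : (Λ * Λ) ^ (1 - 1 / p) * Λ ^ (1 / p + 1 / p) = Λ * Λ := by
    have h1p : 0 ≤ 1 - 1 / p := by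
      rw [sub_nonneg, div_le_one hp0]; exact hp
    rw [ENNReal.mul_rpow_of_nonneg _ _ h1p, ← ENNReal.rpow_add _ _ hΛ0 hΛt,
      ← ENNReal.rpow_add _ _ hΛ0 hΛt]
    conv_rhs => rw [← ENNReal.rpow_one Λ, ← ENNReal.rpow_add _ _ hΛ0 hΛt]
    congr 1
    ring
  rw [hpow] at hosc
  -- From `1 = |f(s)| ≤ |f(s) - m| + |m|`, to be averaged over the arc: oscillation at most `1/2`
  -- leaves `|m| ≥ 1/2`.
  have hpt : ∀ s, Λ * 1 ≤ (∫⁻ t in Set.Ioc a (a + l),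
      ‖(f (Circle.exp s) : ℂ) - f (Circle.exp t)‖ₑ) + Λ * ‖m‖ₑ := by
    intro s
    have hJ := (intervalIntegrable_iff_integrableOn_Ioc_of_le (by linarith)).1
      (intervalIntegrable_comp_exp hfi a (a + l))
    have h1 : l • ((f (Circle.exp s) : ℂ) - m) =
        ∫ t in Set.Ioc a (a + l), ((f (Circle.exp s) : ℂ) - f (Circle.exp t)) := by
      rw [integral_sub (integrable_const _) hJ, integral_const, measureReal_restrict_apply_univ,
        Real.volume_real_Ioc_of_le (by linarith), add_sub_cancel_left, smul_sub, hm', smul_smul,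
        mul_inv_cancel₀ hl0.ne', one_smul, intervalIntegral.integral_of_le (by linarith)]
    have h2 : Λ * ‖(f (Circle.exp s) : ℂ) - m‖ₑ ≤ ∫⁻ t in Set.Ioc a (a + l),
        ‖(f (Circle.exp s) : ℂ) - f (Circle.exp t)‖ₑ := by
      calc _ = ‖l • ((f (Circle.exp s) : ℂ) - m)‖ₑ := by
            rw [enorm_smul, Real.enorm_eq_ofReal hl0.le]
        _ ≤ _ := by rw [h1]; exact enorm_integral_le_lintegral_enorm _
    have h3 : (1 : ℝ≥0∞) ≤ ‖(f (Circle.exp s) : ℂ) - m‖ₑ + ‖m‖ₑ := by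
      have := enorm_add_le ((f (Circle.exp s) : ℂ) - m) m
      rw [sub_add_cancel, ← ofReal_norm (f (Circle.exp s) : ℂ), Circle.norm_coe] at this
      simpa using this
    calc Λ * 1 ≤ Λ * (‖(f (Circle.exp s) : ℂ) - m‖ₑ + ‖m‖ₑ) := by gcongr
      _ ≤ _ := by rw [mul_add]; gcongr
  have hint : Λ * Λ * 1 ≤ Λ * Λ * (ENNReal.ofReal (1 / 2) + ‖m‖ₑ) := by
    calc Λ * Λ * 1 = ∫⁻ s in Set.Ioc a (a + l), Λ * 1 := by
          rw [setLIntegral_const, Real.volume_Ioc, add_sub_cancel_left]; ring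
      _ ≤ ∫⁻ s in Set.Ioc a (a + l), ((∫⁻ t in Set.Ioc a (a + l),
          ‖(f (Circle.exp s) : ℂ) - f (Circle.exp t)‖ₑ) + Λ * ‖m‖ₑ) := lintegral_mono hpt
      _ = (∫⁻ s in Set.Ioc a (a + l), ∫⁻ t in Set.Ioc a (a + l),
          ‖(f (Circle.exp s) : ℂ) - f (Circle.exp t)‖ₑ) + Λ * Λ * ‖m‖ₑ := by
          rw [lintegral_add_right' _ aemeasurable_const, setLIntegral_const, Real.volume_Ioc,
            add_sub_cancel_left]
          ring
      _ ≤ Λ * Λ * ENNReal.ofReal (1 / 2) + Λ * Λ * ‖m‖ₑ := by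
          gcongr
          refine hosc.trans ?_
          gcongr
      _ = _ := by ring
  have hfinal := (ENNReal.mul_le_mul_iff_right (mul_ne_zero hΛ0 hΛ0) (by finiteness)).1 hint
  rw [← ofReal_norm m, ← ENNReal.ofReal_add (by norm_num) (norm_nonneg _),
    ENNReal.one_le_ofReal] at hfinal
  linarith

theorem floor_eq_zero_of_critical {p : ℝ} (hp : 1 < p) : ⌊(1 / p : ℝ)⌋₊ = 0 :=
  Nat.floor_eq_zero.2 (by rw [div_lt_one (by linarith)]; exact hp)

theorem seminorm_of_floor_eq_zero {s p : ℝ} (hs : 0 < s) (h : ⌊s⌋₊ = 0) (f : Circle → ℂ) :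
    seminorm s p f = gagliardo s p f := by
  rw [seminorm, if_neg (by rw [h]; simpa using hs.ne'), h]
  simp

theorem memSobolev_of_floor_eq_zero {s p : ℝ} (hs : 0 < s) (h : ⌊s⌋₊ = 0) {f : Circle → ℂ} :
    MemSobolev s p f ↔ MemLp f (ENNReal.ofReal p) arcLength ∧ gagliardo s p f < ⊤ := by
  constructor
  · intro hf
    exact ⟨hf.memLp 0 (Nat.zero_le _), seminorm_of_floor_eq_zero hs h f ▸ hf.seminorm_lt_top⟩
  · rintro ⟨h1, h2⟩
    refine ⟨fun k hk => by omega, fun k hk => ?_, by rwa [seminorm_of_floor_eq_zero hs h]⟩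
    rw [h, Nat.le_zero] at hk
    subst hk
    exact h1

theorem arcLength_singleton_one : ∀ᵐ z ∂arcLength, z ≠ 1 := by
  refine ae_arcLength_iff.2 ?_
  have hc : (Set.range fun n : ℤ => (n : ℝ) * (2 * Real.pi)).Countable := Set.countable_range _
  filter_upwards [hc.ae_notMem volume] with t ht h
  obtain ⟨n, hn⟩ := Circle.exp_eq_one.1 h
  exact ht ⟨n, hn.symm⟩

/-- Multiplying by a concentrating bubble changes little the energy due to the first factor. -/
theorem tendsto_lintegral_mul_bubble {σ p : ℝ} (hp : 0 < p) {f : Circle → ℂ}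
    (hf : AEStronglyMeasurable f arcLength) (hfin : gagliardoEnergy σ p f ≠ ⊤) (D : ℤ) :
    Tendsto (fun j => ∫⁻ x, ∫⁻ y, ENNReal.ofReal ((‖f x - f y‖ * ‖1 - (bubble D j y : ℂ)‖) ^ p /
      dist x y ^ (1 + σ * p)) ∂arcLength ∂arcLength) atTop (𝓝 0) := by
  have hb : ∀ j, Continuous fun z => (bubble D j z : ℂ) := fun j => (isSmooth_bubble D j).continuous
  have hk := aemeasurable_gagliardoKernel (σ := σ) (p := p) hf
  have hfac : ∀ j (x y : Circle), ENNReal.ofReal ((‖f x - f y‖ * ‖1 - (bubble D j y : ℂ)‖) ^ p /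
      dist x y ^ (1 + σ * p)) =
      ENNReal.ofReal (‖1 - (bubble D j y : ℂ)‖ ^ p) * gagliardoKernel σ p f x y := by
    intro j x y
    rw [gagliardoKernel, ← ENNReal.ofReal_mul (by positivity),
      Real.mul_rpow (norm_nonneg _) (norm_nonneg _)]
    congr 1
    ring
  simp_rw [hfac]
  have hm : ∀ j, AEMeasurable (fun z : Circle × Circle =>
      ENNReal.ofReal (‖1 - (bubble D j z.2 : ℂ)‖ ^ p) * gagliardoKernel σ p f z.1 z.2)
      (arcLength.prod arcLength) := fun j => by
    refine AEMeasurable.mul (Measurable.aemeasurable ?_) hk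
    exact ENNReal.measurable_ofReal.comp
      (((continuous_const.sub ((hb j).comp continuous_snd)).norm.measurable).pow_const p)
  have heq : ∀ j, ∫⁻ x, ∫⁻ y, ENNReal.ofReal (‖1 - (bubble D j y : ℂ)‖ ^ p) *
      gagliardoKernel σ p f x y ∂arcLength ∂arcLength = ∫⁻ z : Circle × Circle,
        ENNReal.ofReal (‖1 - (bubble D j z.2 : ℂ)‖ ^ p) * gagliardoKernel σ p f z.1 z.2
        ∂(arcLength.prod arcLength) := fun j => (lintegral_prod _ (hm j)).symm
  simp_rw [heq]
  have h0 : (0 : ℝ≥0∞) = ∫⁻ _, 0 ∂(arcLength.prod arcLength) := by simp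
  rw [h0]
  refine tendsto_lintegral_of_dominated_convergence'
    (fun z => ENNReal.ofReal (2 ^ p) * gagliardoKernel σ p f z.1 z.2) hm
    (fun j => Eventually.of_forall fun z => ?_) ?_ ?_
  · have h2 : ‖1 - (bubble D j z.2 : ℂ)‖ ≤ 2 := by
      refine (norm_sub_le _ _).trans ?_
      rw [Circle.norm_coe, norm_one]; norm_num
    exact mul_le_mul' (ENNReal.ofReal_le_ofReal (Real.rpow_le_rpow (norm_nonneg _) h2 hp.le)) le_rfl
  · rw [lintegral_const_mul' _ _ ENNReal.ofReal_ne_top, ← gagliardoEnergy_eq_prod hf]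
    finiteness
  · have hne : ∀ᵐ z ∂(arcLength.prod arcLength), z.2 ≠ 1 :=
      Measure.quasiMeasurePreserving_snd.ae arcLength_singleton_one
    have hfin' : ∀ᵐ z ∂(arcLength.prod arcLength), gagliardoKernel σ p f z.1 z.2 < ⊤ :=
      Eventually.of_forall fun z => ENNReal.ofReal_lt_top
    filter_upwards [hne, hfin'] with z hz hzt
    have h1 : Tendsto (fun j => ENNReal.ofReal (‖1 - (bubble D j z.2 : ℂ)‖ ^ p)) atTop (𝓝 0) := by
      have h2 := ((tendsto_bubble D hz).const_sub 1).norm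
      rw [sub_self, norm_zero] at h2
      have h3 := (Real.continuousAt_rpow_const 0 p (Or.inr hp.le)).tendsto.comp h2
      rw [Real.zero_rpow hp.ne'] at h3
      simpa [Function.comp_def] using ENNReal.tendsto_ofReal h3
    simpa using ENNReal.Tendsto.mul_const h1 (Or.inr hzt.ne)

theorem exists_mul_bubble_close {p : ℝ} (hp : 1 < p) :
    ∃ C : ℝ, 0 < C ∧ ∀ (d₁ d₂ : ℤ), d₁ ≠ d₂ → ∀ f ∈ degreeClass (1 / p) p d₁,
      ∃ g ∈ degreeClass (1 / p) p d₂,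
        gagliardo (1 / p) p (fun z => (f z : ℂ) - g z) ≤
          ENNReal.ofReal (C * |(d₁ : ℝ) - d₂| ^ (1 / p)) := by
  have hp0 : 0 < p := by linarith
  obtain ⟨C, hC, hbub⟩ := exists_gagliardoEnergy_bubble_le hp
  -- `2 ^ (p - 1)` comes from convexity and `1` bounds the cross term, absorbed by `|D| ≥ 1`. Only
  -- `j` depends on `f`.
  refine ⟨(2 ^ (p - 1) * (1 + C)) ^ (1 / p), by positivity, fun d₁ d₂ hd f hf => ?_⟩
  have hs : 0 < 1 / p := by positivity
  have hfloor := floor_eq_zero_of_critical hp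
  obtain ⟨hfL, hfg⟩ := (memSobolev_of_floor_eq_zero hs hfloor).1 hf.1
  have hfm := hfL.1
  rw [gagliardo_lt_top_iff hp0] at hfg
  set D : ℤ := d₂ - d₁ with hD
  have hD0 : D ≠ 0 := sub_ne_zero.2 hd.symm
  have hDabs : |(d₁ : ℝ) - d₂| = |(D : ℝ)| := by rw [abs_sub_comm, hD]; push_cast; rfl
  have hD1 : 1 ≤ |(D : ℝ)| := by exact_mod_cast Int.one_le_abs hD0
  obtain ⟨j, hj⟩ := ((tendsto_lintegral_mul_bubble hp0 hfm hfg.ne D).eventually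
    (gt_mem_nhds one_pos)).exists
  set h : Circle → Circle := bubble D j with hh
  have hhc : Continuous fun z => (h z : ℂ) := (isSmooth_bubble D j).continuous
  set g : Circle → Circle := fun z => f z * h z with hg
  have hdiff : ∀ x y, ‖((f x : ℂ) - g x) - ((f y : ℂ) - g y)‖ ≤
      ‖(f x : ℂ) - f y‖ * ‖1 - (h y : ℂ)‖ + ‖(h x : ℂ) - h y‖ := by
    intro x y
    have e : ((f x : ℂ) - g x) - ((f y : ℂ) - g y) =
        ((f x : ℂ) - f y) * (1 - h y) - f x * ((h x : ℂ) - h y) := by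
      simp only [hg, Circle.coe_mul]; ring
    rw [e]
    refine (norm_sub_le _ _).trans ?_
    rw [norm_mul, norm_mul, Circle.norm_coe, one_mul]
  have h2p : (2 : ℝ≥0∞) ^ (p - 1) = ENNReal.ofReal (2 ^ (p - 1)) := by
    rw [← ENNReal.ofReal_rpow_of_pos two_pos]; simp
  have hen : gagliardoEnergy (1 / p) p (fun z => (f z : ℂ) - g z) ≤
      ENNReal.ofReal (2 ^ (p - 1) * (1 + C) * |(D : ℝ)|) := by
    calc _ ≤ ∫⁻ x, ∫⁻ y, 2 ^ (p - 1) * (ENNReal.ofReal ((‖(f x : ℂ) - f y‖ * ‖1 - (h y : ℂ)‖) ^ p /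
          dist x y ^ (1 + 1 / p * p)) + gagliardoKernel (1 / p) p (fun z => (h z : ℂ)) x y)
          ∂arcLength ∂arcLength :=
          lintegral_mono fun x => lintegral_mono fun y =>
            gagliardoKernel_le_add hp.le (by positivity) (norm_nonneg _) (hdiff x y)
      _ = 2 ^ (p - 1) * ((∫⁻ x, ∫⁻ y, ENNReal.ofReal ((‖(f x : ℂ) - f y‖ * ‖1 - (h y : ℂ)‖) ^ p /
          dist x y ^ (1 + 1 / p * p)) ∂arcLength ∂arcLength) +
            gagliardoEnergy (1 / p) p (fun z => (h z : ℂ))) := by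
          have hne : (2 : ℝ≥0∞) ^ (p - 1) ≠ ⊤ := by finiteness
          rw [gagliardoEnergy, ← lintegral_add_right' _
            (aemeasurable_gagliardoKernel hhc.aestronglyMeasurable).lintegral_prod_right',
            ← lintegral_const_mul' _ _ hne]
          refine lintegral_congr fun x => ?_
          rw [lintegral_const_mul' _ _ hne, lintegral_add_right' _
            (aemeasurable_gagliardoKernel_right hhc.aestronglyMeasurable x)]
      _ ≤ 2 ^ (p - 1) * (1 + ENNReal.ofReal (C * |(D : ℝ)|)) := by
          gcongr
          exact hbub D j hD0
      _ = ENNReal.ofReal (2 ^ (p - 1) * (1 + C * |(D : ℝ)|)) := by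
          rw [h2p, ← ENNReal.ofReal_one, ← ENNReal.ofReal_add one_pos.le (by positivity),
            ← ENNReal.ofReal_mul (by positivity)]
      _ ≤ _ := by
          refine ENNReal.ofReal_le_ofReal ?_
          rw [mul_assoc]
          gcongr
          linarith
  refine ⟨g, ⟨?_, ?_⟩, ?_⟩
  · rw [memSobolev_of_floor_eq_zero hs hfloor]
    have hgm : AEStronglyMeasurable (fun z => (g z : ℂ)) arcLength := by
      simp only [hg, Circle.coe_mul]
      exact hfm.mul hhc.aestronglyMeasurable
    refine ⟨MemLp.of_bound hgm 1 (Eventually.of_forall fun z => (Circle.norm_coe _).le), ?_⟩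
    rw [gagliardo_lt_top_iff hp0]
    refine (gagliardoEnergy_le_add hp.le hfm (g := fun z => (f z : ℂ) - g z)
      fun x y => ?_).trans_lt (ENNReal.mul_lt_top (by finiteness)
        (ENNReal.add_lt_top.2 ⟨hfg, hen.trans_lt ENNReal.ofReal_lt_top⟩))
    have e : (g x : ℂ) - g y = ((f x : ℂ) - f y) - (((f x : ℂ) - g x) - ((f y : ℂ) - g y)) := by
      ring
    rw [e]
    exact norm_sub_le _ _
  · have := hf.2.mul_phase hfm (eventually_norm_arcMean_ge hp.le hfm hfg.ne) (isPhase_bubble D j)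
    rwa [hD, add_sub_cancel] at this
  · rw [gagliardo_eq, hDabs, ← Real.mul_rpow (by positivity) (abs_nonneg _),
      ← ENNReal.ofReal_rpow_of_nonneg (by positivity) (by positivity)]
    gcongr

theorem exists_dist_gagliardo_le {p : ℝ} (hp : 1 < p) : ∃ C : ℝ≥0, ∀ d₁ d₂ : ℤ,
    Dist (gagliardo (1 / p) p) (1 / p) p d₁ d₂ ≤
      C * ENNReal.ofReal (|(d₁ : ℝ) - d₂| ^ (1 / p)) := by
  have hp0 : 0 < p := by linarith
  obtain ⟨C, hC, h⟩ := exists_mul_bubble_close hp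
  refine ⟨C.toNNReal, fun d₁ d₂ => iSup₂_le fun f hf => ?_⟩
  rcases eq_or_ne d₁ d₂ with rfl | hd
  · refine (iInf₂_le f hf).trans ?_
    simp [gagliardo, hp0.ne']
    simp [hp0]
  · obtain ⟨g, hg, hle⟩ := h d₁ d₂ hd f hf
    refine (iInf₂_le g hg).trans (hle.trans (le_of_eq ?_))
    rw [ENNReal.ofReal_mul hC.le]
    rfl

theorem gagliardo_sub_const (σ p : ℝ) (f : Circle → ℂ) (c : ℂ) :
    gagliardo σ p (fun z => f z - c) = gagliardo σ p f := by
  simp [gagliardo]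

theorem exists_dist_moduloMean_le {p : ℝ} (hp : 1 < p) {N : (Circle → ℂ) → ℝ≥0∞}
    (hN : IsComparableToNorm (1 / p) p N) : ∃ C : ℝ≥0, ∀ d₁ d₂ : ℤ,
    Dist (moduloMean N) (1 / p) p d₁ d₂ ≤ C * ENNReal.ofReal (|(d₁ : ℝ) - d₂| ^ (1 / p)) := by
  have hp0 : 0 < p := by linarith
  have hs : 0 < 1 / p := by positivity
  have hfloor := floor_eq_zero_of_critical hp
  obtain ⟨C, hC, h⟩ := exists_mul_bubble_close hp
  obtain ⟨_, C', _, hN⟩ := hN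
  have hfull : ∀ u : Circle → ℂ, fullNorm (1 / p) p u =
      eLpNorm u (ENNReal.ofReal p) arcLength + gagliardo (1 / p) p u := fun u => by
    rw [fullNorm, hfloor, seminorm_of_floor_eq_zero hs hfloor]
    simp
  -- The difference and its mean are each bounded by `2`, so the `L^p` part is at most `B` for all
  -- degrees; it is absorbed since `|d₁ - d₂| ≥ 1`.
  set B : ℝ := (2 * Real.pi) ^ (1 / p) * 4 with hB
  have hB0 : 0 < B := by positivity
  refine ⟨C' * (B + C).toNNReal, fun d₁ d₂ => iSup₂_le fun f hf => ?_⟩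
  rcases eq_or_ne d₁ d₂ with rfl | hd
  · refine (iInf₂_le f hf).trans ?_
    have hz : MemSobolev (1 / p) p fun _ => (0 : ℂ) := (IsSmooth.const 0).memSobolev hs hp.le
    have h1 : fullNorm (1 / p) p (fun _ => (0 : ℂ)) = 0 := by
      rw [hfull]
      simp [gagliardo, hp0.ne', hp0]
    have h2 := (hN _ hz).2
    rw [h1, mul_zero] at h2
    simp only [moduloMean, sub_self, average_zero]
    exact h2.trans zero_le
  · obtain ⟨g, hg, hle⟩ := h d₁ d₂ hd f hf
    refine (iInf₂_le g hg).trans ?_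
    set u : Circle → ℂ := fun z => (f z : ℂ) - g z with hu
    have hmem : MemSobolev (1 / p) p u := hf.1.sub hp.le hg.1
    have hu2 : ∀ z, ‖u z‖ ≤ 2 := fun z => by
      refine (norm_sub_le _ _).trans ?_
      rw [Circle.norm_coe, Circle.norm_coe]; norm_num
    set c := ⨍ w, u w ∂arcLength with hc
    have hc2 : ‖c‖ ≤ 2 := by
      have h1 := norm_integral_le_of_norm_le_const (μ := (arcLength Set.univ)⁻¹ • arcLength)
        (Eventually.of_forall hu2)
      refine h1.trans ?_
      have : (((arcLength Set.univ)⁻¹ • arcLength).real Set.univ) ≤ 1 := by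
        rw [measureReal_def, Measure.smul_apply, smul_eq_mul]
        exact ENNReal.toReal_le_of_le_ofReal one_pos.le (by
          rw [ENNReal.ofReal_one]; exact ENNReal.inv_mul_le_one _)
      linarith
    have hL : eLpNorm (fun z => u z - c) (ENNReal.ofReal p) arcLength ≤ ENNReal.ofReal B := by
      have h1 := eLpNorm_le_of_ae_bound (μ := arcLength) (p := ENNReal.ofReal p)
        (f := fun z => u z - c) (C := 4) (Eventually.of_forall fun z => by
          linarith [norm_sub_le (u z) c, hu2 z])
      rwa [arcLength_univ, ENNReal.toReal_ofReal hp0.le, ENNReal.ofReal_rpow_of_nonneg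
        (by positivity) (by positivity), ← ENNReal.ofReal_mul (by positivity), ← one_div] at h1
    have hD1 : 1 ≤ |(d₁ : ℝ) - d₂| ^ (1 / p) := by
      refine Real.one_le_rpow ?_ hs.le
      exact_mod_cast Int.one_le_abs (sub_ne_zero.2 hd)
    rw [moduloMean]
    refine (hN _ (hmem.sub_const hs hp.le _)).2.trans ?_
    rw [hfull, gagliardo_sub_const]
    calc _ ≤ (C' : ℝ≥0∞) * (ENNReal.ofReal B + ENNReal.ofReal (C * |(d₁ : ℝ) - d₂| ^ (1 / p))) := by
          gcongr
      _ ≤ C' * (ENNReal.ofReal ((B + C) * |(d₁ : ℝ) - d₂| ^ (1 / p))) := by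
          rw [← ENNReal.ofReal_add hB0.le (by positivity)]
          gcongr
          nlinarith
      _ = _ := by
          rw [ENNReal.ofReal_mul (by positivity), ENNReal.coe_mul, mul_assoc]
          rfl

theorem exists_hdist_le {δ : (Circle → ℂ) → ℝ≥0∞} {s p : ℝ} {r : ℝ}
    (h : ∃ C : ℝ≥0, ∀ d₁ d₂ : ℤ, Dist δ s p d₁ d₂ ≤ C * ENNReal.ofReal (|(d₁ : ℝ) - d₂| ^ r)) :
    ∃ C : ℝ≥0, ∀ d₁ d₂ : ℤ, HDist δ s p d₁ d₂ ≤ C * ENNReal.ofReal (|(d₁ : ℝ) - d₂| ^ r) := by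
  obtain ⟨C, hC⟩ := h
  exact ⟨C, fun d₁ d₂ => max_le (hC d₁ d₂) (by rw [abs_sub_comm]; exact hC d₂ d₁)⟩

/-! ### The space `W^{1,1}` -/

theorem IsWeakDeriv.seminorm_one_one {f g : Circle → ℂ} (h : IsWeakDeriv f g) :
    seminorm 1 1 f = ∫⁻ z, ‖g z‖ₑ ∂arcLength := by
  have h1 : weakDeriv^[⌊(1 : ℝ)⌋₊] f =ᵐ[arcLength] g := by
    rw [Nat.floor_one]
    exact h.weakDeriv_ae_eq
  rw [seminorm_eq_of_ae h1, if_pos (by simp), ENNReal.ofReal_one, eLpNorm_one_eq_lintegral_enorm]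

theorem memSobolev_one_one_iff {f : Circle → ℂ} : MemSobolev 1 1 f ↔ WeaklyDifferentiable f := by
  refine ⟨fun h => h.differentiable 0 (by simp), fun h => ?_⟩
  have hw := isWeakDeriv_weakDeriv h
  refine ⟨fun k hk => ?_, fun k hk => ?_, ?_⟩
  · rw [Nat.floor_one, Nat.lt_one_iff] at hk
    subst hk
    exact h
  · rw [Nat.floor_one] at hk
    rw [ENNReal.ofReal_one, memLp_one_iff_integrable]
    interval_cases k
    · exact hw.1
    · exact hw.2.1
  · rw [hw.seminorm_one_one]
    exact hw.2.1.2

/-! ### Upper bound in `W^{1,1}`: multiplication by bubbles. -/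

theorem tendsto_lintegral_mul_one_sub_bubble {u : Circle → ℂ} (hu : Integrable u arcLength)
    (D : ℤ) : Tendsto (fun j => ∫⁻ z, ‖u z * (1 - (bubble D j z : ℂ))‖ₑ ∂arcLength) atTop
      (𝓝 0) := by
  have h0 : (0 : ℝ≥0∞) = ∫⁻ _, 0 ∂arcLength := by simp
  rw [h0]
  refine tendsto_lintegral_of_dominated_convergence' (fun z => 2 * ‖u z‖ₑ) (fun j => ?_)
    (fun j => Eventually.of_forall fun z => ?_) ?_ ?_
  · exact (hu.1.mul (continuous_const.sub
      (isSmooth_bubble D j).continuous).aestronglyMeasurable).enorm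
  · have h2 : ‖1 - (bubble D j z : ℂ)‖ ≤ 2 := by
      refine (norm_sub_le _ _).trans ?_
      rw [Circle.norm_coe, norm_one]; norm_num
    have h3 : ‖1 - (bubble D j z : ℂ)‖ₑ ≤ 2 := by
      rw [← ofReal_norm]
      exact (ENNReal.ofReal_le_ofReal h2).trans (by simp)
    exact (enorm_mul _ _).trans_le ((mul_comm _ _).trans_le (mul_le_mul' h3 le_rfl))
  · rw [lintegral_const_mul' _ _ (by finiteness)]
    exact (ENNReal.mul_lt_top (by finiteness) hu.2).ne
  · filter_upwards [arcLength_singleton_one] with z hz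
    have h := (((tendsto_bubble D hz).const_sub 1).const_mul (u z)).enorm
    simpa using h

theorem dist_one_one_le (d₁ d₂ : ℤ) :
    Dist (seminorm 1 1) 1 1 d₁ d₂ ≤ ENNReal.ofReal (2 * Real.pi * |(d₁ : ℝ) - d₂|) := by
  refine iSup₂_le fun f hf => ?_
  have hw := isWeakDeriv_weakDeriv (memSobolev_one_one_iff.1 hf.1)
  set u := weakDeriv fun z => (f z : ℂ) with hu
  obtain ⟨F, hFc, hfF, -⟩ := hw.exists_primitive
  set D := d₂ - d₁ with hD
  have hlim := (tendsto_lintegral_mul_one_sub_bubble hw.2.1 D).add_const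
    (ENNReal.ofReal (2 * Real.pi * |(D : ℝ)|))
  rw [zero_add] at hlim
  have hDabs : |(d₁ : ℝ) - d₂| = |(D : ℝ)| := by rw [abs_sub_comm, hD]; push_cast; rfl
  rw [hDabs]
  refine ge_of_tendsto' hlim fun j => ?_
  have hb := isSmooth_bubble D j
  have hfb := hw.mul hb.isWeakDeriv
  have hmem : (fun z => f z * bubble D j z) ∈ degreeClass 1 1 d₂ := by
    refine ⟨memSobolev_one_one_iff.2 ⟨_, by simpa only [Circle.coe_mul] using hfb⟩, ?_⟩
    have hae : (fun z => ((f z * bubble D j z : Circle) : ℂ)) =ᵐ[arcLength]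
        fun z => F z * bubble D j z := by
      filter_upwards [hfF] with z hz
      rw [Circle.coe_mul, ← hz]
    rw [hasDegree_iff_of_ae_eq (hFc.mul hb.continuous) hae]
    have := ((hasDegree_iff_of_ae_eq hFc hfF).1 hf.2).mul_phase (isPhase_bubble D j)
    rwa [hD, add_sub_cancel] at this
  refine (iInf₂_le _ hmem).trans ?_
  simp only [Circle.coe_mul]
  rw [(hw.sub hfb).seminorm_one_one, ← lintegral_enorm_circleDeriv_bubble,
    ← lintegral_add_right' _ hb.circleDeriv.continuous.aestronglyMeasurable.enorm]
  refine lintegral_mono fun z => ?_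
  have e : u z - (u z * (bubble D j z : ℂ) +
      f z * circleDeriv (fun z => (bubble D j z : ℂ)) z) =
      u z * (1 - (bubble D j z : ℂ)) - f z * circleDeriv (fun z => (bubble D j z : ℂ)) z := by
    ring
  simp only
  rw [e]
  refine (enorm_sub_le).trans ?_
  rw [enorm_mul (f z : ℂ), ← ofReal_norm (f z : ℂ), Circle.norm_coe, ENNReal.ofReal_one, one_mul]

/-! ### The degree as an integral. -/

theorem IsPrimitive.circleExp {ψ r : ℝ → ℝ}
    (hψ : IsPrimitive (fun t => (ψ t : ℂ)) (fun t => (r t : ℂ))) :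
    IsPrimitive (fun t => (Circle.exp (ψ t) : ℂ))
      (fun t => r t * Complex.I * Circle.exp (ψ t)) := by
  refine of_absolutelyContinuous (fun a b => ?_) (fun a b => ?_) ?_
  · refine squeeze_zero (fun _ => Finset.sum_nonneg fun _ _ => dist_nonneg)
      (fun E => Finset.sum_le_sum fun i _ => ?_) (hψ.absolutelyContinuousOnInterval a b)
    exact (dist_exp_exp_le _ _).trans_eq (by
      rw [Complex.dist_eq, ← Complex.ofReal_sub, Complex.norm_real, Real.norm_eq_abs])
  · exact ((hψ a b).1.mul_const Complex.I).mul_continuousOn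
      (continuous_subtype_val.comp (Circle.exp.continuous.comp
        (Complex.continuous_re.comp hψ.continuous))).continuousOn
  · filter_upwards [hψ.ae_hasDerivAt] with t ht
    simp only [Circle.coe_exp]
    convert (ht.mul_const Complex.I).cexp using 1
    ring

/-- The degree of a map with values in the circle as an integral. -/
theorem integral_im_eq_degree {G g : Circle → ℂ} {d : ℤ} (hd : HasContinuousDegree G d)
    (hG : ∀ z, ‖G z‖ = 1)
    (hP : IsPrimitive (fun t => G (Circle.exp t)) (fun t => g (Circle.exp t))) :
    ∫ t in (-Real.pi)..Real.pi, (g (Circle.exp t) * starRingEnd ℂ (G (Circle.exp t))).im =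
      2 * Real.pi * d := by
  have hGG : ∀ t : ℝ, G (Circle.exp t) * starRingEnd ℂ (G (Circle.exp t)) = 1 := fun t => by
    rw [Complex.mul_conj', hG]; simp
  set u : ℝ → ℂ := fun t => g (Circle.exp t) * starRingEnd ℂ (G (Circle.exp t)) with hu
  set r : ℝ → ℝ := fun t => (u t).im with hr
  -- Differentiating `G Ḡ = 1` shows that `g Ḡ` is purely imaginary.
  have hre : ∀ᵐ t, u t = r t * Complex.I := by
    filter_upwards [(hP.mul hP.conj).ae_hasDerivAt] with t ht
    simp only [hGG] at ht
    have h1 := ht.unique (hasDerivAt_const t (1 : ℂ))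
    have h2 : u t + starRingEnd ℂ (u t) = 0 := by
      rw [← h1]
      simp only [hu, map_mul, Complex.conj_conj]
      ring
    rw [Complex.add_conj] at h2
    have h3 : (u t).re = 0 := by
      have : 2 * (u t).re = 0 := by exact_mod_cast h2
      linarith
    apply Complex.ext <;> simp [h3, hr]
  have hui : ∀ a b, IntervalIntegrable u volume a b := fun a b =>
    (hP a b).1.mul_continuousOn hP.conj.continuous.continuousOn
  have hri : ∀ a b, IntervalIntegrable r volume a b := fun a b =>
    ⟨(hui a b).1.im, (hui a b).2.im⟩
  set ψ : ℝ → ℝ := fun t => ∫ s in (0 : ℝ)..t, r s with hψ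
  have hψP : IsPrimitive (fun t => (ψ t : ℂ)) (fun t => (r t : ℂ)) := fun a b => by
    refine ⟨⟨(hri a b).1.ofReal, (hri a b).2.ofReal⟩, ?_⟩
    rw [intervalIntegral.integral_ofReal, ← Complex.ofReal_sub,
      intervalIntegral.integral_interval_sub_left (hri _ _) (hri _ _)]
  have hE := hψP.circleExp
  have hEE : ∀ t, (Circle.exp (ψ t) : ℂ) * starRingEnd ℂ (Circle.exp (ψ t) : ℂ) = 1 := fun t => by
    rw [Complex.mul_conj', Circle.norm_coe]; simp
  -- `G` times the conjugate of `exp(iψ)` has derivative zero, so `ψ` is a phase of `G` up to a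
  -- constant.
  have hK := (hP.mul hE.conj).congr_ae (u' := fun _ => 0) (by
    filter_upwards [hre] with t ht
    have h1 : g (Circle.exp t) = r t * Complex.I * G (Circle.exp t) := by
      rw [← ht, hu]
      linear_combination (-g (Circle.exp t)) * hGG t
    rw [h1]
    simp only [map_mul, Complex.conj_ofReal, Complex.conj_I]
    ring)
  have hconst : ∀ t, G (Circle.exp t) = G 1 * Circle.exp (ψ t) := fun t => by
    have h1 := hK.eq_add 0 t
    simp only [intervalIntegral.integral_zero, add_zero] at h1
    have h2 : ψ 0 = 0 := intervalIntegral.integral_same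
    rw [h2, Circle.exp_zero] at h1
    simp only [Circle.coe_one, map_one, mul_one] at h1
    linear_combination (Circle.exp (ψ t) : ℂ) * h1 - G (Circle.exp t) * hEE t
  have hper : Function.Periodic r (2 * Real.pi) :=
    periodic_comp_exp fun z => (g z * starRingEnd ℂ (G z)).im
  set c := ∫ t in (-Real.pi)..Real.pi, r t with hc
  have hψc : ∀ t, ψ (t + 2 * Real.pi) = ψ t + c := fun t => by
    have h1 := hper.intervalIntegral_add_eq t (-Real.pi)
    rw [show -Real.pi + 2 * Real.pi = Real.pi by ring, ← hc] at h1
    rw [← h1, hψ]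
    exact (intervalIntegral.integral_add_adjacent_intervals (hri _ _) (hri _ _)).symm
  have hG1 : G 1 ≠ 0 := fun h => by simpa [h] using hG 1
  have hexp : Circle.exp c = 1 := by
    have h1 := hconst (0 + 2 * Real.pi)
    have h2 := hconst 0
    rw [hψc, Circle.exp_add, Circle.exp_two_pi, mul_one, h2, Circle.exp_add, Circle.coe_mul,
      ← mul_assoc] at h1
    apply Circle.ext
    have h3 : G 1 * Circle.exp (ψ 0) ≠ 0 := mul_ne_zero hG1 (Circle.coe_ne_zero _)
    rw [Circle.coe_one]
    exact mul_left_cancel₀ h3 (by rw [mul_one]; exact h1.symm)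
  obtain ⟨k, hk⟩ := Circle.exp_eq_one.1 hexp
  obtain ⟨α, hα⟩ := Circle.exp_surjective ⟨G 1, mem_sphere_zero_iff_norm.2 (hG 1)⟩
  have hα' : (Circle.exp α : ℂ) = G 1 := by rw [hα]
  -- This phase grows by `2πk` over one turn; uniqueness of the degree identifies `k` with `d`.
  have hdeg : HasContinuousDegree G k := by
    refine ⟨hd.1, hd.2.1, fun t => α + ψ t,
      continuous_const.add (Complex.continuous_re.comp hψP.continuous), fun t => ?_, fun t => ?_⟩
    · rw [hG, Circle.exp_add, Circle.coe_mul, hα', hconst]; simp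
    · simp only [hψc, hk]; ring
  rw [hk, hd.eq_of_norm_sub_lt_two hdeg hG hG (fun z => by simp)]
  ring

/-! ### Lower bound in `W^{1,1}`: oscillating maps. -/

theorem lintegral_lintegral_arc {φ : Circle → ℝ≥0∞} (hφ : Measurable φ) (r : ℝ) :
    ∫⁻ z, (∫⁻ s in Set.Ioc (-r) r, φ (z * Circle.exp s)) ∂arcLength =
      ENNReal.ofReal (2 * r) * ∫⁻ z, φ z ∂arcLength := by
  have hm : Measurable fun q : Circle × ℝ => φ (q.1 * Circle.exp q.2) :=
    hφ.comp (continuous_fst.mul (Circle.exp.continuous.comp continuous_snd)).measurable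
  rw [lintegral_lintegral_swap hm.aemeasurable]
  simp_rw [lintegral_mul_exp_arcLength]
  rw [setLIntegral_const, Real.volume_Ioc, mul_comm]
  congr 2
  ring

theorem IsPrimitive.enorm_sub_le_arc {U : ℝ → ℂ} {v : Circle → ℂ}
    (h : IsPrimitive U fun t => v (Circle.exp t)) {θ t r : ℝ} (ht : |t - θ| ≤ r) :
    ‖U t - U θ‖ₑ ≤ ∫⁻ s in Set.Ioc (-r) r, ‖v (Circle.exp θ * Circle.exp s)‖ₑ := by
  have hshift : ∫⁻ s in Set.Ioc (-r) r, ‖v (Circle.exp θ * Circle.exp s)‖ₑ =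
      ∫⁻ s in Set.Ioc (θ - r) (θ + r), ‖v (Circle.exp s)‖ₑ := by
    have h1 := (measurePreserving_add_left volume θ).setLIntegral_comp_preimage_emb
      (measurableEmbedding_addLeft θ) (fun s => ‖v (Circle.exp s)‖ₑ) (Set.Ioc (θ - r) (θ + r))
    rw [← h1]
    simp [Set.preimage_const_add_Ioc, Circle.exp_add]
  rw [hshift]
  obtain ⟨h1, h2⟩ := abs_le.1 ht
  rcases le_total θ t with hle | hle
  · exact (h.norm_sub_le hle).trans (lintegral_mono_set (Set.Ioc_subset_Ioc (by linarith)
      (by linarith)))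
  · rw [enorm_sub_rev]
    exact (h.norm_sub_le hle).trans (lintegral_mono_set (Set.Ioc_subset_Ioc (by linarith)
      (by linarith)))

/-- The three-point estimate is applied at each `θ`, with `η` the variation of the difference over
the window of radius `2π/n`. Integrated over the circle, these local variations give the total
variation times the window length `4π/n`. -/
theorem lintegral_norm_sq_wiggle_sub_le {d : ℤ} {δ : ℝ} {n : ℕ} (hn : 0 < n) {G g : Circle → ℂ}
    (hG : ∀ z, ‖G z‖ = 1) (hg : Integrable g arcLength)
    (hP : IsPrimitive (fun t => G (Circle.exp t)) (fun t => g (Circle.exp t))) :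
    ∫⁻ z, ENNReal.ofReal ((1 - Real.cos (δ + d * Real.pi / (2 * n))) *
        ‖(wiggle d δ n z : ℂ) - G z‖ ^ 2) ∂arcLength ≤
      ENNReal.ofReal (20 * (2 * (2 * Real.pi / n))) *
        ∫⁻ z, ‖circleDeriv (fun z => (wiggle d δ n z : ℂ)) z - g z‖ₑ ∂arcLength := by
  have hs : IsSmooth fun z => (wiggle d δ n z : ℂ) :=
    (isPhase_wiggle d δ n).isSmooth (contDiff_wigglePhase d δ n)
  have hint : AEStronglyMeasurable
      (fun z => circleDeriv (fun z => (wiggle d δ n z : ℂ)) z - g z) arcLength :=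
    hs.circleDeriv.continuous.aestronglyMeasurable.sub hg.1
  obtain ⟨v, hvm, hv⟩ := hint
  have hV : IsPrimitive (fun t => (wiggle d δ n (Circle.exp t) : ℂ) - G (Circle.exp t))
      (fun t => v (Circle.exp t)) :=
    (hs.isPrimitive.sub hP).congr_ae (ae_arcLength_iff.1 hv)
  rw [lintegral_congr_ae (hv.mono fun z hz => by simp only [hz] :
      (fun z => ‖circleDeriv (fun z => (wiggle d δ n z : ℂ)) z - g z‖ₑ) =ᵐ[arcLength]
        fun z => ‖v z‖ₑ), ENNReal.ofReal_mul (by norm_num), mul_assoc,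
    ← lintegral_lintegral_arc hvm.measurable.enorm,
    ← lintegral_const_mul' _ _ ENNReal.ofReal_ne_top]
  refine lintegral_mono fun z => ?_
  obtain ⟨θ, rfl⟩ := Circle.exp_surjective z
  set η := ∫⁻ s in Set.Ioc (-(2 * Real.pi / n)) (2 * Real.pi / n),
    ‖v (Circle.exp θ * Circle.exp s)‖ₑ with hη
  rcases eq_or_ne η ⊤ with htop | htop
  · rw [htop, ENNReal.mul_top (by simp)]
    exact le_top
  · have h := wiggle_sub_norm_sq_le hn hG (d := d) (δ := δ) (θ := θ) (η := η.toReal) fun t ht => by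
      have h1 := hV.enorm_sub_le_arc ht
      rw [← toReal_enorm]
      exact ENNReal.toReal_mono htop h1
    rw [← ENNReal.ofReal_toReal htop, ← ENNReal.ofReal_mul (by norm_num)]
    exact ENNReal.ofReal_le_ofReal h

theorem hasDerivAt_wigglePhase (d : ℤ) (δ : ℝ) (n : ℕ) (θ : ℝ) :
    HasDerivAt (wigglePhase d δ n) (d + δ * n * Real.cos (n * θ)) θ := by
  have h1 := (hasDerivAt_id θ).const_mul (d : ℝ)
  have h2 := (((hasDerivAt_id θ).const_mul (n : ℝ)).sin).const_mul δ
  refine (h1.add h2).congr_deriv ?_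
  simp only [id, mul_one]
  ring

theorem norm_sub_sq_of_norm_one {a b : ℂ} (ha : ‖a‖ = 1) (hb : ‖b‖ = 1) :
    ‖a - b‖ ^ 2 = 2 - 2 * (a * starRingEnd ℂ b).re := by
  rw [← Complex.normSq_eq_norm_sq, Complex.normSq_sub, Complex.normSq_eq_norm_sq,
    Complex.normSq_eq_norm_sq, ha, hb]
  ring

/-- An oscillating weight barely sees the square of a slowly varying function. -/
theorem abs_integral_cos_mul_norm_sq_le {δ : ℝ} (hδ : 0 ≤ δ) (n : ℕ) {V v : Circle → ℂ}
    (hV : IsPrimitive (fun t => V (Circle.exp t)) (fun t => v (Circle.exp t)))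
    (hV2 : ∀ z, ‖V z‖ ≤ 2) :
    |∫ t in (-Real.pi)..Real.pi, δ * n * Real.cos (n * t) * ‖V (Circle.exp t)‖ ^ 2| ≤
      4 * δ * ∫ t in (-Real.pi)..Real.pi, ‖v (Circle.exp t)‖ := by
  have hpi := Real.pi_pos
  set w : ℝ → ℂ := fun t => ((δ * Real.sin (n * t) : ℝ) : ℂ) with hw
  set w' : ℝ → ℂ := fun t => ((δ * n * Real.cos (n * t) : ℝ) : ℂ) with hw'
  -- The weight is the derivative of `δ sin nt`, which is bounded by `δ` whatever `n` is and
  -- vanishes at `±π`: integrating by parts moves the derivative onto `|V|²`.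
  have hwP : IsPrimitive w w' := by
    refine IsPrimitive.of_hasDerivAt (fun t => ?_) (by fun_prop)
    have h2 := ((((hasDerivAt_id t).const_mul (n : ℝ)).sin).const_mul δ).ofReal_comp
    refine h2.congr_deriv ?_
    simp only [hw', id, mul_one]
    push_cast
    ring
  set S : ℝ → ℂ := fun t => V (Circle.exp t) * starRingEnd ℂ (V (Circle.exp t)) with hS
  set s : ℝ → ℂ := fun t => v (Circle.exp t) * starRingEnd ℂ (V (Circle.exp t)) +
    V (Circle.exp t) * starRingEnd ℂ (v (Circle.exp t)) with hs
  have hSP : IsPrimitive S s := hV.mul hV.conj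
  have h1 := (hwP.mul hSP (-Real.pi) Real.pi).2
  have hw0 : w Real.pi = 0 ∧ w (-Real.pi) = 0 := by
    simp only [hw, mul_neg, Real.sin_neg, Real.sin_nat_mul_pi]
    simp
  simp only [hw0.1, hw0.2, zero_mul, sub_zero] at h1
  have hi1 : IntervalIntegrable (fun t => w' t * S t) volume (-Real.pi) Real.pi :=
    (hwP _ _).1.mul_continuousOn hSP.continuous.continuousOn
  have hi2 : IntervalIntegrable (fun t => w t * s t) volume (-Real.pi) Real.pi :=
    (hSP _ _).1.continuousOn_mul hwP.continuous.continuousOn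
  rw [intervalIntegral.integral_add hi1 hi2] at h1
  have h2 : ((∫ t in (-Real.pi)..Real.pi,
      δ * n * Real.cos (n * t) * ‖V (Circle.exp t)‖ ^ 2 : ℝ) : ℂ) =
      ∫ t in (-Real.pi)..Real.pi, w' t * S t := by
    rw [← intervalIntegral.integral_ofReal]
    refine intervalIntegral.integral_congr fun t _ => ?_
    simp only [hw', hS, Complex.mul_conj']
    push_cast
    ring
  rw [← Real.norm_eq_abs, ← Complex.norm_real, h2, eq_neg_of_add_eq_zero_left h1.symm, norm_neg,
    ← intervalIntegral.integral_const_mul]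
  refine intervalIntegral.norm_integral_le_of_norm_le (by linarith)
    (Eventually.of_forall fun t _ => ?_) ((hV _ _).1.norm.const_mul _)
  have h3 : ‖w t‖ ≤ δ := by
    rw [hw, Complex.norm_real, norm_mul, Real.norm_of_nonneg hδ, Real.norm_eq_abs]
    exact mul_le_of_le_one_right hδ (Real.abs_sin_le_one _)
  have h4 : ‖s t‖ ≤ 4 * ‖v (Circle.exp t)‖ := by
    refine (norm_add_le _ _).trans ?_
    rw [norm_mul, norm_mul, RCLike.norm_conj, RCLike.norm_conj]
    nlinarith [hV2 (Circle.exp t), norm_nonneg (v (Circle.exp t))]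
  calc ‖w t * s t‖ = ‖w t‖ * ‖s t‖ := norm_mul _ _
    _ ≤ δ * (4 * ‖v (Circle.exp t)‖) := by gcongr
    _ = _ := by ring

theorem two_pi_mul_abs_sub_le {d₁ d₂ : ℤ} {δ : ℝ} (hδ : 0 ≤ δ) (n : ℕ) {G g : Circle → ℂ}
    (hd : HasContinuousDegree G d₂) (hG : ∀ z, ‖G z‖ = 1)
    (hP : IsPrimitive (fun t => G (Circle.exp t)) (fun t => g (Circle.exp t))) :
    2 * Real.pi * |(d₁ : ℝ) - d₂| ≤
      (1 + 2 * δ) * (∫ t in (-Real.pi)..Real.pi,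
        ‖circleDeriv (fun z => (wiggle d₁ δ n z : ℂ)) (Circle.exp t) - g (Circle.exp t)‖) +
      |(d₁ : ℝ)| / 2 * ∫ t in (-Real.pi)..Real.pi,
        ‖(wiggle d₁ δ n (Circle.exp t) : ℂ) - G (Circle.exp t)‖ ^ 2 := by
  have hpi := Real.pi_pos
  have hs : IsSmooth fun z => (wiggle d₁ δ n z : ℂ) :=
    (isPhase_wiggle d₁ δ n).isSmooth (contDiff_wigglePhase d₁ δ n)
  set V : Circle → ℂ := fun z => (wiggle d₁ δ n z : ℂ) - G z with hV
  set v : Circle → ℂ := fun z => circleDeriv (fun z => (wiggle d₁ δ n z : ℂ)) z - g z with hv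
  have hVP : IsPrimitive (fun t => V (Circle.exp t)) (fun t => v (Circle.exp t)) :=
    hs.isPrimitive.sub hP
  have hV2 : ∀ z, ‖V z‖ ≤ 2 := fun z => by
    refine (norm_sub_le _ _).trans ?_
    rw [Circle.norm_coe, hG]; norm_num
  set B := ∫ t in (-Real.pi)..Real.pi, ‖v (Circle.exp t)‖ with hB
  set A := ∫ t in (-Real.pi)..Real.pi, ‖V (Circle.exp t)‖ ^ 2 with hA
  set Q := ∫ t in (-Real.pi)..Real.pi, δ * n * Real.cos (n * t) * ‖V (Circle.exp t)‖ ^ 2 with hQ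
  have hA0 : 0 ≤ A := intervalIntegral.integral_nonneg (by linarith) fun t _ => by positivity
  have hQB : |Q| ≤ 4 * δ * B := abs_integral_cos_mul_norm_sq_le hδ n hVP hV2
  set q : ℝ → ℝ := fun t => (v (Circle.exp t) * starRingEnd ℂ (G (Circle.exp t))).im with hq
  have hqB : |∫ t in (-Real.pi)..Real.pi, q t| ≤ B := by
    rw [← Real.norm_eq_abs]
    refine intervalIntegral.norm_integral_le_of_norm_le (by linarith)
      (Eventually.of_forall fun t _ => ?_) (hVP _ _).1.norm
    refine (Complex.abs_im_le_norm _).trans ?_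
    rw [norm_mul, RCLike.norm_conj, hG, mul_one]
  -- Here `Im(f' Ḡ) = φ' Re(f Ḡ)` and `Re(f Ḡ) = 1 - |V|²/2`, with `φ' = d₁ + δ n cos nt`.
  have hpt : ∀ t, q t = (d₁ : ℝ) + δ * n * Real.cos (n * t) -
      (d₁ / 2 * ‖V (Circle.exp t)‖ ^ 2 +
        1 / 2 * (δ * n * Real.cos (n * t) * ‖V (Circle.exp t)‖ ^ 2)) -
      (g (Circle.exp t) * starRingEnd ℂ (G (Circle.exp t))).im := by
    intro t
    have h1 := norm_sub_sq_of_norm_one (Circle.norm_coe (wiggle d₁ δ n (Circle.exp t)))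
      (hG (Circle.exp t))
    have h2 := (isPhase_wiggle d₁ δ n).circleDeriv_eq (hasDerivAt_wigglePhase d₁ δ n t)
    have h3 : ((((d₁ : ℝ) + δ * n * Real.cos (n * t) : ℝ) : ℂ) * Complex.I *
        wiggle d₁ δ n (Circle.exp t) * starRingEnd ℂ (G (Circle.exp t))).im =
        ((d₁ : ℝ) + δ * n * Real.cos (n * t)) *
          ((wiggle d₁ δ n (Circle.exp t) : ℂ) * starRingEnd ℂ (G (Circle.exp t))).re := by
      rw [mul_assoc, mul_assoc, Complex.im_ofReal_mul,
        Complex.I_mul_im]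
    simp only [hq, hv, sub_mul, Complex.sub_im]
    rw [h2, h3, hV, h1]
    ring
  have hVc : Continuous fun t : ℝ => ‖V (Circle.exp t)‖ ^ 2 := hVP.continuous.norm.pow 2
  have hcc : Continuous fun t : ℝ => (d₁ : ℝ) + δ * n * Real.cos (n * t) := by fun_prop
  have hA1 : Continuous fun t : ℝ => (d₁ : ℝ) / 2 * ‖V (Circle.exp t)‖ ^ 2 :=
    continuous_const.mul hVc
  have hA2 : Continuous fun t : ℝ =>
      1 / 2 * (δ * n * Real.cos (n * t) * ‖V (Circle.exp t)‖ ^ 2) :=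
    continuous_const.mul (Continuous.mul (by fun_prop) hVc)
  have hgi : IntervalIntegrable (fun t => (g (Circle.exp t) * starRingEnd ℂ (G (Circle.exp t))).im)
      volume (-Real.pi) Real.pi := by
    have h := (hP (-Real.pi) Real.pi).1.mul_continuousOn hP.conj.continuous.continuousOn
    exact ⟨h.1.im, h.2.im⟩
  have hcos : ∫ t in (-Real.pi)..Real.pi, ((d₁ : ℝ) + δ * n * Real.cos (n * t)) =
      2 * Real.pi * d₁ := by
    rw [intervalIntegral.integral_eq_sub_of_hasDerivAt
      (fun t _ => hasDerivAt_wigglePhase d₁ δ n t)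
      (hcc.intervalIntegrable _ _)]
    simp only [wigglePhase, mul_neg, Real.sin_neg, Real.sin_nat_mul_pi]
    ring
  have hsum : ∫ t in (-Real.pi)..Real.pi, q t =
      2 * Real.pi * d₁ - (d₁ / 2 * A + 1 / 2 * Q) - 2 * Real.pi * d₂ := by
    rw [intervalIntegral.integral_congr fun t _ => hpt t, intervalIntegral.integral_sub _ hgi,
      intervalIntegral.integral_sub, hcos, intervalIntegral.integral_add,
      intervalIntegral.integral_const_mul, intervalIntegral.integral_const_mul,
      integral_im_eq_degree hd hG hP]
    exacts [hA1.intervalIntegrable _ _, hA2.intervalIntegrable _ _, hcc.intervalIntegrable _ _,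
      (hA1.add hA2).intervalIntegrable _ _,
      (hcc.sub (hA1.add hA2)).intervalIntegrable _ _]
  have habs : 2 * Real.pi * |(d₁ : ℝ) - d₂| =
      |(∫ t in (-Real.pi)..Real.pi, q t) + (d₁ / 2 * A + 1 / 2 * Q)| := by
    rw [hsum, ← abs_of_pos (show 0 < 2 * Real.pi by positivity), ← abs_mul]
    rw [abs_of_pos (show 0 < 2 * Real.pi by positivity)]
    congr 1
    ring
  rw [habs]
  refine (abs_add_le _ _).trans ?_
  have h5 := abs_add_le (d₁ / 2 * A) (1 / 2 * Q)
  rw [abs_mul, abs_mul, abs_of_nonneg hA0, abs_div, abs_two,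
    abs_of_pos (one_half_pos (α := ℝ))] at h5
  linarith

theorem exists_forall_dist_ge (d₁ d₂ : ℤ) {κ : ℝ} (hκ : 0 < κ) (hκ1 : κ ≤ 1) :
    ∃ f ∈ degreeClass 1 1 d₁, ∀ g ∈ degreeClass 1 1 d₂,
      ENNReal.ofReal (2 * Real.pi * |(d₁ : ℝ) - d₂|) ≤
        ENNReal.ofReal (1 + κ) * seminorm 1 1 fun z => (f z : ℂ) - g z := by
  have hpi := Real.pi_pos
  -- The integration by parts costs `2δ = κ/2`; the other `κ/2` is left for the term in `|d₁|`,
  -- small for `n` large. `κ ≤ 1` keeps `δ` below `π`, where `cos δ < 1`.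
  set δ := κ / 4 with hδ
  have hδ0 : 0 < δ := by positivity
  have hcos : 0 < 1 - Real.cos δ := by
    have := Real.cos_lt_cos_of_nonneg_of_le_pi le_rfl (by linarith [Real.pi_gt_three]) hδ0
    rw [Real.cos_zero] at this
    linarith
  obtain ⟨n, hn, hγ, hn2⟩ : ∃ n : ℕ, 0 < n ∧
      0 < 1 - Real.cos (δ + d₁ * Real.pi / (2 * n)) ∧
      |(d₁ : ℝ)| / 2 * (20 * (2 * (2 * Real.pi / n)) /
        (1 - Real.cos (δ + d₁ * Real.pi / (2 * n)))) < κ / 2 := by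
    have h1 : Tendsto (fun n : ℕ => 1 - Real.cos (δ + d₁ * Real.pi / (2 * n))) atTop
        (𝓝 (1 - Real.cos δ)) := by
      have h2 := (tendsto_const_div_atTop_nhds_zero_nat (d₁ * Real.pi / 2)).const_add δ
      rw [add_zero] at h2
      have h3 := ((Real.continuous_cos.tendsto δ).comp h2).const_sub 1
      refine h3.congr fun n => ?_
      simp only [Function.comp_apply, div_div]
    have h4 := ((tendsto_const_div_atTop_nhds_zero_nat (80 * Real.pi)).div h1 hcos.ne').const_mul
      (|(d₁ : ℝ)| / 2)
    rw [zero_div, mul_zero] at h4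
    obtain ⟨n, h5, h6, h7⟩ := ((eventually_gt_atTop 0).and ((h1.eventually
      (lt_mem_nhds hcos)).and (h4.eventually (gt_mem_nhds (half_pos hκ))))).exists
    refine ⟨n, h5, h6, ?_⟩
    refine lt_of_eq_of_lt ?_ h7
    simp only [Pi.div_apply]
    ring
  refine ⟨wiggle d₁ δ n, (isPhase_wiggle d₁ δ n).mem_degreeClass (contDiff_wigglePhase d₁ δ n)
    one_pos le_rfl, fun g hg => ?_⟩
  have hs : IsSmooth fun z => (wiggle d₁ δ n z : ℂ) :=
    (isPhase_wiggle d₁ δ n).isSmooth (contDiff_wigglePhase d₁ δ n)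
  have hw := isWeakDeriv_weakDeriv (memSobolev_one_one_iff.1 hg.1)
  set g' := weakDeriv fun z => (g z : ℂ) with hg'
  obtain ⟨G, hGc, hgG, hP⟩ := hw.exists_primitive
  have hG := norm_eq_one_of_ae_eq hGc hgG
  have hdeg := (hasDegree_iff_of_ae_eq hGc hgG).1 hg.2
  rw [(hs.isWeakDeriv.sub hw).seminorm_one_one]
  set γ := 1 - Real.cos (δ + d₁ * Real.pi / (2 * n)) with hγdef
  have hvi : Integrable (fun z => circleDeriv (fun z => (wiggle d₁ δ n z : ℂ)) z - g' z)
      arcLength := (integrable_of_continuous hs.circleDeriv.continuous).sub hw.2.1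
  have hVc : Continuous fun z => (wiggle d₁ δ n z : ℂ) - G z := hs.continuous.sub hGc
  have h1 := two_pi_mul_abs_sub_le hδ0.le n (d₁ := d₁) hdeg hG hP
  rw [← integral_arcLength fun z => ‖circleDeriv (fun z => (wiggle d₁ δ n z : ℂ)) z - g' z‖,
    ← integral_arcLength fun z => ‖(wiggle d₁ δ n z : ℂ) - G z‖ ^ 2] at h1
  have h2 := lintegral_norm_sq_wiggle_sub_le (d := d₁) (δ := δ) hn hG hw.2.1 hP
  rw [← hγdef] at h2
  set B := ∫ z, ‖circleDeriv (fun z => (wiggle d₁ δ n z : ℂ)) z - g' z‖ ∂arcLength with hB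
  set A := ∫ z, ‖(wiggle d₁ δ n z : ℂ) - G z‖ ^ 2 ∂arcLength with hA
  have hB0 : 0 ≤ B := integral_nonneg fun z => norm_nonneg _
  have hBe : ∫⁻ z, ‖circleDeriv (fun z => (wiggle d₁ δ n z : ℂ)) z - g' z‖ₑ ∂arcLength =
      ENNReal.ofReal B := (ofReal_integral_norm_eq_lintegral_enorm hvi).symm
  have hVi : Integrable (fun z => γ * ‖(wiggle d₁ δ n z : ℂ) - G z‖ ^ 2) arcLength := by
    have hc : Continuous fun z => γ * ‖(wiggle d₁ δ n z : ℂ) - G z‖ ^ 2 :=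
      continuous_const.mul (hVc.norm.pow 2)
    obtain ⟨C, hC⟩ := isCompact_univ.exists_bound_of_continuousOn hc.continuousOn
    exact Integrable.of_bound hc.aestronglyMeasurable C (Eventually.of_forall fun z => hC z trivial)
  rw [← ofReal_integral_eq_lintegral_ofReal hVi (Eventually.of_forall fun z => by positivity),
    integral_const_mul, hBe, ← ENNReal.ofReal_mul (by positivity),
    ENNReal.ofReal_le_ofReal_iff (by positivity), ← hA] at h2
  rw [hBe, ← ENNReal.ofReal_mul (by positivity)]
  refine ENNReal.ofReal_le_ofReal (h1.trans ?_)
  have h3 : A ≤ 20 * (2 * (2 * Real.pi / n)) / γ * B := by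
    rw [div_mul_eq_mul_div, le_div_iff₀ hγ]
    linarith
  have h4 : |(d₁ : ℝ)| / 2 * A ≤ κ / 2 * B := by
    calc _ ≤ |(d₁ : ℝ)| / 2 * (20 * (2 * (2 * Real.pi / n)) / γ * B) := by gcongr
      _ = |(d₁ : ℝ)| / 2 * (20 * (2 * (2 * Real.pi / n)) / γ) * B := by ring
      _ ≤ _ := by gcongr
  rw [hδ]
  linarith

theorem dist_one_one_eq (d₁ d₂ : ℤ) :
    Dist (seminorm 1 1) 1 1 d₁ d₂ = ENNReal.ofReal (2 * Real.pi * |(d₁ : ℝ) - d₂|) := by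
  refine (dist_one_one_le d₁ d₂).antisymm ?_
  have hlim : Tendsto (fun j : ℕ => ENNReal.ofReal (1 + 1 / (j + 1 : ℝ)) *
      Dist (seminorm 1 1) 1 1 d₁ d₂) atTop (𝓝 (1 * Dist (seminorm 1 1) 1 1 d₁ d₂)) := by
    refine ENNReal.Tendsto.mul_const ?_ (Or.inl one_ne_zero)
    have h1 := (tendsto_one_div_add_atTop_nhds_zero_nat (𝕜 := ℝ)).const_add 1
    simpa using ENNReal.tendsto_ofReal h1
  rw [one_mul] at hlim
  refine ge_of_tendsto' hlim fun j => ?_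
  obtain ⟨f, hf, h⟩ := exists_forall_dist_ge d₁ d₂ (κ := 1 / (j + 1 : ℝ)) (by positivity)
    (by rw [div_le_one (by positivity)]; linarith [(Nat.cast_nonneg j : (0 : ℝ) ≤ j)])
  have hc0 : ENNReal.ofReal (1 + 1 / (j + 1 : ℝ)) ≠ 0 := by
    rw [Ne, ENNReal.ofReal_eq_zero, not_le]
    positivity
  rw [mul_comm (ENNReal.ofReal (1 + _)),
    ← ENNReal.div_le_iff_le_mul (Or.inl hc0) (Or.inl ENNReal.ofReal_ne_top)]
  refine le_trans (le_iInf₂ fun g hg => ?_) (le_iSup₂ (f := fun (f : Circle → Circle)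
    (_ : f ∈ degreeClass 1 1 d₁) => ⨅ g ∈ degreeClass 1 1 d₂,
      seminorm 1 1 fun z => (f z : ℂ) - g z) f hf)
  rw [ENNReal.div_le_iff_le_mul (Or.inl hc0) (Or.inl ENNReal.ofReal_ne_top),
    mul_comm (seminorm _ _ _)]
  exact h g hg

end CircleSobolev

theorem theorem1p3 :
    -- `W^{1,1}`, with the distance `∫ |f' - g'|`
    (∀ d₁ d₂ : ℤ, CircleSobolev.Dist (CircleSobolev.seminorm 1 1) 1 1 d₁ d₂ =
      ENNReal.ofReal (2 * Real.pi * |(d₁ : ℝ) - d₂|)) ∧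
    -- `W^{1/p,p}`, with the Gagliardo distance, and with any norm taken modulo the mean
    (∀ p : ℝ, 1 < p →
      (∃ C : ℝ≥0, ∀ d₁ d₂ : ℤ,
        CircleSobolev.HDist (CircleSobolev.gagliardo (1 / p) p) (1 / p) p d₁ d₂ ≤
          C * ENNReal.ofReal (|(d₁ : ℝ) - d₂| ^ (1 / p))) ∧
      ∀ N : (Circle → ℂ) → ℝ≥0∞, CircleSobolev.IsComparableToNorm (1 / p) p N →
        ∃ C : ℝ≥0, ∀ d₁ d₂ : ℤ,
          CircleSobolev.HDist (CircleSobolev.moduloMean N) (1 / p) p d₁ d₂ ≤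
            C * ENNReal.ofReal (|(d₁ : ℝ) - d₂| ^ (1 / p))) ∧
    -- `W^{s,p}` with `sp > 1`, with the top-order distance, and with any norm modulo the mean
    (∀ s p : ℝ, 0 < s → 1 ≤ p → 1 < s * p → ∀ d₁ d₂ : ℤ, d₁ ≠ d₂ →
      CircleSobolev.Dist (CircleSobolev.seminorm s p) s p d₁ d₂ = ⊤ ∧
      ∀ N : (Circle → ℂ) → ℝ≥0∞, CircleSobolev.IsComparableToNorm s p N →
        CircleSobolev.Dist (CircleSobolev.moduloMean N) s p d₁ d₂ = ⊤) := by
  refine ⟨CircleSobolev.dist_one_one_eq, fun p hp => ⟨?_, fun N hN => ?_⟩,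
    fun s p hs hp hsp d₁ d₂ hd => ⟨?_, fun N hN => ?_⟩⟩
  · exact CircleSobolev.exists_hdist_le (CircleSobolev.exists_dist_gagliardo_le hp)
  · exact CircleSobolev.exists_hdist_le (CircleSobolev.exists_dist_moduloMean_le hp hN)
  · exact CircleSobolev.dist_seminorm_eq_top hs hp hsp hd
  · exact CircleSobolev.dist_moduloMean_eq_top hs hp hsp hd hN
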